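/- **Setup.** For each $n$ let $(Y_i,X_i,Z_i)$, $i=1,\dots,n$, be i.i.d. copies of $(Y,X,Z)\in\mathbb R\times\mathbb R\times\mathbb R^{d_n}$. The law of $X$ is fixed, with Lebesgue density $f_X$; the conditional law of $(Y,Z)$ given $X=x$ (a fixed Markov kernel, with respect to which all conditional moments given $X=x$ are taken) and $d_n$ may depend on $n$. Let $\mathcal X$ be the support of $X$, $\mathcal X_h=\mathcal X\cap[-h,h]$, and $\tau=\lim_{x\downarrow0}\mathbb E[Y|X=x]-\lim_{x\uparrow0}\mathbb E[Y|X=x]$. For $\eta:\mathbb R^{d_n}\to\mathbb R$ put $M_i(\eta)=Y_i-\eta(Z_i)$ and $M(\eta)=Y-\eta(Z)$. Independently of the data, the indices are randomly split into a fixed number $S$ of folds $I_1,\dots,I_S$ of equal size (up to one unit); $s(i)$ is the fold of $i$, and $\hat\eta_s$ is a measurable estimator computed from $\{(Y_i,X_i,Z_i)\}_{i\notin I_s}$. For a kernel $K$ and bandwidth $h=h_n>0$ let $K_h(u)=K(u/h)/h$, $K_h^+(u)=K_h(u)1\{u\ge0\}$, $K^-_h(u)=K_h(u)1\{u<0\}$,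 $\widetilde X_{i}=(1,X_i)^\top$, and for $v\in\{0,1\}$ let $w_{i,v}=w_{i,v}^+-w_{i,v}^-$ with $$w_{i,v}^\star=e_v^\top\Big(\sum_j K_h^\star(X_j)\widetilde X_{j}\widetilde X_{j}^\top\Big)^{-1}K_h^\star(X_i)\widetilde X_{i},\qquad e_0=(1,0)^\top,\ e_1=(0,1)^\top,$$ and $w_i(h)=w_{i,0}$. Let $\mathcal R_i$ be the set of the $R$ nearest neighbours $j\ne i$ of $i$ in terms of $X$ on the same side of $0$, with $R\geq1$ fixed. Put $$\hat\tau=\sum_i w_i(h)M_i(\hat\eta_{s(i)}),\quad \widehat{se}^2=\sum_i w_i(h)^2\Big(M_i(\hat\eta_{s(i)})-\tfrac1R\sum_{j\in\mathcal R_i}M_j(\hat\eta_{s(j)})\Big)^2,\quad \bar b(h)=-\frac{B_Y}2\sum_i w_i(h)X_i^2\operatorname{sign}(X_i),$$ let $z_{\gamma}^{*}(r)$ be the $\gamma$-quantile of $|N(r,1)|$, and $CI(\gamma)=\big[\hat\tau\pm z^*_\gamma(\bar b(h)/\widehat{se})\,\widehat{se}\big]$. **Assumptions.** Let $\mathcal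 E$ be the class of measurable $\eta$ such that $\mathbb E[\eta(Z)|X=x]$ exists and is twice continuously differentiable in $x$ in a neighbourhood of $0$. There are sets $\mathcal T_n\subset\mathcal E$ and functions $\bar\eta=\bar\eta_n\in\mathcal T_n$ such that: 1. $\mathbb P(\hat\eta_s\in\mathcal T_n)\to1$ for every $s$, and $\sup_{\eta\in\mathcal T_n}\sup_{x\in\mathcal X_h}\mathbb E[(\eta(Z)-\bar\eta(Z))^2|X=x]=O(r_n^2)$ for some $r_n=o(1)$. 2. For $j=1,2$: $\partial_x^j\mathbb E[\eta(Z)-\bar\eta(Z)|X=x]$ exists for $\eta\in\mathcal T_n$ and $x\in\mathcal X_h\setminus\{0\}$, for $n$ large, and is $O(v_{j,n})$ uniformly in such $\eta,x$, for some $v_{j,n}=o(1)$. 3. $f_X$ is continuous and bounded away from $0$ on an open neighbourhood of $0$; $K$ is a bounded symmetric probability density, continuous on its support and zero outside $[-1,1]$; $h\to0$ and $nh\to\infty$. 4. For constants $C>0$, $L$, $q>2$ not depending on $n$: $\mathbb E[M(\bar\eta)|X=x]$ is twice continuously differentiable on $\mathcal X\setminus\{0\}$ with second derivative bounded by $C$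 and $L$-Lipschitz on each side of $0$; $\mathbb E[|M(\bar\eta)-\mathbb E[M(\bar\eta)|X]|^q|X=x]\le C$ on $\mathcal X$; $\mathbb V[M(\bar\eta)|X=x]$ is $L$-Lipschitz on each side of $0$ and at least $1/C$ on $\mathcal X\setminus\{0\}$. 5. For $v\in\{0,1\}$, $\sum_i w_{i,v}^2\iota_i=o_P((nh^{1+2v})^{-1})$, where, with $\Delta_i=\hat\eta_{s(i)}(Z_i)-\bar\eta(Z_i)$, $\iota_i=\sum(\Delta_i-\Delta_j)(M_i(\bar\eta)-M_l(\bar\eta))$ over the pairs $(j,l)\in\mathcal R_i^2$ with $(j,l)\notin I_{s(i)}^2$. 6. There are open sets $\widetilde{\mathcal X}_h\supset\mathcal X_h$ such that condition 1 holds (possibly with another rate $r_n=o(1)$) with $\mathcal X_h$ replaced by $\mathcal X\cap\widetilde{\mathcal X}_h$, and $\mathbb E[(M(\eta)-\mathbb E[M(\eta)|X])^4|X=x]\le B$ for all $n$, $\eta\in\mathcal T_n$, $x\in\mathcal X\cap\widetilde{\mathcal X}_h$, with $B$ not depending on $n$; and $\mathbb E[M(\bar\eta)|X=x]$ and $\mathbb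 V[M(\bar\eta)|X=x]$ are Lipschitz in $x$ on each side of $0$, with a constant not depending on $n$. 7. For every $n$, $|\partial_x^2\mathbb E[Y|X=x]|\le B_Y$ for all $x\ne0$ in some neighbourhood of $0$, where $B_Y$ does not depend on $n$. **Proposition.** Let $\alpha\in(0,1)$. If conditions 1–7 hold and $nh^5=O(1)$, then $$\mathbb P\big(\tau\in CI(1-\alpha/2)\big)\ge1-\alpha+o(1).$$ Moreover, if $\alpha\le1/2$, then the same bound holds for the shorter interval based on the $1-\alpha$ quantile of $|N(r,1)|$: $\mathbb P(\tau\in CI(1-\alpha))\ge1-\alpha+o(1)$. -/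

import Mathlib

open MeasureTheory ProbabilityTheory Filter Topology Set

noncomputable section

/-! ### Sampling model -/

/-- A sequence of sharp regression discontinuity designs with cutoff `0`. The running variable has
a fixed Lebesgue density; the conditional law of `(Y, Z)` given `X = x`, as well as the dimension of
`Z`, may change with the sample size `n`. -/
structure RDDesign where
  /-- Lebesgue density of the running variable. -/
  fX : ℝ → ℝ
  measurable_fX : Measurable fX
  fX_nonneg : ∀ x, 0 ≤ fX x
  lintegral_fX : ∫⁻ x, ENNReal.ofReal (fX x) = 1
  /-- Number of covariates. -/
  dim : ℕ → ℕ
  /-- Conditional law of `(Y, Z)` given `X = x`. -/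
  condLaw : (n : ℕ) → Kernel ℝ (ℝ × (Fin (dim n) → ℝ))
  markov : ∀ n, IsMarkovKernel (condLaw n)

namespace RDDesign

variable (D : RDDesign)

instance (n : ℕ) : IsMarkovKernel (D.condLaw n) := D.markov n

/-- Covariate values at sample size `n`. -/
abbrev Cov (n : ℕ) : Type := Fin (D.dim n) → ℝ

/-- One observation `(X, (Y, Z))`. -/
abbrev Obs (n : ℕ) : Type := ℝ × (ℝ × D.Cov n)

/-- Law of the running variable. -/
def lawX : Measure ℝ := volume.withDensity fun x => ENNReal.ofReal (D.fX x)

instance : IsProbabilityMeasure D.lawX :=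
  ⟨by simp [lawX, D.lintegral_fX]⟩

/-- Law of one observation. -/
def obsLaw (n : ℕ) : Measure (D.Obs n) := D.lawX ⊗ₘ D.condLaw n

instance (n : ℕ) : IsProbabilityMeasure (D.obsLaw n) := by
  unfold obsLaw; infer_instance

/-- Support of the running variable. -/
def suppX : Set ℝ := D.lawX.support

/-- `suppX ∩ [-b, b]`. -/
def suppXh (b : ℝ) : Set ℝ := D.suppX ∩ Icc (-b) b

/-- `x ↦ E[g(Y, Z) | X = x]`. -/
def condMean (n : ℕ) (g : ℝ × D.Cov n → ℝ) (x : ℝ) : ℝ := ∫ p, g p ∂(D.condLaw n x)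

/-- The outcome `Y` as a function of `(Y, Z)`. -/
def outcome (n : ℕ) (p : ℝ × D.Cov n) : ℝ := p.1

/-- The covariate-adjusted outcome `M(η) = Y - η(Z)` as a function of `(Y, Z)`. -/
def adj {n : ℕ} (η : D.Cov n → ℝ) (p : ℝ × D.Cov n) : ℝ := p.1 - η p.2

/-- `x ↦ E[η(Z) | X = x]`. -/
def covMean {n : ℕ} (η : D.Cov n → ℝ) (x : ℝ) : ℝ := D.condMean n (fun p => η p.2) x

/-- `x ↦ E[M(η) | X = x]`. -/
def adjMean {n : ℕ} (η : D.Cov n → ℝ) (x : ℝ) : ℝ := D.condMean n (D.adj η) x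

/-- `x ↦ V[M(η) | X = x]`. -/
def adjVar {n : ℕ} (η : D.Cov n → ℝ) (x : ℝ) : ℝ :=
  D.condMean n (fun p => (D.adj η p - D.adjMean η x) ^ 2) x

/-- The RD parameter `τ = E[Y | X = 0⁺] - E[Y | X = 0⁻]`, with one-sided limits. -/
def tau (n : ℕ) : ℝ :=
  limUnder (𝓝[>] (0 : ℝ)) (D.condMean n (D.outcome n)) -
    limUnder (𝓝[<] (0 : ℝ)) (D.condMean n (D.outcome n))

/-- The class of admissible adjustment functions: `E[η(Z) | X = x]` exists and is twice
continuously differentiable around the cutoff. -/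
def Admissible {n : ℕ} (η : D.Cov n → ℝ) : Prop :=
  Measurable η ∧ ∃ ε > 0,
    (∀ x ∈ Ioo (-ε) ε, Integrable (fun p : ℝ × D.Cov n => η p.2) (D.condLaw n x)) ∧
    ContDiffOn ℝ 2 (D.covMean η) (Ioo (-ε) ε)

end RDDesign

/-- A cross-fitted first stage with `S` folds: a random split of the sample that is independent of
the data and has folds of equal size (up to one unit, when `S` does not divide `n`), and an
estimator that maps a subsample, indexed by `J`, to an adjustment function. -/
structure CrossFit (D : RDDesign) (S : ℕ) where
  /-- Law of the map `i ↦ s(i)` that assigns units to folds. -/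
  foldLaw : (n : ℕ) → Measure (Fin n → Fin S)
  prob : ∀ n, IsProbabilityMeasure (foldLaw n)
  balanced : ∀ n, ∀ᵐ s ∂(foldLaw n), ∀ k : Fin S,
    n / S ≤ (Finset.univ.filter fun i => s i = k).card ∧
      (Finset.univ.filter fun i => s i = k).card ≤ n / S + 1
  /-- The first-stage estimator `η̂(z; {W_i}_{i ∈ J})`. -/
  est : (n : ℕ) → (J : Finset (Fin n)) → ({i // i ∈ J} → D.Obs n) → D.Cov n → ℝ
  measurable_est : ∀ n J, Measurable fun p : ({i // i ∈ J} → D.Obs n) × D.Cov n => est n J p.1 p.2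

/-- A sample of size `n` together with its split into folds. -/
abbrev Sample (D : RDDesign) (S n : ℕ) : Type := (Fin n → D.Obs n) × (Fin n → Fin S)

namespace CrossFit

variable {D : RDDesign} {S : ℕ} (F : CrossFit D S)

instance (n : ℕ) : IsProbabilityMeasure (F.foldLaw n) := F.prob n

/-- Joint law of an i.i.d. sample and the independent random split. -/
def sampleLaw (n : ℕ) : Measure (Sample D S n) :=
  (Measure.pi fun _ : Fin n => D.obsLaw n).prod (F.foldLaw n)

instance (n : ℕ) : IsProbabilityMeasure (F.sampleLaw n) := by
  unfold sampleLaw; infer_instance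

/-- `η̂_k`, computed from the data outside of fold `k`. -/
def foldEst {n : ℕ} (ω : Sample D S n) (k : Fin S) : D.Cov n → ℝ :=
  F.est n (Finset.univ.filter fun i => ω.2 i ≠ k) fun i => ω.1 i

/-- `M_i(η̂_{s(i)})`. -/
def adjHat {n : ℕ} (ω : Sample D S n) (i : Fin n) : ℝ :=
  D.adj (F.foldEst ω (ω.2 i)) (ω.1 i).2

end CrossFit

/-! ### Local polynomial weights -/

/-- `K_b(v) = K(v / b) / b`. -/
def scaledKernel (K : ℝ → ℝ) (b v : ℝ) : ℝ := K (v / b) / b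

open Classical in
/-- `K_b` restricted to one side `A` of the cutoff, where `A` is `[0, ∞)` or `(-∞, 0)`. -/
def sideKernel (K : ℝ → ℝ) (b : ℝ) (A : Set ℝ) (v : ℝ) : ℝ :=
  if v ∈ A then scaledKernel K b v else 0

/-- `(1, x, …, x^p)`. -/
def polyVec (p : ℕ) (x : ℝ) : Fin (p + 1) → ℝ := fun j => x ^ (j : ℕ)

/-- The matrix `∑ᵢ K_b^A(X_i) X̃_{p,i} X̃_{p,i}ᵀ`. -/
def gramMatrix (K : ℝ → ℝ) (b : ℝ) (A : Set ℝ) (p : ℕ) {n : ℕ} (X : Fin n → ℝ) :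
    Matrix (Fin (p + 1)) (Fin (p + 1)) ℝ :=
  ∑ i, sideKernel K b A (X i) • Matrix.vecMulVec (polyVec p (X i)) (polyVec p (X i))

/-- One-sided weights `e_vᵀ (∑ᵢ K_b^A(X_i) X̃_{p,i} X̃_{p,i}ᵀ)⁻¹ K_b^A(X_i) X̃_{p,i}`. -/
def sideWeight (K : ℝ → ℝ) (b : ℝ) (A : Set ℝ) {p : ℕ} (v : Fin (p + 1)) {n : ℕ}
    (X : Fin n → ℝ) (i : Fin n) : ℝ :=
  ((gramMatrix K b A p X)⁻¹.mulVec (sideKernel K b A (X i) • polyVec p (X i))) v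

/-- The weights `w_{i,v,p}(b)` of the RD local polynomial regression of order `p`. -/
def rdWeight (K : ℝ → ℝ) (b : ℝ) {p : ℕ} (v : Fin (p + 1)) {n : ℕ}
    (X : Fin n → ℝ) (i : Fin n) : ℝ :=
  sideWeight K b (Ici 0) v X i - sideWeight K b (Iio 0) v X i

open Classical in
/-- The `R` nearest neighbours of unit `i`, in terms of the running variable, among the other units
on the same side of the cutoff: those `j` to which fewer than `R` such units are strictly
preferred. -/
def neighbors (R : ℕ) {n : ℕ} (X : Fin n → ℝ) (i : Fin n) : Finset (Fin n) :=
  Finset.univ.filter fun j => j ≠ i ∧ (0 ≤ X j ↔ 0 ≤ X i) ∧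
    (Finset.univ.filter fun k => k ≠ i ∧ (0 ≤ X k ↔ 0 ≤ X i) ∧
      |X k - X i| < |X j - X i|).card < R

/-! ### Estimator, standard error and confidence interval -/

/-- The `γ`-quantile of `|N(r, 1)|`. -/
def absNormalQuantile (γ r : ℝ) : ℝ :=
  sInf {t : ℝ | γ ≤ (gaussianReal r 1).real {y | |y| ≤ t}}

namespace CrossFit

variable {D : RDDesign} {S : ℕ} (F : CrossFit D S)

/-- Realizations of the running variable. -/
def runX {n : ℕ} (ω : Sample D S n) : Fin n → ℝ := fun i => (ω.1 i).1

/-- The estimator `τ̂_{v,p}(b; η̂) = ∑ᵢ w_{i,v,p}(b) M_i(η̂_{s(i)})`. -/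
def tauHat (K : ℝ → ℝ) (b : ℝ) {p : ℕ} (v : Fin (p + 1)) {n : ℕ} (ω : Sample D S n) : ℝ :=
  ∑ i, rdWeight K b v (runX ω) i * F.adjHat ω i

/-- Nearest-neighbour variance estimator of unit `i`. -/
def sigmaSqHat (R : ℕ) {n : ℕ} (ω : Sample D S n) (i : Fin n) : ℝ :=
  (F.adjHat ω i - (∑ j ∈ neighbors R (runX ω) i, F.adjHat ω j) / R) ^ 2

/-- The nearest-neighbour standard error of `τ̂_{v,p}(b; η̂)`. -/
def seHat (K : ℝ → ℝ) (R : ℕ) (b : ℝ) {p : ℕ} (v : Fin (p + 1)) {n : ℕ}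
    (ω : Sample D S n) : ℝ :=
  √(∑ i, rdWeight K b v (runX ω) i ^ 2 * F.sigmaSqHat R ω i)

/-- The worst-case bias bound `b̄(b) = -(B_Y / 2) ∑ᵢ w_i(b) X_i² sign(X_i)`, where `w_i(b)` are the
local linear weights. -/
def biasBound (K : ℝ → ℝ) (BY b : ℝ) {n : ℕ} (ω : Sample D S n) : ℝ :=
  -(BY / 2) * ∑ i, rdWeight K b (0 : Fin (1 + 1)) (runX ω) i *
    runX ω i ^ 2 * Real.sign (runX ω i)

/-- The bias-aware interval `τ̂ ± z ŝe`, where `z` is the `γ`-quantile of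
`|N(b̄ / ŝe, 1)|`. -/
def ciBiasAware (K : ℝ → ℝ) (R : ℕ) (BY b γ : ℝ) {n : ℕ} (ω : Sample D S n) : Set ℝ :=
  let est := F.tauHat K b (0 : Fin (1 + 1)) ω
  let se := F.seHat K R b (0 : Fin (1 + 1)) ω
  let z := absNormalQuantile γ (biasBound K BY b ω / se)
  Icc (est - z * se) (est + z * se)

open Classical in
/-- The term `ι_i(η̂)`: the sum over those pairs `(j, l)` of neighbours of `i` that do not both lie
in the fold of `i`. -/
def iota (R : ℕ) {n : ℕ} (ηbar : D.Cov n → ℝ) (ω : Sample D S n) (i : Fin n) : ℝ :=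
  let Δ := fun j => F.foldEst ω (ω.2 j) (ω.1 j).2.2 - ηbar (ω.1 j).2.2
  ∑ q ∈ (neighbors R (runX ω) i ×ˢ neighbors R (runX ω) i).filter
      (fun q => ¬(ω.2 q.1 = ω.2 i ∧ ω.2 q.2 = ω.2 i)),
    (Δ i - Δ q.1) * (D.adj ηbar (ω.1 i).2 - D.adj ηbar (ω.1 q.2).2)

end CrossFit

/-! ### Assumptions -/

/-- `f` is `L`-Lipschitz on the part of `A` to the left and on the part of `A` to the right of the
cutoff. -/
def LipschitzEachSide (L : ℝ) (f : ℝ → ℝ) (A : Set ℝ) : Prop :=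
  ∀ x ∈ A, ∀ y ∈ A, 0 < x * y → |f x - f y| ≤ L * |x - y|

section Assumptions

variable (D : RDDesign) {S : ℕ} (F : CrossFit D S)
  (T : (n : ℕ) → Set (D.Cov n → ℝ)) (ηbar : (n : ℕ) → D.Cov n → ℝ) (h : ℕ → ℝ)

/-- The realization sets `T n` consist of admissible functions, contain `ηbar n`, contain the
first-stage estimates with probability approaching one, and contract around `ηbar n` in conditional
mean square, uniformly over `x` in the region `A n`. -/
structure FirstStage (A : ℕ → Set ℝ) : Prop where
  admissible : ∀ n, ∀ η ∈ T n, D.Admissible η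
  bar_mem : ∀ n, ηbar n ∈ T n
  mem : ∀ k : Fin S,
    Tendsto (fun n => F.sampleLaw n {ω | F.foldEst ω k ∉ T n}) atTop (𝓝 0)
  rate : ∃ r : ℕ → ℝ, Tendsto r atTop (𝓝 0) ∧ ∃ c : ℝ, ∀ᶠ n in atTop,
    ∀ η ∈ T n, ∀ x ∈ A n,
      ∫⁻ p, ENNReal.ofReal ((η p.2 - ηbar n p.2) ^ 2) ∂(D.condLaw n x) ≤
        ENNReal.ofReal (c * r n ^ 2)

/-- For `j = 1, …, J`, the `j`-th derivative of `x ↦ E[η(Z) - η̄(Z) | X = x]` exists on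
`𝒳_h \ {0}` and is `O(v_{j,n})` with `v_{j,n} = o(1)`, uniformly over `η` in the realization set. -/
def Derivatives (J : ℕ) : Prop :=
  ∀ j < J, ∃ v : ℕ → ℝ, Tendsto v atTop (𝓝 0) ∧ ∃ c : ℝ, ∀ᶠ n in atTop,
    ∀ η ∈ T n, ∀ x ∈ D.suppXh (h n) \ {0},
      DifferentiableWithinAt ℝ
        (iteratedDerivWithin j (D.covMean fun z => η z - ηbar n z) (D.suppX \ {0}))
        (D.suppX \ {0}) x ∧
      |iteratedDerivWithin (j + 1) (D.covMean fun z => η z - ηbar n z) (D.suppX \ {0}) x| ≤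
        c * |v n|

/-- Regularity of the density of the running variable, the kernel and the bandwidth. -/
structure Regularity (K : ℝ → ℝ) : Prop where
  density : ∃ U : Set ℝ, IsOpen U ∧ (0 : ℝ) ∈ U ∧ ContinuousOn D.fX U ∧
    ∃ c > 0, ∀ x ∈ U, c ≤ D.fX x
  kernel_measurable : Measurable K
  kernel_nonneg : ∀ u, 0 ≤ K u
  kernel_integral : ∫ u, K u = 1
  kernel_bounded : ∃ c, ∀ u, K u ≤ c
  kernel_symm : ∀ u, K (-u) = K u
  kernel_continuous : ContinuousOn K (Function.support K)
  kernel_zero : ∀ u, u ∉ Icc (-1 : ℝ) 1 → K u = 0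
  bandwidth_pos : ∀ n, 0 < h n
  bandwidth_zero : Tendsto h atTop (𝓝 0)
  effective_size : Tendsto (fun n : ℕ => (n : ℝ) * h n) atTop atTop

/-- Regularity of the conditional moments of `M(η̄)` given the running variable, with constants
that do not depend on the sample size. -/
def MomentRegularity : Prop :=
  ∃ C > 0, ∃ L : ℝ, ∃ q > (2 : ℝ), ∀ n,
    (∀ x ∈ D.suppX, Integrable (D.adj (ηbar n)) (D.condLaw n x)) ∧
    ContDiffOn ℝ 2 (D.adjMean (ηbar n)) (D.suppX \ {0}) ∧
    LipschitzEachSide L (iteratedDerivWithin 2 (D.adjMean (ηbar n)) (D.suppX \ {0}))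
      (D.suppX \ {0}) ∧
    (∀ x ∈ D.suppX \ {0},
      |iteratedDerivWithin 2 (D.adjMean (ηbar n)) (D.suppX \ {0}) x| ≤ C) ∧
    (∀ x ∈ D.suppX,
      ∫⁻ p, ENNReal.ofReal (|D.adj (ηbar n) p - D.adjMean (ηbar n) x| ^ q) ∂(D.condLaw n x) ≤
        ENNReal.ofReal C) ∧
    LipschitzEachSide L (D.adjVar (ηbar n)) (D.suppX \ {0}) ∧
    (∀ x ∈ D.suppX \ {0}, 1 / C ≤ D.adjVar (ηbar n) x)

/-- The additional technical condition for nearest-neighbour standard errors: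
`∑ᵢ w_{i,v,p}(h)² ι_i(η̂) = o_P((n h^{1+2v})⁻¹)` for `0 ≤ v ≤ p`. -/
def NeighborCondition (K : ℝ → ℝ) (R p : ℕ) : Prop :=
  ∀ v : Fin (p + 1), ∀ ε > 0,
    Tendsto (fun n => F.sampleLaw n {ω | ε < |(n : ℝ) * h n ^ (1 + 2 * (v : ℕ)) *
      ∑ i, rdWeight K (h n) v (CrossFit.runX ω) i ^ 2 * F.iota R (ηbar n) ω i|})
      atTop (𝓝 0)

/-- The remaining conditions for nearest-neighbour standard errors: the first-stage assumption
also holds on open sets `A n ⊇ 𝒳_h`, on which conditional fourth moments of `M(η)` are bounded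
uniformly over the realization sets, and the conditional mean and variance of `M(η̄)` are Lipschitz
on each side of the cutoff. -/
def StdErrConditions : Prop :=
  (∃ A : ℕ → Set ℝ, (∀ n, IsOpen (A n) ∧ D.suppXh (h n) ⊆ A n) ∧
    FirstStage D F T ηbar (fun n => D.suppX ∩ A n) ∧
    ∃ B : ℝ, ∀ n, ∀ η ∈ T n, ∀ x ∈ D.suppX ∩ A n,
      ∫⁻ p, ENNReal.ofReal ((D.adj η p - D.adjMean η x) ^ 4) ∂(D.condLaw n x) ≤
        ENNReal.ofReal B) ∧
  ∃ L : ℝ, ∀ n, LipschitzEachSide L (D.adjMean (ηbar n)) (D.suppX \ {0}) ∧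
    LipschitzEachSide L (D.adjVar (ηbar n)) (D.suppX \ {0})

/-- Near the cutoff, the second derivative of `x ↦ E[Y | X = x]` is bounded by `BY`. -/
def OutcomeCurvatureBound (BY : ℝ) : Prop :=
  ∀ n, ∃ ε > 0, ∀ x : ℝ, 0 < |x| → |x| < ε →
    |iteratedDeriv 2 (D.condMean n (D.outcome n)) x| ≤ BY

end Assumptions

end

/-! Given the running variable and the fold split, the outcomes are independent
(`map_compProd_piKernel`). With N = n h, on designs of probability close to one the weights are
O(1/N), live on O(N) units, and the weighted noise has standard deviation se at least of order
N^(-1/2). The error of the estimator is Σ w_i e_i, plus the bias of the weighted means E[M(η̄) |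
X_i], minus the first-stage error Σ w_i Δ_i.

Noise: Lindeberg replacement with bounded fourth moments bounds its two-sided tails by slightly
enlarged normal ones plus O(N^(-1/2)) (`CenteredNoise.exists_abs_sum_tail_le`).

First stage: given the data outside a fold, the centred part is a sum of independent terms of small
variance. The conditional mean is a function of X with a linear expansion across the cutoff whose
coefficients vanish. Each fold has nearly the same weight on both sides, so this mean cancels up to
o(N^(-1/2)) (`WeightBounds.abs_fold_sum_le`).

Bias: the bound B_Y concerns E[Y | X]. The one-sided second derivatives c, c' of E[M(η̄) | X] at
zero satisfy |c + m|, |c' + m| ≤ B_Y, with m the second derivative of E[η̄(Z) | X] at zero. The bias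
is h²/2 (c k₊ - c' k₋) + O(h³) with nonpositive curvature factors k₊, k₋. Kernel symmetry gives k₊ -
k₋ → 0, so m drops out and the bias is at most the bound b̄ plus o(h²) (`WeightBounds.abs_bias_le`).
Since n h⁵ = O(1), h² is O(N^(-1/2)).

Standard error: a lower bound (1 - δ) se suffices, because the half-length z(b̄/s) s of the interval
is nondecreasing in s when the level is at least 1/2 (`absNormalQuantile_scale_mono`). In that lower
bound Young's inequality absorbs the first stage and the variation of the means. Finally, the mass
that a normal law gives to a symmetric interval decreases in the modulus of its mean
(`absNormalCDF_anti`), so a critical value for the worst bias covers the actual one. The resulting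
bound is uniform over splits and is averaged over them. -/

noncomputable section

/-! ### Disintegration of a finite product of composition-products -/

lemma lintegral_pi_prod {ι : Type*} [Fintype ι] {E : Type*} [MeasurableSpace E]
    (μ : ι → Measure E) [∀ i, IsProbabilityMeasure (μ i)] (f : ι → E → ENNReal)
    (hf : ∀ i, Measurable (f i)) :
    ∫⁻ x, ∏ i, f i (x i) ∂(Measure.pi μ) = ∏ i, ∫⁻ x, f i x ∂(μ i) := by
  have hind : iIndepFun (fun i (x : ι → E) => f i (x i)) (Measure.pi μ) :=
    iIndepFun_pi (X := fun i => f i) fun i => (hf i).aemeasurable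
  rw [lintegral_prod_eq_prod_lintegral_of_indepFun Finset.univ _ hind
    (fun i => (hf i).comp (measurable_pi_apply i))]
  refine Finset.prod_congr rfl fun i _ => ?_
  rw [← (measurePreserving_eval μ i).lintegral_comp (hf i)]

section Disintegration

variable {ι : Type*} [Fintype ι] {A E : Type*} [MeasurableSpace A] [MeasurableSpace E]

lemma measurable_measure_pi (κ : Kernel A E) [IsMarkovKernel κ] :
    Measurable fun x : ι → A => Measure.pi fun i => κ (x i) := by
  refine Measurable.measure_of_isPiSystem_of_isProbabilityMeasure generateFrom_pi.symm
    isPiSystem_pi ?_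
  rintro _ ⟨s, hs, rfl⟩
  simp only [Measure.pi_pi]
  refine Finset.measurable_prod _ fun i _ => ?_
  exact (Kernel.measurable_coe κ (hs i (mem_univ i))).comp (measurable_pi_apply i)

/-- The kernel that draws independent values given independent conditions. -/
def piKernel (ι : Type*) [Fintype ι] (κ : Kernel A E) [IsMarkovKernel κ] :
    Kernel (ι → A) (ι → E) :=
  ⟨fun x => Measure.pi fun i => κ (x i), measurable_measure_pi κ⟩

lemma piKernel_apply (κ : Kernel A E) [IsMarkovKernel κ] (x : ι → A) :
    piKernel ι κ x = Measure.pi fun i => κ (x i) := rfl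

instance (κ : Kernel A E) [IsMarkovKernel κ] : IsMarkovKernel (piKernel ι κ) :=
  ⟨fun x => by rw [piKernel_apply]; infer_instance⟩

/-- Both measures are compared on boxes, where everything factorizes. An i.i.d. sample is thus drawn
as i.i.d. conditions followed by independent, not identically distributed outcomes, the setting of
all later conditional arguments. -/
lemma map_compProd_piKernel (μ : Measure A) [IsProbabilityMeasure μ] (κ : Kernel A E)
    [IsMarkovKernel κ] :
    Measure.map (fun p : (ι → A) × (ι → E) => fun i => (p.1 i, p.2 i))
      ((Measure.pi fun _ : ι => μ) ⊗ₘ piKernel ι κ) = Measure.pi fun _ : ι => μ ⊗ₘ κ := by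
  symm
  refine Measure.pi_eq fun s hs => ?_
  have hm : Measurable fun p : (ι → A) × (ι → E) => fun i => (p.1 i, p.2 i) := by fun_prop
  rw [Measure.map_apply hm (MeasurableSet.univ_pi hs),
    Measure.compProd_apply (hm (MeasurableSet.univ_pi hs))]
  have h1 : ∀ x : ι → A, piKernel ι κ x
      (Prod.mk x ⁻¹' ((fun p : (ι → A) × (ι → E) => fun i => (p.1 i, p.2 i)) ⁻¹' univ.pi s)) =
      ∏ i, κ (x i) (Prod.mk (x i) ⁻¹' s i) := by
    intro x
    rw [piKernel_apply, ← Measure.pi_pi]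
    congr 1
  simp_rw [h1]
  rw [lintegral_pi_prod (fun _ => μ) (fun i a => κ a (Prod.mk a ⁻¹' s i))
    (fun i => Kernel.measurable_kernel_prodMk_left (hs i))]
  exact Finset.prod_congr rfl fun i _ => (Measure.compProd_apply (hs i)).symm

/-- A bound on the conditional probabilities given good conditions bounds the probability. -/
lemma measure_pi_compProd_le (μ : Measure A) [IsProbabilityMeasure μ] (κ : Kernel A E)
    [IsMarkovKernel κ] {B : Set (ι → A × E)} (hB : MeasurableSet B) (G : Set (ι → A))
    (ε : ENNReal)
    (hε : ∀ x ∈ G, Measure.pi (fun i => κ (x i)) {y | (fun i => (x i, y i)) ∈ B} ≤ ε) :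
    Measure.pi (fun _ : ι => μ ⊗ₘ κ) B ≤ ε + Measure.pi (fun _ : ι => μ) Gᶜ := by
  have hm : Measurable fun p : (ι → A) × (ι → E) => fun i => (p.1 i, p.2 i) := by fun_prop
  rw [← map_compProd_piKernel, Measure.map_apply hm hB, Measure.compProd_apply (hm hB)]
  -- `G` need not be measurable, so its complement is replaced by a measurable hull of the same
  -- measure; there the conditional probability is bounded by one.
  set N := toMeasurable (Measure.pi fun _ : ι => μ) Gᶜ
  have hN : MeasurableSet N := measurableSet_toMeasurable _ _
  calc _ ≤ ∫⁻ x, (ε + N.indicator 1 x) ∂(Measure.pi fun _ : ι => μ) := by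
        refine lintegral_mono fun x => ?_
        by_cases hx : x ∈ G
        · exact (hε x hx).trans le_self_add
        · have : x ∈ N := subset_toMeasurable _ _ hx
          simp only [this, indicator_of_mem, Pi.one_apply]
          exact prob_le_one.trans le_add_self
    _ = _ := by
        rw [lintegral_add_left measurable_const, lintegral_indicator_one hN,
          measure_toMeasurable]
        simp

/-- The conditions of the sample are i.i.d. with law μ. As `N` is arbitrary, the bound passes
through a measurable hull. -/
lemma measure_pi_compProd_ge (μ : Measure A) [IsProbabilityMeasure μ] (κ : Kernel A E)
    [IsMarkovKernel κ] (N : Set (ι → A)) :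
    Measure.pi (fun _ : ι => μ ⊗ₘ κ) {ω | (fun i => (ω i).1) ∈ N} ≤
      Measure.pi (fun _ : ι => μ) N := by
  have hmp : MeasurePreserving (fun (ω : ι → A × E) i => (ω i).1)
      (Measure.pi fun _ : ι => μ ⊗ₘ κ) (Measure.pi fun _ : ι => μ) := by
    refine measurePreserving_pi _ _ fun i => ⟨measurable_fst, ?_⟩
    exact Measure.fst_compProd μ κ
  calc _ ≤ Measure.pi (fun _ : ι => μ ⊗ₘ κ)
        ((fun (ω : ι → A × E) i => (ω i).1) ⁻¹' toMeasurable (Measure.pi fun _ : ι => μ) N) :=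
        measure_mono fun ω hω => subset_toMeasurable _ _ hω
    _ = _ := by
        rw [hmp.measure_preimage (measurableSet_toMeasurable _ _).nullMeasurableSet,
          measure_toMeasurable]

end Disintegration

/-! ### Lindeberg's replacement argument -/

/-- Mean value inequality on the segment from `x` to `y`. Each use integrates once and raises the
power by one, so a bounded third derivative gives a cubic Taylor remainder after three uses. -/
lemma norm_sub_le_of_deriv_le_pow {g g' : ℝ → ℝ} (hg : ∀ t, HasDerivAt g (g' t) t) {M x : ℝ}
    {k : ℕ} (hM : ∀ t, |g' t| ≤ M * |t - x| ^ k) (hM0 : 0 ≤ M) (y : ℝ) :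
    |g y - g x| ≤ M * |y - x| ^ (k + 1) := by
  have h := (convex_uIcc x y).norm_image_sub_le_of_norm_hasDerivWithin_le (f := g) (f' := g')
    (C := M * |y - x| ^ k) (fun t _ => (hg t).hasDerivWithinAt) (fun t ht => by
      refine (hM t).trans ?_
      have : |t - x| ≤ |y - x| := abs_sub_left_of_mem_uIcc ht
      gcongr) left_mem_uIcc right_mem_uIcc
  simpa [pow_succ, mul_assoc] using h

/-- A smooth step admits a second order Taylor expansion with a uniform cubic error. -/
lemma smoothTransition_taylor : ∃ M > 0, ∃ ψ₁ ψ₂ : ℝ → ℝ, Continuous ψ₁ ∧ Continuous ψ₂ ∧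
    (∃ C, ∀ x, |ψ₁ x| ≤ C ∧ |ψ₂ x| ≤ C) ∧ ∀ x u,
    |Real.smoothTransition (x + u) - Real.smoothTransition x - ψ₁ x * u - ψ₂ x * u ^ 2|
      ≤ M * |u| ^ 3 := by
  set f := Real.smoothTransition
  have hf : ContDiff ℝ 3 f := Real.smoothTransition.contDiff (n := 3)
  have hf1 : ContDiff ℝ 2 (deriv f) := hf.deriv' (n := 2)
  have hf2 : ContDiff ℝ 1 (deriv (deriv f)) := hf1.deriv' (n := 1)
  have hf3 : ContDiff ℝ 0 (deriv (deriv (deriv f))) := hf2.deriv' (n := 0)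
  -- The derivatives of the step vanish outside [0, 1], so continuity bounds them.
  have bdd : ∀ g : ℝ → ℝ, Continuous g → (∀ x, x < 0 → g x = 0) → (∀ x, 1 < x → g x = 0) →
      ∃ C, ∀ x, |g x| ≤ C := by
    intro g hg h0 h1
    obtain ⟨C, hC⟩ := (isCompact_Icc (a := (0 : ℝ)) (b := 1)).exists_bound_of_continuousOn
      hg.continuousOn
    refine ⟨C, fun x => ?_⟩
    have hC0 : 0 ≤ C := (norm_nonneg _).trans (hC 0 (by simp))
    rcases lt_or_ge x 0 with hx | hx
    · simpa [h0 x hx] using hC0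
    rcases lt_or_ge 1 x with hx' | hx'
    · simpa [h1 x hx'] using hC0
    exact hC x ⟨hx, hx'⟩
  have step : ∀ g : ℝ → ℝ, ∀ c : ℝ, (∀ x, x < 0 → g x = c) → ∀ x, x < 0 → deriv g x = 0 := by
    intro g c hg x hx
    have : g =ᶠ[𝓝 x] fun _ => c := by
      filter_upwards [Iio_mem_nhds hx] with y hy using hg y hy
    rw [this.deriv_eq]; simp
  have step' : ∀ g : ℝ → ℝ, ∀ c : ℝ, (∀ x, 1 < x → g x = c) → ∀ x, 1 < x → deriv g x = 0 := by
    intro g c hg x hx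
    have : g =ᶠ[𝓝 x] fun _ => c := by
      filter_upwards [Ioi_mem_nhds hx] with y hy using hg y hy
    rw [this.deriv_eq]; simp
  have z0 : ∀ x, x < 0 → f x = 0 := fun x hx => Real.smoothTransition.zero_of_nonpos hx.le
  have o0 : ∀ x, 1 < x → f x = 1 := fun x hx => Real.smoothTransition.one_of_one_le hx.le
  have z1 := step f 0 z0
  have o1 := step' f 1 o0
  have z2 := step _ 0 z1
  have o2 := step' _ 0 o1
  obtain ⟨C1, hC1⟩ := bdd _ hf1.continuous z1 o1
  obtain ⟨C2, hC2⟩ := bdd _ hf2.continuous z2 o2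
  obtain ⟨M, hM⟩ := bdd _ hf3.continuous (step _ 0 z2) (step' _ 0 o2)
  have hM0 : 0 ≤ M := (abs_nonneg _).trans (hM 0)
  refine ⟨M + 1, by positivity, deriv f, fun x => deriv (deriv f) x / 2, hf1.continuous,
    hf2.continuous.div_const _, ⟨max C1 C2, fun x => ⟨(hC1 x).trans (le_max_left _ _), ?_⟩⟩, ?_⟩
  · refine le_trans ?_ ((hC2 x).trans (le_max_right _ _))
    rw [abs_div]; exact div_le_self (abs_nonneg _) (by norm_num)
  intro x u
  have d0 : ∀ t, HasDerivAt f (deriv f t) t := fun t =>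
    ((hf.differentiable (by norm_num)) t).hasDerivAt
  have d1 : ∀ t, HasDerivAt (deriv f) (deriv (deriv f) t) t := fun t =>
    ((hf1.differentiable (by norm_num)) t).hasDerivAt
  have d2 : ∀ t, HasDerivAt (deriv (deriv f)) (deriv (deriv (deriv f)) t) t := fun t =>
    ((hf2.differentiable (by norm_num)) t).hasDerivAt
  have e2 : ∀ t, |deriv (deriv f) t - deriv (deriv f) x| ≤ M * |t - x| ^ 1 := fun t =>
    norm_sub_le_of_deriv_le_pow (k := 0) d2 (by simpa using hM) hM0 t
  have e1 : ∀ t, |deriv f t - deriv f x - deriv (deriv f) x * (t - x)| ≤ M * |t - x| ^ 2 := by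
    intro t
    have := norm_sub_le_of_deriv_le_pow (k := 1)
      (g := fun t => deriv f t - deriv f x - deriv (deriv f) x * (t - x))
      (g' := fun t => deriv (deriv f) t - deriv (deriv f) x) (fun t => by
        have := ((d1 t).sub_const (deriv f x)).fun_sub
          (((hasDerivAt_id' t).sub_const x).const_mul (deriv (deriv f) x))
        rwa [mul_one] at this) e2 hM0 t
    simpa using this
  have := norm_sub_le_of_deriv_le_pow (k := 2)
      (g := fun t => f t - f x - deriv f x * (t - x) - deriv (deriv f) x / 2 * (t - x) ^ 2)
      (g' := fun t => deriv f t - deriv f x - deriv (deriv f) x * (t - x)) (fun t => by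
        have := (((d0 t).sub_const (f x)).fun_sub
          (((hasDerivAt_id' t).sub_const x).const_mul (deriv f x))).fun_sub
          ((((hasDerivAt_id' t).sub_const x).fun_pow 2).const_mul (deriv (deriv f) x / 2))
        refine this.congr_deriv ?_
        simp only [mul_one, Nat.cast_ofNat, Nat.add_one_sub_one, pow_one]
        ring) e1 hM0 (x + u)
  simp only [add_sub_cancel_left, sub_self, mul_zero, ne_eq, OfNat.ofNat_ne_zero,
    not_false_eq_true, zero_pow, sub_zero] at this
  refine this.trans ?_
  gcongr
  linarith

/-- Third absolute moment of the standard normal distribution. -/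
def gaussAbsThird : ℝ := ∫ x, |x| ^ 3 ∂(gaussianReal 0 1)

lemma integrable_abs_pow_gaussianReal (m : ℝ) (v : NNReal) (k : ℕ) :
    Integrable (fun x => |x| ^ k) (gaussianReal m v) := by
  have := (memLp_id_gaussianReal (μ := m) (v := v) k).integrable_norm_pow'
  simpa using this

lemma integral_abs_cube_gaussianReal (v : NNReal) :
    ∫ x, |x| ^ 3 ∂(gaussianReal 0 v) = Real.sqrt v ^ 3 * gaussAbsThird := by
  have h : gaussianReal 0 v = (gaussianReal 0 1).map (fun x => Real.sqrt v * x) := by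
    rw [gaussianReal_map_const_mul]
    congr 1
    · simp
    · ext; simp
  rw [h, integral_map (by fun_prop) (by fun_prop), gaussAbsThird, ← integral_const_mul]
  refine integral_congr_ae (ae_of_all _ fun x => ?_)
  simp [abs_mul, mul_pow, abs_of_nonneg (Real.sqrt_nonneg _)]

section Lindeberg

variable {φ φ₁ φ₂ : ℝ → ℝ} {M : ℝ}

/-- Expansion of a smooth functional of a centred perturbation. -/
lemma abs_integral_add_sub_le (hφ : Continuous φ) (hb : ∃ C, ∀ x, |φ x| ≤ C)
    (hT : ∀ x u, |φ (x + u) - φ x - φ₁ x * u - φ₂ x * u ^ 2| ≤ M * |u| ^ 3)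
    (l : Measure ℝ) [IsProbabilityMeasure l] (h1 : Integrable (fun u => u) l)
    (h2 : Integrable (fun u => u ^ 2) l) (h3 : Integrable (fun u => |u| ^ 3) l)
    (h0 : ∫ u, u ∂l = 0) (x : ℝ) :
    |∫ u, φ (x + u) ∂l - (φ x + φ₂ x * ∫ u, u ^ 2 ∂l)| ≤ M * ∫ u, |u| ^ 3 ∂l := by
  obtain ⟨C, hC⟩ := hb
  have hi : Integrable (fun u => φ (x + u)) l :=
    Integrable.of_bound (by fun_prop) C (ae_of_all _ fun u => hC _)
  have : ∫ u, φ (x + u) ∂l - (φ x + φ₂ x * ∫ u, u ^ 2 ∂l) =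
      ∫ u, (φ (x + u) - φ x - φ₁ x * u - φ₂ x * u ^ 2) ∂l := by
    rw [integral_sub, integral_sub, integral_sub, integral_const_mul, integral_const_mul, h0]
    · simp; ring
    · exact hi
    · fun_prop
    · exact hi.sub (by fun_prop)
    · exact h1.const_mul _
    · exact (hi.sub (by fun_prop)).sub (h1.const_mul _)
    · exact h2.const_mul _
  rw [this, ← integral_const_mul]
  refine (abs_integral_le_integral_abs).trans (integral_mono_of_nonneg
    (ae_of_all _ fun u => abs_nonneg _) (h3.const_mul M) (ae_of_all _ fun u => hT x u))

/-- Both laws have mean zero and the same variance, so their second order expansions coincide and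
only the two cubic remainders are left. -/
lemma abs_integral_add_sub_gaussian_le (hφ : Continuous φ) (hb : ∃ C, ∀ x, |φ x| ≤ C)
    (hT : ∀ x u, |φ (x + u) - φ x - φ₁ x * u - φ₂ x * u ^ 2| ≤ M * |u| ^ 3)
    (l : Measure ℝ) [IsProbabilityMeasure l] (h1 : Integrable (fun u => u) l)
    (h2 : Integrable (fun u => u ^ 2) l) (h3 : Integrable (fun u => |u| ^ 3) l)
    (h0 : ∫ u, u ∂l = 0) {v : NNReal} (hv : ∫ u, u ^ 2 ∂l = v) (x : ℝ) :
    |∫ u, φ (x + u) ∂l - ∫ u, φ (x + u) ∂(gaussianReal 0 v)| ≤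
      M * (∫ u, |u| ^ 3 ∂l + Real.sqrt v ^ 3 * gaussAbsThird) := by
  have a := abs_integral_add_sub_le hφ hb hT l h1 h2 h3 h0 x
  have g1 : Integrable (fun u : ℝ => u) (gaussianReal 0 v) :=
    (integrable_abs_pow_gaussianReal 0 v 1).mono' (by fun_prop) (ae_of_all _ fun u => by simp)
  have g2 : Integrable (fun u : ℝ => u ^ 2) (gaussianReal 0 v) := by
    simpa using integrable_abs_pow_gaussianReal 0 v 2
  have g2v : ∫ u, u ^ 2 ∂(gaussianReal 0 v) = v := by
    have := variance_fun_id_gaussianReal (μ := 0) (v := v)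
    rw [variance_eq_integral (by fun_prop)] at this
    simpa using this
  have b := abs_integral_add_sub_le hφ hb hT (gaussianReal 0 v) g1 g2
    (integrable_abs_pow_gaussianReal 0 v 3) (by simp) x
  rw [g2v, integral_abs_cube_gaussianReal] at b
  rw [hv] at a
  rw [abs_le] at *
  constructor <;> linarith [a.1, a.2, b.1, b.2]

/-- Summands are exchanged one at a time for normal variables of the same variance. The shift `c` is
quantified inside the induction, so that an independent summand can be frozen and absorbed into it.
-/
lemma abs_integral_sum_sub_gaussian_le {Ω ι : Type*} [MeasurableSpace Ω] {P : Measure Ω}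
    [IsProbabilityMeasure P] {ξ : ι → Ω → ℝ} (hind : iIndepFun ξ P) (hm : ∀ i, Measurable (ξ i))
    (h3 : ∀ i, Integrable (fun ω => |ξ i ω| ^ 3) P) (h0 : ∀ i, ∫ ω, ξ i ω ∂P = 0) {v : ι → NNReal}
    (hv : ∀ i, ∫ ω, ξ i ω ^ 2 ∂P = v i)
    (hφ : Continuous φ) (hb : ∃ C, ∀ x, |φ x| ≤ C)
    (hT : ∀ x u, |φ (x + u) - φ x - φ₁ x * u - φ₂ x * u ^ 2| ≤ M * |u| ^ 3) (s : Finset ι) :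
    ∀ c, |∫ ω, φ (c + ∑ i ∈ s, ξ i ω) ∂P - ∫ u, φ (c + u) ∂(gaussianReal 0 (∑ i ∈ s, v i))| ≤
      M * ∑ i ∈ s, (∫ ω, |ξ i ω| ^ 3 ∂P + Real.sqrt (v i) ^ 3 * gaussAbsThird) := by
  classical
  obtain ⟨C, hC⟩ := hb
  have hbi : ∀ (Q : Measure ℝ) [IsProbabilityMeasure Q] (c : ℝ),
      Integrable (fun u => φ (c + u)) Q := fun Q _ c =>
    Integrable.of_bound (by fun_prop) C (ae_of_all _ fun u => hC _)
  have hcube : ∀ t : ℝ, ∀ k ≤ 3, |t| ^ k ≤ 1 + |t| ^ 3 := by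
    intro t k hk
    rcases le_total (|t|) 1 with h | h
    · exact (pow_le_one₀ (abs_nonneg _) h).trans (le_add_of_nonneg_right (by positivity))
    · exact (pow_le_pow_right₀ h hk).trans (by linarith)
  induction s using Finset.induction_on with
  | empty => intro c; simp
  | insert a s ha ih =>
    intro c
    set La := P.map (ξ a)
    set Ls := P.map (fun ω => ∑ i ∈ s, ξ i ω)
    have hms : Measurable (fun ω => ∑ i ∈ s, ξ i ω) := Finset.measurable_sum _ fun i _ => hm i
    have : IsProbabilityMeasure La := Measure.isProbabilityMeasure_map (hm a).aemeasurable
    have : IsProbabilityMeasure Ls := Measure.isProbabilityMeasure_map hms.aemeasurable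
    have hindep : IndepFun (ξ a) (fun ω => ∑ i ∈ s, ξ i ω) P := by
      have := (hind.indepFun_finsetSum_of_notMem hm ha).symm
      convert this using 1
      ext ω; simp
    have hsum : P.map (fun ω => ∑ i ∈ insert a s, ξ i ω) = La ∗ Ls := by
      rw [← hindep.map_add_eq_map_conv_map (hm a) hms]
      congr 1
      ext ω; simp [Finset.sum_insert ha]
    have hmi : Measurable (fun ω => ∑ i ∈ insert a s, ξ i ω) :=
      Finset.measurable_sum _ fun i _ => hm i
    have : IsProbabilityMeasure (La ∗ Ls) := by
      rw [← hsum]; exact Measure.isProbabilityMeasure_map hmi.aemeasurable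
    have hL : ∫ ω, φ (c + ∑ i ∈ insert a s, ξ i ω) ∂P = ∫ u, ∫ w, φ (c + (u + w)) ∂Ls ∂La := by
      rw [← integral_conv (hbi _ c), ← hsum, integral_map hmi.aemeasurable (by fun_prop)]
    have hs : ∀ c, ∫ w, φ (c + w) ∂Ls = ∫ ω, φ (c + ∑ i ∈ s, ξ i ω) ∂P := fun c => by
      rw [integral_map hms.aemeasurable (by fun_prop)]
    set Gs := gaussianReal 0 (∑ i ∈ s, v i)
    set Ga := gaussianReal 0 (v a)
    have hG : ∫ u, φ (c + u) ∂(gaussianReal 0 (∑ i ∈ insert a s, v i)) =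
        ∫ w, ∫ u, φ (c + (w + u)) ∂Ga ∂Gs := by
      have : gaussianReal 0 (∑ i ∈ insert a s, v i) = Gs ∗ Ga := by
        rw [gaussianReal_conv_gaussianReal, Finset.sum_insert ha, add_comm (v a), add_zero]
      rw [this]
      have : IsProbabilityMeasure (Gs ∗ Ga) := by rw [← this]; infer_instance
      rw [integral_conv (hbi _ c)]
    -- Hybrid law: the sum over `s` is already normal, `ξ a` is not. The induction hypothesis
    -- compares it with the original sum, one exchange with the normal sum.
    have hsw : ∫ u, ∫ w, φ (c + (u + w)) ∂Gs ∂La = ∫ w, ∫ u, φ (c + (w + u)) ∂La ∂Gs := by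
      rw [integral_integral_swap]
      · simp_rw [add_comm]
      · exact Integrable.of_bound (by fun_prop) C (ae_of_all _ fun u => hC _)
    have hdouble : ∀ (Q Q' : Measure ℝ) [IsProbabilityMeasure Q] [IsProbabilityMeasure Q'],
        Integrable (fun u => ∫ w, φ (c + (u + w)) ∂Q) Q' := by
      intro Q Q' _ _
      have : Integrable (fun p : ℝ × ℝ => φ (c + (p.1 + p.2))) (Q'.prod Q) :=
        Integrable.of_bound (by fun_prop) C (ae_of_all _ fun u => hC _)
      exact this.integral_prod_left
    set Bs := ∑ i ∈ s, (∫ ω, |ξ i ω| ^ 3 ∂P + Real.sqrt (v i) ^ 3 * gaussAbsThird)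
    set Ba := ∫ ω, |ξ a ω| ^ 3 ∂P + Real.sqrt (v a) ^ 3 * gaussAbsThird
    have e1 : |∫ u, ∫ w, φ (c + (u + w)) ∂Ls ∂La - ∫ u, ∫ w, φ (c + (u + w)) ∂Gs ∂La| ≤
        M * Bs := by
      rw [← integral_sub (hdouble _ _) (hdouble _ _)]
      rw [← Real.norm_eq_abs]
      refine (norm_integral_le_of_norm_le_const (C := M * Bs) (ae_of_all La fun u => ?_)).trans_eq
        (by rw [probReal_univ, mul_one])
      have := ih (c + u)
      rw [← hs] at this
      simpa [add_assoc] using this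
    have hLa : ∀ k : ℕ, ∫ u, |u| ^ k ∂La = ∫ ω, |ξ a ω| ^ k ∂P := fun k => by
      rw [integral_map (hm a).aemeasurable (by fun_prop)]
    have i3 : Integrable (fun u => |u| ^ 3) La := by
      rw [integrable_map_measure (by fun_prop) (hm a).aemeasurable]; exact h3 a
    have ik : ∀ f : ℝ → ℝ, Continuous f → (∀ u, |f u| ≤ 1 + |u| ^ 3) → Integrable f La := by
      intro f hf hfb
      exact ((integrable_const 1).add i3).mono' hf.aestronglyMeasurable (ae_of_all _ hfb)
    have e2 : |∫ w, ∫ u, φ (c + (w + u)) ∂La ∂Gs - ∫ w, ∫ u, φ (c + (w + u)) ∂Ga ∂Gs| ≤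
        M * Ba := by
      rw [← integral_sub (hdouble _ _) (hdouble _ _)]
      rw [← Real.norm_eq_abs]
      refine (norm_integral_le_of_norm_le_const (C := M * Ba) (ae_of_all Gs fun w => ?_)).trans_eq
        (by rw [probReal_univ, mul_one])
      have := abs_integral_add_sub_gaussian_le hφ ⟨C, hC⟩ hT La
        (ik _ continuous_id fun u => by simpa using hcube u 1 (by norm_num))
        (ik _ (by fun_prop) fun u => by simpa using hcube u 2 (by norm_num)) i3
        (by rw [integral_map (hm a).aemeasurable (by fun_prop)]; exact h0 a)
        (v := v a) (by rw [integral_map (hm a).aemeasurable (by fun_prop)]; exact hv a) (c + w)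
      rw [hLa 3] at this
      simpa [add_assoc] using this
    rw [hL, hG, Finset.sum_insert ha, mul_add]
    rw [hsw] at e1
    calc _ ≤ _ := abs_sub_le _ (∫ w, ∫ u, φ (c + (w + u)) ∂La ∂Gs) _
      _ ≤ M * Ba + M * Bs := by linarith

end Lindeberg

/-- Smoothing constant of the quantitative central limit theorem. -/
lemma exists_normal_tail_le (δ : ℝ) (hδ : 0 < δ) : ∃ M > 0, ∀ {Ω ι : Type} [MeasurableSpace Ω]
    {P : Measure Ω} [IsProbabilityMeasure P] {ξ : ι → Ω → ℝ}, iIndepFun ξ P →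
    (∀ i, Measurable (ξ i)) → (∀ i, Integrable (fun ω => |ξ i ω| ^ 3) P) →
    (∀ i, ∫ ω, ξ i ω ∂P = 0) → ∀ {v : ι → NNReal}, (∀ i, ∫ ω, ξ i ω ^ 2 ∂P = v i) →
    ∀ (s : Finset ι), ∑ i ∈ s, v i = 1 → ∀ a : ℝ,
    P.real {ω | a ≤ ∑ i ∈ s, ξ i ω} ≤ (gaussianReal 0 1).real (Ici (a - δ)) +
      M * ∑ i ∈ s, (∫ ω, |ξ i ω| ^ 3 ∂P + Real.sqrt (v i) ^ 3 * gaussAbsThird) := by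
  obtain ⟨M, hM, ψ₁, ψ₂, -, -, -, hT⟩ := smoothTransition_taylor
  refine ⟨M / δ ^ 3, by positivity, ?_⟩
  intro Ω ι _ P _ ξ hind hm h3 h0 v hv s hs a
  -- A step of width δ: `φ (δ - a + ·)` is one above `a` and zero below `a - δ`. Rescaling turns the
  -- cubic constant into M / δ³.
  set φ : ℝ → ℝ := fun x => Real.smoothTransition (x / δ) with hφd
  have hφ : Continuous φ := Real.smoothTransition.continuous.comp (continuous_id.div_const δ)
  have hb : ∀ x, |φ x| ≤ 1 := fun x => by
    rw [abs_of_nonneg (Real.smoothTransition.nonneg _)]; exact Real.smoothTransition.le_one _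
  have hT' : ∀ x u, |φ (x + u) - φ x - (fun x => ψ₁ (x / δ) / δ) x * u -
      (fun x => ψ₂ (x / δ) / δ ^ 2) x * u ^ 2| ≤ M / δ ^ 3 * |u| ^ 3 := by
    intro x u
    have := hT (x / δ) (u / δ)
    simp only [hφd, add_div]
    rw [abs_div, div_pow, div_pow, abs_of_pos hδ] at this
    convert this using 1
    · congr 1; ring
    · ring
  have key := abs_integral_sum_sub_gaussian_le hind hm h3 h0 hv hφ ⟨1, hb⟩ hT' s (δ - a)
  rw [hs] at key
  have hms : Measurable fun ω => ∑ i ∈ s, ξ i ω := Finset.measurable_sum _ fun i _ => hm i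
  have hA : MeasurableSet {ω | a ≤ ∑ i ∈ s, ξ i ω} := measurableSet_le measurable_const hms
  have l1 : P.real {ω | a ≤ ∑ i ∈ s, ξ i ω} ≤ ∫ ω, φ (δ - a + ∑ i ∈ s, ξ i ω) ∂P := by
    rw [← integral_indicator_one hA]
    refine integral_mono ((integrable_const 1).indicator hA) (Integrable.of_bound
      (hφ.measurable.comp (measurable_const.add hms)).aestronglyMeasurable 1
      (ae_of_all _ fun ω => hb _)) fun ω => ?_
    by_cases h' : a ≤ ∑ i ∈ s, ξ i ω
    · have : φ (δ - a + ∑ i ∈ s, ξ i ω) = 1 := by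
        apply Real.smoothTransition.one_of_one_le
        rw [le_div_iff₀ hδ]; linarith
      simp [indicator, h', this]
    · simp [indicator, h', hφd, Real.smoothTransition.nonneg]
  have l2 : ∫ u, φ (δ - a + u) ∂(gaussianReal 0 1) ≤ (gaussianReal 0 1).real (Ici (a - δ)) := by
    rw [← integral_indicator_one measurableSet_Ici]
    refine integral_mono (Integrable.of_bound (by fun_prop) 1 (ae_of_all _ fun ω => hb _))
      ((integrable_const 1).indicator measurableSet_Ici) fun u => ?_
    by_cases h' : a - δ ≤ u
    · simp [indicator, h', hφd, Real.smoothTransition.le_one]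
    · have : φ (δ - a + u) = 0 := by
        apply Real.smoothTransition.zero_of_nonpos
        apply div_nonpos_of_nonpos_of_nonneg _ hδ.le
        linarith
      simp [indicator, h', this]
  have := (abs_le.1 key).2
  linarith

lemma gaussianReal_neg_real (m : ℝ) {A : Set ℝ} (hA : MeasurableSet A) :
    (gaussianReal (-m) 1).real A = (gaussianReal m 1).real ((fun x => -x) ⁻¹' A) := by
  rw [← gaussianReal_map_neg, map_measureReal_apply measurable_neg hA]

/-- A quantitative two-sided central limit theorem for sums of independent variables. -/
lemma exists_normal_abs_tail_le (δ : ℝ) (hδ : 0 < δ) : ∃ M > 0, ∀ {Ω ι : Type}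
    [MeasurableSpace Ω] {P : Measure Ω} [IsProbabilityMeasure P] {ξ : ι → Ω → ℝ}, iIndepFun ξ P →
    (∀ i, Measurable (ξ i)) → (∀ i, Integrable (fun ω => |ξ i ω| ^ 3) P) →
    (∀ i, ∫ ω, ξ i ω ∂P = 0) → ∀ {v : ι → NNReal}, (∀ i, ∫ ω, ξ i ω ^ 2 ∂P = v i) →
    ∀ (s : Finset ι), ∑ i ∈ s, v i = 1 → ∀ t b : ℝ,
    P.real {ω | t ≤ |∑ i ∈ s, ξ i ω + b|} ≤ (gaussianReal 0 1).real {x | t - δ ≤ |x + b|} +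
      M * ∑ i ∈ s, (∫ ω, |ξ i ω| ^ 3 ∂P + Real.sqrt (v i) ^ 3 * gaussAbsThird) := by
  obtain ⟨M, hM, H⟩ := exists_normal_tail_le δ hδ
  refine ⟨2 * M, by positivity, ?_⟩
  intro Ω ι _ P _ ξ hind hm h3 h0 v hv s hs t b
  set Z := ∑ i ∈ s, (∫ ω, |ξ i ω| ^ 3 ∂P + Real.sqrt (v i) ^ 3 * gaussAbsThird) with hZ
  have hZ0 : 0 ≤ Z := by
    refine Finset.sum_nonneg fun i _ => add_nonneg (integral_nonneg fun _ => by positivity)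
      (mul_nonneg (by positivity) (integral_nonneg fun _ => by positivity))
  have h1 := H hind hm h3 h0 hv s hs (t - b)
  have h2 := H (ξ := fun i ω => -ξ i ω) (hind.comp (fun _ x => -x) fun _ => measurable_neg)
    (fun i => (hm i).neg) (by simpa using h3) (by simpa [integral_neg] using h0)
    (by simpa using hv) s hs (t + b)
  simp only [abs_neg, Finset.sum_neg_distrib] at h2
  rw [← hZ] at h1 h2
  -- For t > δ the two normal tails are disjoint, so adding the one-sided bounds for the sum and its
  -- negative gives exactly the two-sided normal probability. For t ≤ δ that probability is one.
  rcases lt_or_ge δ t with ht | ht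
  · have e1 : P.real {ω | t ≤ |∑ i ∈ s, ξ i ω + b|} ≤ P.real {ω | t - b ≤ ∑ i ∈ s, ξ i ω} +
        P.real {ω | t + b ≤ -∑ i ∈ s, ξ i ω} := by
      refine (measureReal_mono ?_).trans (measureReal_union_le _ _)
      intro ω hω
      rcases le_abs.1 (show t ≤ |∑ i ∈ s, ξ i ω + b| from hω) with h | h
      · left; show t - b ≤ _; linarith
      · right; show t + b ≤ _; linarith
    have e2 : (gaussianReal 0 1).real (Ici (t + b - δ)) =
        (gaussianReal 0 1).real (Iic (-(t + b - δ))) := by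
      have h := gaussianReal_neg_real 0 (measurableSet_Ici (a := t + b - δ))
      rw [neg_zero] at h
      rw [h]
      congr 1
      ext x
      simp only [mem_preimage, mem_Ici, mem_Iic, le_neg]
    have e3 : (gaussianReal 0 1).real {x | t - δ ≤ |x + b|} =
        (gaussianReal 0 1).real (Ici (t - b - δ)) +
        (gaussianReal 0 1).real (Iic (-(t + b - δ))) := by
      rw [← measureReal_union _ measurableSet_Iic]
      · congr 1
        ext x
        simp only [mem_ofPred_eq, mem_union, mem_Ici, mem_Iic, le_abs]
        constructor <;> rintro (h | h) <;> [left; right; left; right] <;> linarith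
      · rw [Set.disjoint_left]
        intro x hx hx'
        simp only [mem_Ici, mem_Iic] at hx hx'
        linarith
    rw [e3, ← e2]
    linarith
  · have : {x : ℝ | t - δ ≤ |x + b|} = univ := by
      ext x; simp only [mem_ofPred_eq, mem_univ, iff_true]
      exact (sub_nonpos.2 ht).trans (abs_nonneg _)
    rw [this, probReal_univ]
    have : P.real {ω | t ≤ |∑ i ∈ s, ξ i ω + b|} ≤ 1 := measureReal_le_one
    have : 0 ≤ 2 * M * Z := by positivity
    linarith

/-! ### Second moments on finite product spaces -/

section SecondMoments

variable {ι E : Type*} [Fintype ι] [MeasurableSpace E] {ν : ι → Measure E}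
  [∀ i, IsProbabilityMeasure (ν i)] {e : ι → E → ℝ}

lemma measure_pi_abs_sum_ge_le (he : ∀ i, MemLp (e i) 2 (ν i)) (h0 : ∀ i, ∫ y, e i y ∂(ν i) = 0)
    {t : ℝ} (ht : 0 < t) :
    Measure.pi ν {y | t ≤ |∑ i, e i (y i)|} ≤
      ENNReal.ofReal ((∑ i, ∫ y, e i y ^ 2 ∂(ν i)) / t ^ 2) := by
  have hmem : ∀ i, MemLp (fun y : ι → E => e i (y i)) 2 (Measure.pi ν) := fun i =>
    (he i).comp_measurePreserving (measurePreserving_eval ν i)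
  have hs : MemLp (∑ i, fun y : ι → E => e i (y i)) 2 (Measure.pi ν) :=
    memLp_finsetSum' _ fun i _ => hmem i
  have hmean : ∫ y, (∑ i, fun y : ι → E => e i (y i)) y ∂(Measure.pi ν) = 0 := by
    simp only [Finset.sum_apply]
    rw [integral_finsetSum _ fun i _ => (hmem i).integrable (by norm_num)]
    refine Finset.sum_eq_zero fun i _ => ?_
    have hmp := measurePreserving_eval ν i
    have := integral_map hmp.measurable.aemeasurable (f := e i) (by rw [hmp.map_eq]; exact (he i).1)
    rw [hmp.map_eq, h0 i] at this
    exact this.symm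
  have h := meas_ge_le_variance_div_sq hs ht
  rw [hmean, variance_sum_pi he] at h
  simp only [sub_zero, Finset.sum_apply] at h
  refine h.trans_eq ?_
  congr 2
  refine Finset.sum_congr rfl fun i _ => ?_
  rw [variance_eq_integral (he i).1.aemeasurable, h0 i]
  simp

/-- The integrand is a monomial in the coordinates, so its integral factorizes, and a coordinate of
exponent one contributes a zero mean. Only equal unordered pairs survive, each giving a product of
two variances. -/
lemma integral_pi_prod_four [DecidableEq ι] (h1 : ∀ i, ∫ y, e i y ∂(ν i) = 0) (i j k l : ι)
    (hij : i ≠ j) (hkl : k ≠ l) :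
    ∫ y, e i (y i) * e j (y j) * (e k (y k) * e l (y l)) ∂(Measure.pi ν) =
      if (k = i ∧ l = j) ∨ (k = j ∧ l = i) then (∫ y, e i y ^ 2 ∂(ν i)) * ∫ y, e j y ^ 2 ∂(ν j)
      else 0 := by
  set N : ι → ℕ := fun m => (if m = i then 1 else 0) + (if m = j then 1 else 0) +
    ((if m = k then 1 else 0) + (if m = l then 1 else 0)) with hN
  have hprod : ∀ f : ι → ℝ, f i * f j * (f k * f l) = ∏ m, f m ^ N m := by
    intro f
    simp only [hN, pow_add, Finset.prod_mul_distrib]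
    simp [Finset.prod_ite_eq', pow_ite]
  simp_rw [hprod fun m => e m (_)]
  rw [integral_fintype_prod_eq_prod (fun m y => e m y ^ N m)]
  split_ifs with h
  · have hN2 : ∀ m, N m = 2 * (if m = i then 1 else 0) + 2 * (if m = j then 1 else 0) := by
      intro m
      simp only [hN]
      rcases h with ⟨rfl, rfl⟩ | ⟨rfl, rfl⟩ <;> ring
    have : ∀ m, ∫ y, e m y ^ N m ∂(ν m) = (∫ y, e m y ^ 2 ∂(ν m)) ^ (if m = i then 1 else 0) *
        (∫ y, e m y ^ 2 ∂(ν m)) ^ (if m = j then 1 else 0) := by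
      intro m
      rw [hN2]
      by_cases h1 : m = i <;> by_cases h2 : m = j
      · exact absurd (h1.symm.trans h2) hij
      all_goals simp [h1, h2]
      all_goals simp [hij, hij.symm]
    simp_rw [this, Finset.prod_mul_distrib]
    simp [Finset.prod_ite_eq', pow_ite]
  · have : ∃ m, N m = 1 := by
      by_cases hi : k = i ∨ l = i
      · refine ⟨j, ?_⟩
        have hj : ¬ (j = k) ∧ ¬ (j = l) := by
          constructor
          · rintro rfl; rcases hi with hi | hi
            · exact hij hi.symm
            · exact h (Or.inr ⟨rfl, hi⟩)
          · rintro rfl; rcases hi with hi | hi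
            · exact h (Or.inl ⟨hi, rfl⟩)
            · exact hij hi.symm
        simp [hN, hj.1, hj.2, hij.symm]
      · push Not at hi
        exact ⟨i, by simp [hN, hi.1.symm, hi.2.symm, hij]⟩
    obtain ⟨m, hm⟩ := this
    exact Finset.prod_eq_zero (Finset.mem_univ m) (by simp [hm, h1])

/-- Indices within each pair differ, so no exponent exceeds two and second moments are enough. -/
lemma integrable_pi_prod_four (h2 : ∀ i, MemLp (e i) 2 (ν i)) (i j k l : ι)
    (hij : i ≠ j) (hkl : k ≠ l) :
    Integrable (fun y : ι → E => e i (y i) * e j (y j) * (e k (y k) * e l (y l)))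
      (Measure.pi ν) := by
  classical
  set N : ι → ℕ := fun m => (if m = i then 1 else 0) + (if m = j then 1 else 0) +
    ((if m = k then 1 else 0) + (if m = l then 1 else 0)) with hN
  have hprod : ∀ f : ι → ℝ, f i * f j * (f k * f l) = ∏ m, f m ^ N m := by
    intro f
    simp only [hN, pow_add, Finset.prod_mul_distrib]
    simp [Finset.prod_ite_eq', pow_ite]
  simp_rw [hprod fun m => e m (_)]
  refine Integrable.fintype_prod (f := fun m y => e m y ^ N m) fun m => ?_
  have : N m ≤ 2 := by
    simp only [hN]
    split_ifs <;> first | omega | (subst_vars; exact absurd rfl ‹_›)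
  interval_cases hm : N m
  · simp
  · simpa using (h2 m).integrable (by norm_num)
  · exact (h2 m).integrable_sq

/-- Chebyshev's inequality for quadratic forms without diagonal. -/
lemma measure_pi_abs_quadratic_ge_le (he : ∀ i, MemLp (e i) 2 (ν i))
    (h0 : ∀ i, ∫ y, e i y ∂(ν i) = 0) {V : ℝ} (hV : ∀ i, ∫ y, e i y ^ 2 ∂(ν i) ≤ V)
    {c : ι → ι → ℝ} (hc : ∀ i, c i i = 0) {t : ℝ} (ht : 0 < t) :
    Measure.pi ν {y | t ≤ |∑ i, ∑ j, c i j * (e i (y i) * e j (y j))|} ≤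
      ENNReal.ofReal (2 * V ^ 2 * (∑ i, ∑ j, c i j ^ 2) / t ^ 2) := by
  classical
  set v : ι → ℝ := fun i => ∫ y, e i y ^ 2 ∂(ν i)
  have hv0 : ∀ i, 0 ≤ v i := fun i => integral_nonneg fun _ => sq_nonneg _
  set Q : (ι → E) → ℝ := fun y => ∑ i, ∑ j, c i j * (e i (y i) * e j (y j)) with hQ
  have hQ' : ∀ y, Q y = ∑ p : ι × ι, c p.1 p.2 * (e p.1 (y p.1) * e p.2 (y p.2)) := fun y => by
    rw [Fintype.sum_prod_type]
  have hsq : ∀ y, Q y ^ 2 = ∑ p : ι × ι, ∑ q : ι × ι, c p.1 p.2 * c q.1 q.2 *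
      (e p.1 (y p.1) * e p.2 (y p.2) * (e q.1 (y q.1) * e q.2 (y q.2))) := by
    intro y
    rw [hQ', sq, Finset.sum_mul_sum]
    refine Finset.sum_congr rfl fun p _ => Finset.sum_congr rfl fun q _ => ?_
    ring
  have hint : ∀ p q : ι × ι, Integrable (fun y : ι → E => c p.1 p.2 * c q.1 q.2 *
      (e p.1 (y p.1) * e p.2 (y p.2) * (e q.1 (y q.1) * e q.2 (y q.2)))) (Measure.pi ν) := by
    intro p q
    by_cases hp : p.1 = p.2
    · simp [hp, hc]
    by_cases hq : q.1 = q.2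
    · simp [hq, hc]
    exact (integrable_pi_prod_four he _ _ _ _ hp hq).const_mul _
  have hQi : Integrable (fun y => Q y ^ 2) (Measure.pi ν) := by
    simp_rw [hsq]
    exact integrable_finsetSum _ fun p _ => integrable_finsetSum _ fun q _ => hint p q
  -- For a fixed pair only the pair itself and its swap contribute. As `c` need not be symmetric,
  -- the product of the two swapped coefficients is bounded by the mean of their squares; the two
  -- contributions give the factor 2.
  have hval : ∀ p q : ι × ι, ∫ y, c p.1 p.2 * c q.1 q.2 *
      (e p.1 (y p.1) * e p.2 (y p.2) * (e q.1 (y q.1) * e q.2 (y q.2))) ∂(Measure.pi ν) ≤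
      (if q = p then c p.1 p.2 ^ 2 * V ^ 2 else 0) +
      (if q = p.swap then (c p.1 p.2 ^ 2 + c p.2 p.1 ^ 2) / 2 * V ^ 2 else 0) := by
    rintro ⟨i, j⟩ ⟨k, l⟩
    have hnn : 0 ≤ (if ((k, l) : ι × ι) = (i, j) then c i j ^ 2 * V ^ 2 else 0) +
      (if ((k, l) : ι × ι) = (j, i) then (c i j ^ 2 + c j i ^ 2) / 2 * V ^ 2 else 0) := by
      split_ifs <;> positivity
    simp only [Prod.swap_prod_mk]
    by_cases hp : i = j
    · refine le_trans (le_of_eq ?_) hnn; simp [hp, hc]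
    by_cases hq : k = l
    · refine le_trans (le_of_eq ?_) hnn; simp [hq, hc]
    rw [integral_const_mul, integral_pi_prod_four h0 _ _ _ _ hp hq]
    have hvv : v i * v j ≤ V ^ 2 := by
      rw [sq]; exact mul_le_mul (hV i) (hV j) (hv0 j) ((hv0 i).trans (hV i))
    have hvv0 : 0 ≤ v i * v j := mul_nonneg (hv0 i) (hv0 j)
    by_cases h1 : k = i ∧ l = j
    · obtain ⟨rfl, rfl⟩ := h1
      have : ¬ ((k, l) : ι × ι) = (l, k) := by
        simp only [Prod.mk.injEq, not_and]; intro h; exact absurd h hp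
      simp only [this, if_true, if_false, and_self, true_or, add_zero]
      rw [← sq]; exact mul_le_mul_of_nonneg_left hvv (sq_nonneg _)
    by_cases h2 : k = j ∧ l = i
    · obtain ⟨rfl, rfl⟩ := h2
      have : ¬ ((k, l) : ι × ι) = (l, k) := by
        simp only [Prod.mk.injEq, not_and]; intro h; exact absurd h hq
      simp only [this, if_true, if_false, and_self, or_true, zero_add]
      calc c l k * c k l * (v l * v k) ≤ (c l k ^ 2 + c k l ^ 2) / 2 * (v l * v k) := by
            apply mul_le_mul_of_nonneg_right _ hvv0
            nlinarith [sq_nonneg (c l k - c k l)]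
        _ ≤ _ := mul_le_mul_of_nonneg_left hvv (by positivity)
    · rw [if_neg (by tauto), mul_zero]; exact hnn
  have hE : ∫ y, Q y ^ 2 ∂(Measure.pi ν) ≤ 2 * V ^ 2 * ∑ i, ∑ j, c i j ^ 2 := by
    simp_rw [hsq]
    rw [integral_finsetSum _ fun p _ => integrable_finsetSum _ fun q _ => hint p q]
    simp_rw [integral_finsetSum Finset.univ fun q _ => hint _ q]
    refine (Finset.sum_le_sum fun p _ => Finset.sum_le_sum fun q _ => hval p q).trans ?_
    simp only [Finset.sum_add_distrib, Finset.sum_ite_eq', Finset.mem_univ, if_true]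
    rw [Fintype.sum_prod_type, Fintype.sum_prod_type]
    have hsw : ∑ i, ∑ j, c j i ^ 2 = ∑ i, ∑ j, c i j ^ 2 := Finset.sum_comm
    simp_rw [← Finset.sum_mul, ← Finset.sum_div, Finset.sum_add_distrib]
    rw [hsw]
    apply le_of_eq; ring
  have hset : {y | t ≤ |Q y|} ⊆ {y | t ^ 2 ≤ Q y ^ 2} := fun y hy => by
    have := pow_le_pow_left₀ ht.le (show t ≤ |Q y| from hy) 2
    simpa using this
  have hM := mul_meas_ge_le_integral_of_nonneg (ae_of_all (Measure.pi ν) fun y => sq_nonneg (Q y))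
    hQi (t ^ 2)
  have hr : (Measure.pi ν).real {y | t ≤ |Q y|} ≤ 2 * V ^ 2 * (∑ i, ∑ j, c i j ^ 2) / t ^ 2 := by
    rw [le_div_iff₀ (by positivity)]
    have := measureReal_mono (μ := Measure.pi ν) hset
    nlinarith [sq_nonneg t, hM.trans hE]
  rw [← ofReal_measureReal (measure_ne_top _ _)]
  exact ENNReal.ofReal_le_ofReal hr

end SecondMoments

/-! ### The distribution of the absolute value of a normal variable -/

/-- Distribution function of `|N(r, 1)|`. -/
def absNormalCDF (r t : ℝ) : ℝ := (gaussianReal r 1).real {y | |y| ≤ t}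

lemma measurableSet_abs_le (t : ℝ) : MeasurableSet {y : ℝ | |y| ≤ t} :=
  measurableSet_le (by fun_prop) measurable_const

lemma absNormalCDF_eq (r t : ℝ) :
    absNormalCDF r t = (gaussianReal 0 1).real {x | |x + r| ≤ t} := by
  have h := gaussianReal_map_add_const (μ := 0) (v := 1) r
  rw [zero_add] at h
  rw [absNormalCDF, ← h, map_measureReal_apply (by fun_prop) (measurableSet_abs_le t)]
  rfl

lemma absNormalCDF_neg (r t : ℝ) : absNormalCDF (-r) t = absNormalCDF r t := by
  rw [absNormalCDF, gaussianReal_neg_real _ (measurableSet_abs_le t), absNormalCDF]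
  simp

lemma gaussianPDFReal_std (x : ℝ) :
    gaussianPDFReal 0 1 x = (Real.sqrt (2 * Real.pi))⁻¹ * Real.exp (-x ^ 2 / 2) := by
  simp [gaussianPDFReal]

lemma gaussianPDFReal_std_le_one (x : ℝ) : gaussianPDFReal 0 1 x ≤ 1 := by
  rw [gaussianPDFReal_std]
  have h1 : (Real.sqrt (2 * Real.pi))⁻¹ ≤ 1 := by
    apply inv_le_one_of_one_le₀
    rw [Real.one_le_sqrt]
    linarith [Real.pi_gt_three]
  have h2 : Real.exp (-x ^ 2 / 2) ≤ 1 := by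
    rw [Real.exp_le_one_iff]; nlinarith [sq_nonneg x]
  exact mul_le_one₀ h1 (Real.exp_pos _).le h2

lemma gaussianReal_std_real_Ioc (a b : ℝ) (hab : a ≤ b) :
    (gaussianReal 0 1).real (Ioc a b) = ∫ x in a..b, gaussianPDFReal 0 1 x := by
  rw [measureReal_def, gaussianReal_apply_eq_integral _ one_ne_zero,
    ENNReal.toReal_ofReal (integral_nonneg fun x => gaussianPDFReal_nonneg _ _ _),
    intervalIntegral.integral_of_le hab]

lemma gaussianReal_std_real_Ioc_le (a b : ℝ) (hab : a ≤ b) :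
    (gaussianReal 0 1).real (Ioc a b) ≤ b - a := by
  rw [gaussianReal_std_real_Ioc a b hab]
  calc _ ≤ ∫ _ in a..b, (1 : ℝ) := intervalIntegral.integral_mono_on hab
        (integrable_gaussianPDFReal 0 1).intervalIntegrable (by simp)
        fun x _ => gaussianPDFReal_std_le_one x
    _ = b - a := by simp

lemma absNormalCDF_of_neg (r : ℝ) {t : ℝ} (ht : t < 0) : absNormalCDF r t = 0 := by
  have : {y : ℝ | |y| ≤ t} = ∅ := by
    ext y; simp only [mem_ofPred_eq, mem_empty_iff_false, iff_false, not_le]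
    exact ht.trans_le (abs_nonneg y)
  rw [absNormalCDF, this, measureReal_empty]

instance : NullSingletonClass (gaussianReal 0 1) := nullSingletonClass_gaussianReal one_ne_zero

lemma absNormalCDF_eq_Ioc (r t : ℝ) :
    absNormalCDF r t = (gaussianReal 0 1).real (Ioc (-t - r) (t - r)) := by
  rw [absNormalCDF_eq, measureReal_congr (Ioc_ae_eq_Icc (μ := gaussianReal 0 1))]
  congr 1
  ext x
  simp only [mem_ofPred_eq, mem_Icc, abs_le]
  constructor <;> rintro ⟨h1, h2⟩ <;> constructor <;> linarith

/-- Each end of the window moves by `u - t`, and the standard normal density is at most one. This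
serves both to show that the quantile is attained and to price a small change of the critical value.
-/
lemma absNormalCDF_le_add (r : ℝ) {t u : ℝ} (h : t ≤ u) :
    absNormalCDF r u ≤ absNormalCDF r t + 2 * (u - t) := by
  rw [absNormalCDF_eq_Ioc, absNormalCDF_eq_Ioc]
  have hsub : Ioc (-u - r) (u - r) ⊆
      Ioc (-t - r) (t - r) ∪ (Ioc (-u - r) (-t - r) ∪ Ioc (t - r) (u - r)) := by
    intro x hx
    simp only [mem_union, mem_Ioc] at hx ⊢
    by_cases h1 : x ≤ -t - r
    · exact Or.inr (Or.inl ⟨hx.1, h1⟩)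
    by_cases h2 : x ≤ t - r
    · exact Or.inl ⟨not_le.1 h1, h2⟩
    · exact Or.inr (Or.inr ⟨not_le.1 h2, hx.2⟩)
  have h1 := (measureReal_mono (μ := gaussianReal 0 1) hsub).trans (measureReal_union_le _ _)
  have h2 := measureReal_union_le (μ := gaussianReal 0 1) (Ioc (-u - r) (-t - r))
    (Ioc (t - r) (u - r))
  have h3 := gaussianReal_std_real_Ioc_le (-u - r) (-t - r) (by linarith)
  have h4 := gaussianReal_std_real_Ioc_le (t - r) (u - r) (by linarith)
  linarith

lemma absNormalCDF_shift_le (r d t : ℝ) : absNormalCDF r t ≤ absNormalCDF (r + d) (t + |d|) := by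
  rw [absNormalCDF_eq, absNormalCDF_eq]
  refine measureReal_mono fun x hx => ?_
  show |x + (r + d)| ≤ t + |d|
  rw [← add_assoc]
  exact (abs_add_le _ _).trans (by gcongr; exact hx)

/-- Raising the centre shifts the window [-t - x, t - x] to the left: density is lost at `t - x` and
gained at `-t - x`. For t, x ≥ 0 the lost point is the closer one to zero, so the loss dominates. -/
lemma absNormalCDF_anti_of_nonneg {b r : ℝ} (hb : 0 ≤ b) (hbr : b ≤ r) (t : ℝ) :
    absNormalCDF r t ≤ absNormalCDF b t := by
  rcases lt_or_ge t 0 with ht | ht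
  · rw [absNormalCDF_of_neg r ht]; exact measureReal_nonneg
  rw [absNormalCDF_eq_Ioc, absNormalCDF_eq_Ioc, gaussianReal_std_real_Ioc _ _ (by linarith),
    gaussianReal_std_real_Ioc _ _ (by linarith)]
  set p := gaussianPDFReal 0 1 with hp
  have hi : ∀ a b, IntervalIntegrable p volume a b := fun a b =>
    (integrable_gaussianPDFReal 0 1).intervalIntegrable
  have h := intervalIntegral.integral_interval_sub_interval_comm (hi (-t - b) (t - b))
    (hi (-t - r) (t - r)) (hi (-t - b) (-t - r))
  have e1 : ∫ x in b..r, p (-t - x) = ∫ x in (-t - r)..(-t - b), p x :=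
    intervalIntegral.integral_comp_sub_left _ _
  have e2 : ∫ x in b..r, p (t - x) = ∫ x in (t - r)..(t - b), p x :=
    intervalIntegral.integral_comp_sub_left _ _
  have hcomp : ∫ x in b..r, p (-t - x) ≤ ∫ x in b..r, p (t - x) := by
    refine intervalIntegral.integral_mono_on hbr ?_ ?_ fun x hx => ?_
    · exact (((integrable_gaussianPDFReal 0 1).comp_sub_left (-t))).intervalIntegrable
    · exact (((integrable_gaussianPDFReal 0 1).comp_sub_left t)).intervalIntegrable
    · rw [hp, gaussianPDFReal_std, gaussianPDFReal_std]
      have : 0 ≤ t * x := mul_nonneg ht (hb.trans hx.1)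
      refine mul_le_mul_of_nonneg_left (Real.exp_le_exp.2 ?_) (by positivity)
      nlinarith
  rw [e1, e2] at hcomp
  have s1 := intervalIntegral.integral_symm (μ := volume) (f := p) (-t - b) (-t - r)
  have s2 := intervalIntegral.integral_symm (μ := volume) (f := p) (t - b) (t - r)
  linarith

/-- This is why a critical value computed for the largest bias is valid for every bias of smaller
modulus, of either sign. -/
lemma absNormalCDF_anti {b r : ℝ} (hbr : |b| ≤ r) (t : ℝ) :
    absNormalCDF r t ≤ absNormalCDF b t := by
  rcases abs_cases b with ⟨h, h0⟩ | ⟨h, h0⟩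
  · exact absNormalCDF_anti_of_nonneg h0 (h ▸ hbr) t
  · rw [← absNormalCDF_neg b]
    exact absNormalCDF_anti_of_nonneg (by linarith) (h ▸ hbr) t

lemma tendsto_absNormalCDF (r : ℝ) : Tendsto (absNormalCDF r) atTop (𝓝 1) := by
  have hU : (⋃ t : ℝ, {y : ℝ | |y| ≤ t}) = univ := by
    ext y; simp only [mem_iUnion, mem_univ, iff_true]; exact ⟨|y|, le_refl |y|⟩
  have h := tendsto_measure_iUnion_atTop (μ := gaussianReal r 1) (s := fun t : ℝ => {y | |y| ≤ t})
    fun a b hab y hy => le_trans (show _ ≤ _ from hy) hab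
  rw [hU, measure_univ] at h
  have := (ENNReal.tendsto_toReal ENNReal.one_ne_top).comp h
  rwa [ENNReal.toReal_one] at this

/-! ### Quantiles of the absolute value of a normal variable. -/

section Quantile

variable {γ : ℝ}

lemma absNormalQuantile_eq (γ r : ℝ) :
    absNormalQuantile γ r = sInf {t | γ ≤ absNormalCDF r t} := rfl

lemma absNormalQuantile_le (h0 : 0 < γ) {r t : ℝ} (ht : γ ≤ absNormalCDF r t) :
    absNormalQuantile γ r ≤ t := by
  refine csInf_le ⟨0, fun s hs => ?_⟩ ht
  by_contra hneg
  replace hs : γ ≤ absNormalCDF r s := hs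
  rw [absNormalCDF_of_neg r (not_le.1 hneg)] at hs
  exact absurd hs (not_le.2 h0)

lemma nonempty_absNormalCDF_ge (h1 : γ < 1) (r : ℝ) : {t | γ ≤ absNormalCDF r t}.Nonempty :=
  ((tendsto_absNormalCDF r).eventually (lt_mem_nhds h1)).exists.imp fun _ => le_of_lt

lemma absNormalQuantile_nonneg (h0 : 0 < γ) (r : ℝ) :
    0 ≤ absNormalQuantile γ r := by
  refine Real.sInf_nonneg fun s hs => ?_
  by_contra hneg
  replace hs : γ ≤ absNormalCDF r s := hs
  rw [absNormalCDF_of_neg r (not_le.1 hneg)] at hs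
  exact absurd hs (not_le.2 h0)

/-- The Lipschitz bound for the distribution function closes the gap between the infimum and the
points just above it. -/
lemma le_absNormalCDF_quantile (h0 : 0 < γ) (h1 : γ < 1) (r : ℝ) :
    γ ≤ absNormalCDF r (absNormalQuantile γ r) := by
  refine le_of_forall_pos_le_add fun ε hε => ?_
  obtain ⟨t, ht, htz⟩ := exists_lt_of_csInf_lt (nonempty_absNormalCDF_ge h1 r)
    (show absNormalQuantile γ r < absNormalQuantile γ r + ε / 2 by linarith)
  have hz := absNormalQuantile_nonneg h0 r
  have h2 := absNormalQuantile_le h0 ht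
  have := absNormalCDF_le_add r h2
  have ht' : γ ≤ absNormalCDF r t := ht
  linarith

/-- A change of the centre is compensated by lengthening the interval by the same amount. -/
lemma absNormalQuantile_le_add (h0 : 0 < γ) (h1 : γ < 1) (r r' : ℝ) :
    absNormalQuantile γ r' ≤ absNormalQuantile γ r + |r' - r| := by
  refine absNormalQuantile_le h0 ((le_absNormalCDF_quantile h0 h1 r).trans ?_)
  simpa using absNormalCDF_shift_le r (r' - r) (absNormalQuantile γ r)

lemma continuous_absNormalQuantile (h0 : 0 < γ) (h1 : γ < 1) :
    Continuous (absNormalQuantile γ) := by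
  refine (LipschitzWith.of_dist_le_mul (K := 1) fun r r' => ?_).continuous
  rw [Real.dist_eq, Real.dist_eq, NNReal.coe_one, one_mul, abs_le]
  have a := absNormalQuantile_le_add h0 h1 r r'
  have b := absNormalQuantile_le_add h0 h1 r' r
  rw [abs_sub_comm] at a
  constructor <;> linarith

lemma absNormalQuantile_mono (h0 : 0 < γ) (h1 : γ < 1) {r r' : ℝ} (hr : 0 ≤ r) (h : r ≤ r') :
    absNormalQuantile γ r ≤ absNormalQuantile γ r' :=
  absNormalQuantile_le h0 ((le_absNormalCDF_quantile h0 h1 r').trans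
    (absNormalCDF_anti (by rwa [abs_of_nonneg hr]) _))

/-- The interval (a, -a) has positive mass and separates two tails of equal mass. Strictness is what
admits the level 1/2 itself in `absNormalQuantile_scale_mono`. -/
lemma gaussianReal_real_Iic_std_lt_half {a : ℝ} (ha : a < 0) :
    (gaussianReal 0 1).real (Iic a) < 1 / 2 := by
  have h1 : (gaussianReal 0 1).real (Ici (-a)) = (gaussianReal 0 1).real (Iic a) := by
    have := gaussianReal_neg_real 0 (measurableSet_Ici (a := -a))
    rw [neg_zero] at this
    rw [this]; congr 1; ext x; simp
  have hpos : 0 < (gaussianReal 0 1).real (Ioo a (-a)) := by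
    rw [measureReal_def, ENNReal.toReal_pos_iff]
    refine ⟨pos_iff_ne_zero.2 fun h => ?_, measure_lt_top _ _⟩
    have := gaussianReal_absolutelyContinuous' 0 one_ne_zero h
    rw [Real.volume_Ioo, ENNReal.ofReal_eq_zero] at this
    linarith
  have hu : (gaussianReal 0 1).real (Iic a) + (gaussianReal 0 1).real (Ioo a (-a)) +
      (gaussianReal 0 1).real (Ici (-a)) = 1 := by
    rw [← measureReal_union _ measurableSet_Ioo, ← measureReal_union _ measurableSet_Ici]
    · rw [← probReal_univ (μ := gaussianReal 0 1)]
      congr 1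
      ext x
      simp only [mem_union, mem_Iic, mem_Ioo, mem_Ici, mem_univ, iff_true]
      by_cases h1 : x ≤ a <;> by_cases h2 : -a ≤ x
      · exact Or.inr h2
      · exact Or.inl (Or.inl h1)
      · exact Or.inr h2
      · exact Or.inl (Or.inr ⟨not_le.1 h1, not_le.1 h2⟩)
    · rw [Set.disjoint_left]
      rintro x (hx | hx) hx' <;> simp only [mem_Iic, mem_Ioo, mem_Ici] at hx hx' <;> linarith
    · rw [Set.disjoint_left]
      intro x hx hx'; simp only [mem_Iic, mem_Ioo] at hx hx'; linarith
  linarith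

/-- The `γ`-quantile of `|N(b, s²)|` is nondecreasing in `s` when `γ ≥ 1/2`. -/
lemma absNormalQuantile_scale_mono (h0 : 1 / 2 ≤ γ) (h1 : γ < 1) {b s₁ s₂ : ℝ} (hs₁ : 0 < s₁)
    (hs : s₁ ≤ s₂) :
    absNormalQuantile γ (b / s₁) * s₁ ≤ absNormalQuantile γ (b / s₂) * s₂ := by
  wlog hb : 0 ≤ b generalizing b
  · have := this (b := -b) (by linarith)
    have hneg : ∀ r, absNormalQuantile γ (-r) = absNormalQuantile γ r := fun r => by
      simp_rw [absNormalQuantile_eq, absNormalCDF_neg]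
    simpa [neg_div, hneg] using this
  have hγ : 0 < γ := by linarith
  have hs₂ : 0 < s₂ := hs₁.trans_le hs
  set t := absNormalQuantile γ (b / s₂) * s₂ with ht
  have hF : γ ≤ absNormalCDF (b / s₂) (t / s₂) := by
    rw [ht, mul_div_cancel_right₀ _ hs₂.ne']; exact le_absNormalCDF_quantile hγ h1 _
  rw [absNormalCDF_eq_Ioc] at hF
  -- A level of at least 1/2 forces the critical value past the centre: otherwise the standardized
  -- window lies below a negative number and has mass less than 1/2. Then `t - b` and `t + b` are
  -- nonnegative, and dividing by the smaller scale moves both ends outwards.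
  have hbt : b ≤ t := by
    by_contra hlt
    have : t / s₂ - b / s₂ < 0 := by rw [← sub_div]; exact div_neg_of_neg_of_pos (by linarith) hs₂
    have h2 := gaussianReal_real_Iic_std_lt_half this
    have h3 := measureReal_mono (μ := gaussianReal 0 1)
      (Ioc_subset_Iic_self (a := -(t / s₂) - b / s₂) (b := t / s₂ - b / s₂))
    linarith
  rw [← le_div_iff₀ hs₁]
  refine absNormalQuantile_le hγ (hF.trans ?_)
  rw [absNormalCDF_eq_Ioc]
  refine measureReal_mono (Ioc_subset_Ioc ?_ ?_)
  · have : (t + b) / s₂ ≤ (t + b) / s₁ := div_le_div_of_nonneg_left (by linarith) hs₁ hs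
    rw [add_div, add_div] at this
    linarith
  · have : (t - b) / s₂ ≤ (t - b) / s₁ := div_le_div_of_nonneg_left (by linarith) hs₁ hs
    rwa [sub_div, sub_div] at this

/-- Noncoverage probability of a normal variable with slightly misspecified bias bound and
critical value. -/
lemma gaussianReal_abs_ge_le (h0 : 0 < γ) (h1 : γ < 1) {r β δ u : ℝ}
    (hδ : 0 < δ) (hβ : |β| ≤ r + δ) (hu : u ≤ absNormalQuantile γ r) :
    (gaussianReal 0 1).real {x | u ≤ |x + β|} ≤
      1 - γ + 2 * (absNormalQuantile γ r - u + 2 * δ) := by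
  have hz := absNormalQuantile_nonneg h0 r
  -- The critical value is shortened by 2δ: one δ pays for a bias exceeding `r` by δ, the other
  -- separates |x + β| ≤ u - δ from |x + β| ≥ u, so that the two probabilities add up to at most
  -- one.
  have e1 : γ ≤ absNormalCDF r (u - 2 * δ) + 2 * (absNormalQuantile γ r - (u - 2 * δ)) :=
    (le_absNormalCDF_quantile h0 h1 r).trans (absNormalCDF_le_add r (by linarith))
  have e2 : absNormalCDF r (u - 2 * δ) ≤ absNormalCDF (r + δ) (u - δ) := by
    have := absNormalCDF_shift_le r δ (u - 2 * δ)
    rwa [abs_of_pos hδ, show u - 2 * δ + δ = u - δ by ring] at this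
  have e3 := absNormalCDF_anti hβ (u - δ)
  have e4 : absNormalCDF β (u - δ) + (gaussianReal 0 1).real {x | u ≤ |x + β|} ≤ 1 := by
    rw [absNormalCDF_eq, ← measureReal_union]
    · exact measureReal_le_one
    · rw [Set.disjoint_left]
      intro x hx hx'
      have a : |x + β| ≤ u - δ := hx
      have b : u ≤ |x + β| := hx'
      linarith
    · exact measurableSet_le measurable_const (by fun_prop)
  linarith

end Quantile

/-! ### One-sided local linear weights -/

/-- Weighted kernel moments on one side of the cutoff, in units of the bandwidth. -/
def kMoment (K : ℝ → ℝ) (b : ℝ) (A : Set ℝ) {n : ℕ} (a x : Fin n → ℝ) (m : ℕ) : ℝ :=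
  ∑ i, a i * (A.indicator K (x i / b) * (x i / b) ^ m)

/-- A side of the cutoff is invariant under rescaling. -/
def IsCone (A : Set ℝ) : Prop := ∀ b > 0, ∀ x, x / b ∈ A ↔ x ∈ A

lemma isCone_Ici : IsCone (Ici 0) := fun b hb x => by
  simp only [mem_Ici]; exact ⟨fun h => by simpa [div_nonneg_iff, hb.le, hb.not_ge] using h,
    fun h => div_nonneg h hb.le⟩

lemma isCone_Iio : IsCone (Iio 0) := fun b hb x => by
  simp only [mem_Iio]
  exact ⟨fun h => by simpa [div_neg_iff, hb.not_gt, hb] using h, fun h => div_neg_of_neg_of_pos h hb⟩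

section Weights

variable {K : ℝ → ℝ} {b : ℝ} {A : Set ℝ} {n : ℕ} {x : Fin n → ℝ}

lemma sideKernel_eq (hA : IsCone A) (hb : 0 < b) (t : ℝ) :
    sideKernel K b A t = A.indicator K (t / b) / b := by
  have h := hA b hb t
  by_cases ht : t ∈ A
  · rw [sideKernel, if_pos ht, indicator_of_mem (h.2 ht), scaledKernel]
  · rw [sideKernel, if_neg ht, indicator_of_notMem (mt h.1 ht), zero_div]

/-- Cramer's rule for the 2 × 2 design in units of the bandwidth. It also holds for singular
designs, where the matrix inverse and the division are both zero by convention. -/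
lemma sideWeight_eq (hA : IsCone A) (hb : 0 < b) (i : Fin n) :
    sideWeight K b A (0 : Fin (1 + 1)) x i =
      A.indicator K (x i / b) * (kMoment K b A 1 x 2 - kMoment K b A 1 x 1 * (x i / b)) /
        (kMoment K b A 1 x 0 * kMoment K b A 1 x 2 - kMoment K b A 1 x 1 ^ 2) := by
  set S := kMoment K b A 1 x with hS
  have hb' := hb.ne'
  have hG : gramMatrix K b A 1 x = !![S 0 / b, S 1; S 1, b * S 2] := by
    ext j k
    fin_cases j <;> fin_cases k <;>
    · simp only [gramMatrix, Matrix.sum_apply, Matrix.smul_apply, Matrix.vecMulVec_apply, polyVec,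
        sideKernel_eq hA hb, hS, kMoment, smul_eq_mul, Pi.one_apply, one_mul]
      simp [Finset.sum_div, Finset.mul_sum]
      try refine Finset.sum_congr rfl fun i _ => ?_
      try field_simp
  have hdet : (!![S 0 / b, S 1; S 1, b * S 2] : Matrix (Fin 2) (Fin 2) ℝ).det =
      S 0 * S 2 - S 1 ^ 2 := by
    rw [Matrix.det_fin_two_of]; field_simp
  rw [sideWeight, hG]
  change ((!![S 0 / b, S 1; S 1, b * S 2] : Matrix (Fin 2) (Fin 2) ℝ)⁻¹.mulVec _) 0 = _
  rw [Matrix.inv_def, hdet, Matrix.adjugate_fin_two_of, Ring.inverse_eq_inv']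
  simp only [Matrix.mulVec, dotProduct, Pi.smul_apply, Fin.sum_univ_two, polyVec,
    sideKernel_eq hA hb, smul_eq_mul]
  simp
  field_simp
  try ring

/-- Determinant of the one-sided design. -/
def kDet (K : ℝ → ℝ) (b : ℝ) (A : Set ℝ) {n : ℕ} (x : Fin n → ℝ) : ℝ :=
  kMoment K b A 1 x 0 * kMoment K b A 1 x 2 - kMoment K b A 1 x 1 ^ 2

/-- Weighted polynomial averages become ratios of kernel moments. The multiplier `a` is 1 for the
full sample and a fold indicator for cross-fitting. -/
lemma sum_sideWeight_mul (hA : IsCone A) (hb : 0 < b) (a : Fin n → ℝ) (m : ℕ) :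
    ∑ i, a i * (sideWeight K b A (0 : Fin (1 + 1)) x i * (x i / b) ^ m) =
      (kMoment K b A 1 x 2 * kMoment K b A a x m - kMoment K b A 1 x 1 * kMoment K b A a x (m + 1))
        / kDet K b A x := by
  simp_rw [sideWeight_eq hA hb]
  rw [kMoment.eq_def K b A a x m, kMoment.eq_def K b A a x (m + 1), Finset.mul_sum, Finset.mul_sum,
    ← Finset.sum_sub_distrib, Finset.sum_div]
  refine Finset.sum_congr rfl fun i _ => ?_
  rw [kDet]
  ring

lemma sideWeight_eq_zero (hA : IsCone A) (hb : 0 < b) (hK : ∀ u, u ∉ Icc (-1 : ℝ) 1 → K u = 0)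
    {i : Fin n} (h : sideWeight K b A (0 : Fin (1 + 1)) x i ≠ 0) : x i ∈ A ∧ |x i| ≤ b := by
  rw [sideWeight_eq hA hb] at h
  have h1 : A.indicator K (x i / b) ≠ 0 := fun h0 => h (by rw [h0]; simp)
  have h2 : x i / b ∈ A := by_contra fun h0 => h1 (indicator_of_notMem h0 _)
  rw [indicator_of_mem h2] at h1
  have h3 : x i / b ∈ Icc (-1 : ℝ) 1 := by_contra fun h0 => h1 (hK _ h0)
  refine ⟨(hA b hb _).1 h2, ?_⟩
  rw [mem_Icc, ← abs_le, abs_div, abs_of_pos hb, div_le_one hb] at h3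
  exact h3

/-- Cauchy–Schwarz for kernel moments with nonnegative weights of constant sign. -/
lemma kMoment_sq_le (hK : ∀ u, 0 ≤ K u) {ε : ℝ} (hε : ε ^ 2 = 1)
    (hA : ∀ u ∈ A, 0 ≤ ε * u) :
    kMoment K b A 1 x 2 ^ 2 ≤ kMoment K b A 1 x 1 * kMoment K b A 1 x 3 := by
  have hmass : ∀ u, 0 ≤ A.indicator K u * (ε * u) := by
    intro u
    by_cases hu : u ∈ A
    · rw [indicator_of_mem hu]; exact mul_nonneg (hK u) (hA u hu)
    · simp [hu]
  -- On one side `ε * u` is nonnegative, so K(u) ε u is a legitimate weight for Cauchy–Schwarz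
  -- between 1 and u. The sign then disappears through ε² = 1.
  set g : Fin n → ℝ := fun i => A.indicator K (x i / b) * (ε * (x i / b))
  have h1 : kMoment K b A 1 x 1 * kMoment K b A 1 x 3 =
      (∑ i, Real.sqrt (g i) ^ 2) * ∑ i, (Real.sqrt (g i) * (x i / b)) ^ 2 := by
    have e1 : ∑ i, Real.sqrt (g i) ^ 2 = ε * kMoment K b A 1 x 1 := by
      rw [kMoment, Finset.mul_sum]
      refine Finset.sum_congr rfl fun i _ => ?_
      rw [Real.sq_sqrt (hmass _)]; simp; ring
    have e2 : ∑ i, (Real.sqrt (g i) * (x i / b)) ^ 2 = ε * kMoment K b A 1 x 3 := by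
      rw [kMoment, Finset.mul_sum]
      refine Finset.sum_congr rfl fun i _ => ?_
      rw [mul_pow, Real.sq_sqrt (hmass _)]; simp; ring
    rw [e1, e2]
    linear_combination (-(kMoment K b A 1 x 1 * kMoment K b A 1 x 3)) * hε
  have h2 : kMoment K b A 1 x 2 ^ 2 =
      (∑ i, Real.sqrt (g i) * (Real.sqrt (g i) * (x i / b))) ^ 2 := by
    have e : ∑ i, Real.sqrt (g i) * (Real.sqrt (g i) * (x i / b)) = ε * kMoment K b A 1 x 2 := by
      rw [kMoment, Finset.mul_sum]
      refine Finset.sum_congr rfl fun i _ => ?_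
      rw [← mul_assoc, Real.mul_self_sqrt (hmass _)]; simp; ring
    rw [e]
    linear_combination (-(kMoment K b A 1 x 2 ^ 2)) * hε
  rw [h1, h2]
  exact Finset.sum_mul_sq_le_sq_mul_sq _ _ _

lemma exists_close_of_continuousAt {f : (Fin 4 → ℝ) → ℝ} {c : Fin 4 → ℝ} (hf : ContinuousAt f c)
    {ε : ℝ} (hε : 0 < ε) : ∃ η > 0, ∀ s : Fin 4 → ℝ, (∀ m, |s m - c m| < η) → |f s - f c| < ε := by
  obtain ⟨η, hη, h⟩ := Metric.continuousAt_iff.1 hf ε hε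
  refine ⟨η, hη, fun s hs => ?_⟩
  have : dist s c < η := (dist_pi_lt_iff hη).2 fun m => by rw [Real.dist_eq]; exact hs m
  simpa [Real.dist_eq] using h this

/-- Kernel moments close to limits with a positive definite limit design give weights of the
order of the inverse effective sample size. -/
lemma exists_sideWeight_bound (c : Fin 4 → ℝ) (hc : 0 < c 0 * c 2 - c 1 ^ 2) (k : ℝ) :
    ∃ W > 0, ∃ η > 0, ∀ {K : ℝ → ℝ} {b : ℝ} {A : Set ℝ} {n : ℕ} {x : Fin n → ℝ} {N : ℝ},
    IsCone A → 0 < b → (∀ u, 0 ≤ K u) → (∀ u, K u ≤ k) → (∀ u, u ∉ Icc (-1 : ℝ) 1 → K u = 0) →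
    0 < N → (∀ m : Fin 4, |kMoment K b A 1 x m / N - c m| < η) →
    0 < kDet K b A x ∧ |kMoment K b A 1 x 1| / kDet K b A x ≤ W / N ∧
    |kMoment K b A 1 x 2| / kDet K b A x ≤ W / N ∧
    ∀ i, |sideWeight K b A (0 : Fin (1 + 1)) x i| ≤ W / N := by
  set C := |c 1| + |c 2| + 1
  set d := c 0 * c 2 - c 1 ^ 2
  obtain ⟨η, hη, h⟩ := exists_close_of_continuousAt
    (f := fun s => s 0 * s 2 - s 1 ^ 2) (c := c) (by fun_prop) (half_pos hc)
  have hC : 0 < C := by positivity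
  -- The determinant exceeds N² d / 2 and the first and second moments are at most C N, so their
  -- ratios are at most 2C / (d N). A weight is bounded by the kernel bound times two such ratios,
  -- whence 1 + 2|k|.
  refine ⟨2 * C / d * (1 + 2 * |k|), by positivity, min η 1, by positivity, ?_⟩
  intro K b A n x N hA hb hK0 hKk hK hN hm
  have hk : 0 ≤ k := (hK0 0).trans (hKk 0)
  rw [abs_of_nonneg hk]
  set s : Fin 4 → ℝ := fun m => kMoment K b A 1 x m / N
  have hdet : d / 2 < s 0 * s 2 - s 1 ^ 2 := by
    have := (abs_lt.1 (h s fun m => (hm m).trans_le (min_le_left _ _))).1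
    simp only [d] at this ⊢
    linarith
  have hD : kDet K b A x = N ^ 2 * (s 0 * s 2 - s 1 ^ 2) := by
    simp only [kDet, s]
    field_simp
    simp
  have hD' : N ^ 2 * (d / 2) < kDet K b A x := by
    rw [hD]; exact mul_lt_mul_of_pos_left hdet (by positivity)
  have hDpos : 0 < kDet K b A x := lt_trans (by positivity) hD'
  have hs : ∀ m : Fin 4, |c m| + 1 ≤ C → |kMoment K b A 1 x m| / kDet K b A x ≤ 2 * C / d / N := by
    intro m hmC
    have h1 : |kMoment K b A 1 x m| ≤ C * N := by
      have : |kMoment K b A 1 x m / N| ≤ C := by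
        have := abs_sub_abs_le_abs_sub (kMoment K b A 1 x m / N) (c m)
        linarith [(hm m).trans_le (min_le_right η 1)]
      rwa [abs_div, abs_of_pos hN, div_le_iff₀ hN] at this
    rw [div_le_iff₀ hDpos]
    calc |kMoment K b A 1 x m| ≤ C * N := h1
      _ = 2 * C / d / N * (N ^ 2 * (d / 2)) := by field_simp
      _ ≤ _ := mul_le_mul_of_nonneg_left hD'.le (by positivity)
  have hle : 2 * C / d / N ≤ 2 * C / d * (1 + 2 * k) / N := by
    gcongr
    exact le_mul_of_one_le_right (by positivity) (by linarith)
  have h1 := hs 1 (by simp only [C]; linarith [abs_nonneg (c 2)])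
  have h2 := hs 2 (by simp only [C]; linarith [abs_nonneg (c 1)])
  refine ⟨hDpos, h1.trans hle, h2.trans hle, fun i => ?_⟩
  by_cases h0 : sideWeight K b A (0 : Fin (1 + 1)) x i = 0
  · rw [h0, abs_zero]; positivity
  have hu := (sideWeight_eq_zero hA hb hK h0).2
  rw [sideWeight_eq hA hb, mul_div_assoc, abs_mul]
  have hki : |A.indicator K (x i / b)| ≤ k := by
    rw [abs_of_nonneg (indicator_nonneg (fun u _ => hK0 u) _)]
    exact (indicator_le_self' (fun u _ => hK0 u) _).trans (hKk _)
  have hu1 : |x i / b| ≤ 1 := by rw [abs_div, abs_of_pos hb, div_le_one hb]; exact hu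
  have h3 : |(kMoment K b A 1 x 2 - kMoment K b A 1 x 1 * (x i / b)) / kDet K b A x| ≤
      2 * (2 * C / d / N) := by
    rw [abs_div, abs_of_pos hDpos, two_mul]
    refine le_trans ?_ (add_le_add h2 h1)
    rw [← add_div]
    refine div_le_div_of_nonneg_right ((abs_sub _ _).trans ?_) hDpos.le
    rw [abs_mul]
    exact add_le_add_right (mul_le_of_le_one_right (abs_nonneg _) hu1) _
  calc _ ≤ k * (2 * (2 * C / d / N)) := mul_le_mul hki h3 (abs_nonneg _) hk
    _ ≤ 2 * C / d * (1 + 2 * k) / N := by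
      rw [show k * (2 * (2 * C / d / N)) = 2 * C / d * (2 * k) / N by ring]
      gcongr
      linarith

/-- Second moment of the weights in units of the bandwidth. -/
def kCurv (K : ℝ → ℝ) (b : ℝ) (A : Set ℝ) {n : ℕ} (x : Fin n → ℝ) : ℝ :=
  (kMoment K b A 1 x 2 ^ 2 - kMoment K b A 1 x 1 * kMoment K b A 1 x 3) / kDet K b A x

/-- Numerator and denominator are both quadratic in the moments, so the normalization by `N` cancels
and continuity of the ratio suffices. -/
lemma exists_kCurv_close (c : Fin 4 → ℝ) (hc : 0 < c 0 * c 2 - c 1 ^ 2) {ε : ℝ} (hε : 0 < ε) :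
    ∃ η > 0, ∀ {K : ℝ → ℝ} {b : ℝ} {A : Set ℝ} {n : ℕ} {x : Fin n → ℝ} {N : ℝ},
    0 < N → (∀ m : Fin 4, |kMoment K b A 1 x m / N - c m| < η) →
    |kCurv K b A x - (c 2 ^ 2 - c 1 * c 3) / (c 0 * c 2 - c 1 ^ 2)| < ε := by
  obtain ⟨η, hη, h⟩ := exists_close_of_continuousAt
    (f := fun s => (s 2 ^ 2 - s 1 * s 3) / (s 0 * s 2 - s 1 ^ 2)) (c := c)
    (ContinuousAt.div (by fun_prop) (by fun_prop) hc.ne') hε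
  refine ⟨η, hη, fun {K b A n x N} hN hm => ?_⟩
  convert h _ hm using 3
  simp only [kCurv, kDet]
  have hN' := hN.ne'
  rw [div_pow, div_mul_div_comm, div_mul_div_comm, div_pow, ← sq, ← sub_div, ← sub_div,
    div_div_div_cancel_right₀ (by positivity)]
  simp

/-- Local linear weights reproduce constants and, by the next lemma, annihilate linear terms; of a
quadratic expansion only the value at the cutoff and the curvature remain. -/
lemma sum_sideWeight (hA : IsCone A) (hb : 0 < b) (hD : kDet K b A x ≠ 0) :
    ∑ i, sideWeight K b A (0 : Fin (1 + 1)) x i = 1 := by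
  have := sum_sideWeight_mul (K := K) (x := x) hA hb 1 0
  simp only [Pi.one_apply, one_mul, pow_zero, mul_one, zero_add] at this
  rw [this, div_eq_one_iff_eq hD, kDet]; ring

lemma sum_sideWeight_mul_self (hA : IsCone A) (hb : 0 < b) :
    ∑ i, sideWeight K b A (0 : Fin (1 + 1)) x i * (x i / b) = 0 := by
  have := sum_sideWeight_mul (K := K) (x := x) hA hb 1 1
  simp only [Pi.one_apply, one_mul, pow_one, one_add_one_eq_two] at this
  rw [this]; simp [mul_comm]

lemma sum_sideWeight_mul_sq (hA : IsCone A) (hb : 0 < b) :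
    ∑ i, sideWeight K b A (0 : Fin (1 + 1)) x i * (x i / b) ^ 2 = kCurv K b A x := by
  have := sum_sideWeight_mul (K := K) (x := x) hA hb 1 2
  simp only [Pi.one_apply, one_mul] at this
  rw [this, kCurv, sq]

/-- Quadratic expansion of a weighted average. -/
lemma abs_sum_sideWeight_quadratic_le (hA : IsCone A) (hb : 0 < b) (hD : kDet K b A x ≠ 0)
    (hK : ∀ u, u ∉ Icc (-1 : ℝ) 1 → K u = 0)
    {g : ℝ → ℝ} {α₀ α₁ α₂ r : ℝ} {G : Set ℝ} (hx : ∀ i, x i ∈ G)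
    (hg : ∀ t ∈ A ∩ G, |t| ≤ b → |g t - (α₀ + α₁ * t + α₂ / 2 * t ^ 2)| ≤ r) :
    |∑ i, sideWeight K b A (0 : Fin (1 + 1)) x i * g (x i) -
      (α₀ + α₂ / 2 * b ^ 2 * kCurv K b A x)| ≤
      r * ∑ i, |sideWeight K b A (0 : Fin (1 + 1)) x i| := by
  have e : ∑ i, sideWeight K b A (0 : Fin (1 + 1)) x i * g (x i) -
      (α₀ + α₂ / 2 * b ^ 2 * kCurv K b A x) =
      ∑ i, sideWeight K b A (0 : Fin (1 + 1)) x i *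
        (g (x i) - (α₀ + α₁ * x i + α₂ / 2 * x i ^ 2)) := by
    have h0 := sum_sideWeight hA hb hD
    have h1 := sum_sideWeight_mul_self (K := K) (x := x) hA hb
    have h2 := sum_sideWeight_mul_sq (K := K) (x := x) hA hb
    have hi : ∀ i, sideWeight K b A (0 : Fin (1 + 1)) x i *
        (g (x i) - (α₀ + α₁ * x i + α₂ / 2 * x i ^ 2)) =
        sideWeight K b A (0 : Fin (1 + 1)) x i * g (x i) -
        (α₀ * sideWeight K b A (0 : Fin (1 + 1)) x i +
          α₁ * b * (sideWeight K b A (0 : Fin (1 + 1)) x i * (x i / b)) +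
          α₂ / 2 * b ^ 2 * (sideWeight K b A (0 : Fin (1 + 1)) x i * (x i / b) ^ 2)) := by
      intro i
      field_simp
    simp_rw [hi, Finset.sum_sub_distrib, Finset.sum_add_distrib, ← Finset.mul_sum]
    rw [h0, h1, h2]
    ring
  rw [e, Finset.mul_sum]
  refine (Finset.abs_sum_le_sum_abs _ _).trans (Finset.sum_le_sum fun i _ => ?_)
  rw [abs_mul, mul_comm]
  by_cases h0 : sideWeight K b A (0 : Fin (1 + 1)) x i = 0
  · simp [h0]
  obtain ⟨hi, hib⟩ := sideWeight_eq_zero hA hb hK h0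
  exact mul_le_mul_of_nonneg_right (hg _ ⟨hi, hx i⟩ hib) (abs_nonneg _)

/-- Subsample weights are close to the share of the subsample. -/
lemma abs_sum_mul_sideWeight_sub_le (hA : IsCone A) (hb : 0 < b) (hD : 0 < kDet K b A x)
    {N W ρ π : ℝ} (hN : 0 < N) (h1 : |kMoment K b A 1 x 1| / kDet K b A x ≤ W / N)
    (h2 : |kMoment K b A 1 x 2| / kDet K b A x ≤ W / N) {a : Fin n → ℝ}
    (ha : ∀ m < 3, |kMoment K b A a x m / N - π * (kMoment K b A 1 x m / N)| ≤ ρ) :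
    |∑ i, a i * sideWeight K b A (0 : Fin (1 + 1)) x i - π| ≤ 2 * W * ρ ∧
    |∑ i, a i * (sideWeight K b A (0 : Fin (1 + 1)) x i * (x i / b))| ≤ 2 * W * ρ := by
  have hW : 0 ≤ W / N := le_trans (by positivity) h1
  have ha' : ∀ m < 3, |kMoment K b A a x m - π * kMoment K b A 1 x m| ≤ N * ρ := fun m hm => by
    have := ha m hm
    rw [← mul_div_assoc, ← sub_div, abs_div, abs_of_pos hN, div_le_iff₀ hN] at this
    linarith
  -- If the subsample moments were exactly π times the full ones, the two sums would be π and 0.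
  -- They are linear in the deviations, which are at most N ρ and carry multipliers at most W / N.
  have key : ∀ m < 2, |kMoment K b A 1 x 2 / kDet K b A x *
      (kMoment K b A a x m - π * kMoment K b A 1 x m) - kMoment K b A 1 x 1 / kDet K b A x *
      (kMoment K b A a x (m + 1) - π * kMoment K b A 1 x (m + 1))| ≤ 2 * W * ρ := by
    intro m hm
    refine (abs_sub _ _).trans ?_
    rw [abs_mul, abs_mul, abs_div, abs_div, abs_of_pos hD]
    have e1 := mul_le_mul h2 (ha' m (by omega)) (abs_nonneg _) hW
    have e2 := mul_le_mul h1 (ha' (m + 1) (by omega)) (abs_nonneg _) hW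
    have e3 : W / N * (N * ρ) = W * ρ := by field_simp
    linarith
  have hD' := hD.ne'
  constructor
  · have e := sum_sideWeight_mul (K := K) (x := x) hA hb a 0
    simp only [pow_zero, mul_one] at e
    rw [e]
    convert key 0 (by norm_num) using 2
    field_simp
    rw [kDet]; ring
  · have e := sum_sideWeight_mul (K := K) (x := x) hA hb a 1
    simp only [pow_one] at e
    rw [e]
    convert key 1 (by norm_num) using 2
    field_simp
    ring

/-- Over a fold the weights neither sum to one nor annihilate linear terms, so both sums are kept;
`abs_sum_mul_sideWeight_sub_le` controls them. -/
lemma abs_sum_mul_sideWeight_linear_le (hA : IsCone A) (hb : 0 < b)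
    (hK : ∀ u, u ∉ Icc (-1 : ℝ) 1 → K u = 0) {a : Fin n → ℝ} (ha : ∀ i, |a i| ≤ 1)
    {g : ℝ → ℝ} {α₀ α₁ r : ℝ} {G : Set ℝ} (hx : ∀ i, x i ∈ G)
    (hg : ∀ t ∈ A ∩ G, |t| ≤ b → |g t - (α₀ + α₁ * t)| ≤ r) :
    |∑ i, a i * (sideWeight K b A (0 : Fin (1 + 1)) x i * g (x i)) -
      (α₀ * ∑ i, a i * sideWeight K b A (0 : Fin (1 + 1)) x i +
        α₁ * b * ∑ i, a i * (sideWeight K b A (0 : Fin (1 + 1)) x i * (x i / b)))| ≤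
      r * ∑ i, |sideWeight K b A (0 : Fin (1 + 1)) x i| := by
  have hi : ∑ i, a i * (sideWeight K b A (0 : Fin (1 + 1)) x i * g (x i)) -
      (α₀ * ∑ i, a i * sideWeight K b A (0 : Fin (1 + 1)) x i +
        α₁ * b * ∑ i, a i * (sideWeight K b A (0 : Fin (1 + 1)) x i * (x i / b))) =
      ∑ i, a i * (sideWeight K b A (0 : Fin (1 + 1)) x i * (g (x i) - (α₀ + α₁ * x i))) := by
    rw [Finset.mul_sum, Finset.mul_sum, ← Finset.sum_add_distrib, ← Finset.sum_sub_distrib]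
    refine Finset.sum_congr rfl fun i _ => ?_
    field_simp
  rw [hi, Finset.mul_sum]
  refine (Finset.abs_sum_le_sum_abs _ _).trans (Finset.sum_le_sum fun i _ => ?_)
  rw [abs_mul, abs_mul]
  refine (mul_le_of_le_one_left (by positivity) (ha i)).trans ?_
  rw [mul_comm]
  by_cases h0 : sideWeight K b A (0 : Fin (1 + 1)) x i = 0
  · simp [h0]
  obtain ⟨hi, hib⟩ := sideWeight_eq_zero hA hb hK h0
  exact mul_le_mul_of_nonneg_right (hg _ ⟨hi, hx i⟩ hib) (abs_nonneg _)

end Weights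

/-! ### Nearest neighbours -/

/-- With distinct values, the number of strictly smaller values is an injective rank with values
below the cardinality, so every rank below `R` is taken exactly once. -/
lemma card_filter_rank_lt {ι : Type*} [DecidableEq ι] (s : Finset ι) {f : ι → ℝ}
    (hf : Set.InjOn f s) {R : ℕ} (hR : R ≤ s.card) :
    (s.filter fun j => (s.filter fun k => f k < f j).card < R).card = R := by
  set r : ι → ℕ := fun j => (s.filter fun k => f k < f j).card
  have hlt : ∀ j ∈ s, ∀ k ∈ s, f j < f k → r j < r k := by
    intro j hj k _ hjk
    refine Finset.card_lt_card ⟨fun l hl => ?_, fun h => ?_⟩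
    · rw [Finset.mem_filter] at hl ⊢
      exact ⟨hl.1, hl.2.trans hjk⟩
    · have := h (Finset.mem_filter.2 ⟨hj, hjk⟩)
      exact lt_irrefl _ (Finset.mem_filter.1 this).2
  have hinj : Set.InjOn r s := by
    intro j hj k hk hjk
    by_contra hne
    rcases lt_or_gt_of_ne (fun h => hne (hf hj hk h)) with h | h
    · exact absurd hjk (hlt j hj k hk h).ne
    · exact absurd hjk (hlt k hk j hj h).ne'
  have himg : s.image r = Finset.range s.card := by
    apply Finset.eq_of_subset_of_card_le
    · intro m hm
      obtain ⟨j, hj, rfl⟩ := Finset.mem_image.1 hm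
      rw [Finset.mem_range]
      refine Finset.card_lt_card ⟨Finset.filter_subset _ _, fun h => ?_⟩
      exact lt_irrefl _ (Finset.mem_filter.1 (h hj)).2
    · rw [Finset.card_range, Finset.card_image_of_injOn hinj]
  rw [← Finset.card_image_of_injOn (f := r) (hinj.mono (Finset.filter_subset _ _))]
  have : (s.filter fun j => r j < R).image r = Finset.range R := by
    ext m
    simp only [Finset.mem_image, Finset.mem_filter, Finset.mem_range]
    constructor
    · rintro ⟨j, ⟨_, h⟩, rfl⟩; exact h
    · intro hm
      have : m ∈ s.image r := by rw [himg, Finset.mem_range]; omega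
      obtain ⟨j, hj, rfl⟩ := Finset.mem_image.1 this
      exact ⟨j, ⟨hj, hm⟩, rfl⟩
  rw [this, Finset.card_range]

/-- No two units share a value of the running variable, and no two units are equally far from a
third one. -/
def NoTies {n : ℕ} (x : Fin n → ℝ) : Prop :=
  Function.Injective x ∧ ∀ i j k, j ≠ i → k ≠ i → j ≠ k → |x j - x i| ≠ |x k - x i|

section Neighbors

variable {R n : ℕ} {x : Fin n → ℝ}

lemma card_neighbors (hx : NoTies x) (i : Fin n)
    (hR : R ≤ (Finset.univ.filter fun j => j ≠ i ∧ (0 ≤ x j ↔ 0 ≤ x i)).card) :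
    (neighbors R x i).card = R := by
  classical
  have h := card_filter_rank_lt (Finset.univ.filter fun j => j ≠ i ∧ (0 ≤ x j ↔ 0 ≤ x i))
    (f := fun j => |x j - x i|) (fun j hj k hk hjk => by
      by_contra hne
      simp only [Finset.coe_filter, Finset.mem_univ, true_and, mem_ofPred_eq] at hj hk
      exact hx.2 i j k hj.1 hk.1 hne hjk) hR
  refine Eq.trans (congrArg Finset.card ?_) h
  ext j
  simp only [neighbors, Finset.mem_filter, Finset.mem_univ, true_and, Finset.filter_filter,
    and_assoc]

lemma mem_neighbors_side {i j : Fin n} (h : j ∈ neighbors R x i) :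
    j ≠ i ∧ (0 ≤ x j ↔ 0 ≤ x i) := by
  simp only [neighbors, Finset.mem_filter] at h
  exact ⟨h.2.1, h.2.2.1⟩

/-- Unit `i` prefers every other member of `Q` to its neighbour `j`, and a neighbour has fewer than
`R` preferred competitors. In the counting arguments below `i` is an extreme member of `Q`. -/
lemma card_le_of_closer (Q : Finset (Fin n)) {i j : Fin n}
    (hj : j ∈ neighbors R x i)
    (hQ : ∀ k ∈ Q, k ≠ i → (0 ≤ x k ↔ 0 ≤ x i) ∧ |x k - x i| < |x j - x i|) : Q.card ≤ R := by
  classical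
  simp only [neighbors, Finset.mem_filter] at hj
  have h1 : (Q.erase i).card < R := by
    refine lt_of_le_of_lt (Finset.card_le_card fun k hk => ?_) hj.2.2.2
    rw [Finset.mem_erase] at hk
    simp only [Finset.mem_filter, Finset.mem_univ, true_and]
    exact ⟨hk.1, hQ k hk.2 hk.1⟩
  have h2 := Finset.pred_card_le_card_erase (s := Q) (a := i)
  omega

/-- Among the units on a given side of `j` that count `j` as a neighbour, the farthest one prefers
all the others to `j`, since they lie in between. Hence at most `R` units in each of the two
directions. -/
lemma card_filter_mem_neighbors_le (hx : NoTies x) (j : Fin n) :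
    (Finset.univ.filter fun i => j ∈ neighbors R x i).card ≤ 2 * R := by
  classical
  have hpart : ∀ ε : ℝ, ε ^ 2 = 1 →
      (Finset.univ.filter fun i => j ∈ neighbors R x i ∧ ε * x j < ε * x i).card ≤ R := by
    intro ε hε
    have hε' : |ε| = 1 := by rw [← sq_eq_sq₀ (abs_nonneg _) zero_le_one, sq_abs, hε, one_pow]
    set Q := Finset.univ.filter fun i => j ∈ neighbors R x i ∧ ε * x j < ε * x i
    rcases Q.eq_empty_or_nonempty with hQ | hQ
    · rw [hQ]; simp
    obtain ⟨i, hi, hmax⟩ := Q.exists_max_image (fun i => ε * x i) hQ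
    have hi' := (Finset.mem_filter.1 hi).2
    refine card_le_of_closer Q hi'.1 fun k hk hki => ?_
    have hk' := (Finset.mem_filter.1 hk).2
    refine ⟨(mem_neighbors_side hk'.1).2.symm.trans (mem_neighbors_side hi'.1).2, ?_⟩
    have hlt : ε * x k < ε * x i := by
      refine lt_of_le_of_ne (hmax k hk) fun h => hki (hx.1 ?_)
      exact mul_left_cancel₀ (by rintro rfl; norm_num at hε) h
    have e : ∀ a c : ℝ, |a - c| = |ε * a - ε * c| := fun a c => by
      rw [← mul_sub, abs_mul, hε', one_mul]
    rw [e (x k), e (x j), abs_of_neg (by linarith), abs_of_neg (by linarith)]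
    linarith
  have h1 := hpart 1 (by norm_num)
  have h2 := hpart (-1) (by norm_num)
  refine (Finset.card_le_card (t := (Finset.univ.filter fun i => j ∈ neighbors R x i ∧
    1 * x j < 1 * x i) ∪ (Finset.univ.filter fun i => j ∈ neighbors R x i ∧
    -1 * x j < -1 * x i)) fun i hi => ?_).trans ((Finset.card_union_le _ _).trans (by omega))
  simp only [Finset.mem_filter, Finset.mem_univ, true_and, Finset.mem_union] at hi ⊢
  have : x i ≠ x j := fun h => (mem_neighbors_side hi).1 (hx.1 h).symm
  rcases lt_or_gt_of_ne this with h | h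
  · exact Or.inr ⟨hi, by linarith⟩
  · exact Or.inl ⟨hi, by linarith⟩

/-- Few units in a window have a neighbour outside of the window. -/
lemma card_filter_neighbors_outside_le (b : ℝ) :
    (Finset.univ.filter fun i => |x i| ≤ b ∧ ∃ j ∈ neighbors R x i, b < |x j|).card ≤ 2 * R := by
  classical
  -- On one side of the cutoff, take the unit of `Q` closest to zero. Its neighbour outside the
  -- window lies beyond all members of `Q`, so they are preferred to that neighbour.
  have hcore : ∀ Q : Finset (Fin n), (∀ i ∈ Q, |x i| ≤ b ∧ ∃ j ∈ neighbors R x i, b < |x j|) →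
      (∀ i ∈ Q, ∀ k ∈ Q, (0 ≤ x k ↔ 0 ≤ x i)) → Q.card ≤ R := by
    intro Q hQ hside
    rcases Q.eq_empty_or_nonempty with h0 | h0
    · rw [h0]; simp
    obtain ⟨i, hi, hmin⟩ := Q.exists_min_image (fun i => |x i|) h0
    obtain ⟨hib, j, hj, hjb⟩ := hQ i hi
    have hjs := (mem_neighbors_side hj).2
    refine card_le_of_closer Q hj fun k hk hki => ⟨hside i hi k hk, ?_⟩
    have hkb := (hQ k hk).1
    have hks := hside i hi k hk
    have hmk : |x i| ≤ |x k| := hmin k hk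
    by_cases hpos : 0 ≤ x i
    · have h1 := hks.2 hpos
      have h2 := hjs.2 hpos
      rw [abs_of_nonneg hpos] at hmk
      rw [abs_of_nonneg h1] at hkb hmk
      rw [abs_of_nonneg h2] at hjb
      rw [abs_of_nonneg (by linarith), abs_of_nonneg (by linarith)]
      linarith
    · have h1 : x k < 0 := not_le.1 fun h => hpos (hks.1 h)
      have h2 : x j < 0 := not_le.1 fun h => hpos (hjs.1 h)
      rw [abs_of_neg (not_le.1 hpos)] at hmk
      rw [abs_of_neg h1] at hkb hmk
      rw [abs_of_neg h2] at hjb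
      rw [abs_of_nonpos (by linarith), abs_of_nonpos (by linarith)]
      linarith
  set P : Fin n → Prop := fun i => |x i| ≤ b ∧ ∃ j ∈ neighbors R x i, b < |x j|
  have h1 := hcore (Finset.univ.filter fun i => P i ∧ 0 ≤ x i)
    (fun i hi => ((Finset.mem_filter.1 hi).2).1) fun i hi k hk => by
      simp [((Finset.mem_filter.1 hi).2).2, ((Finset.mem_filter.1 hk).2).2]
  have h2 := hcore (Finset.univ.filter fun i => P i ∧ ¬ 0 ≤ x i)
    (fun i hi => ((Finset.mem_filter.1 hi).2).1) fun i hi k hk => by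
      simp only [((Finset.mem_filter.1 hi).2).2, ((Finset.mem_filter.1 hk).2).2]
  refine (Finset.card_le_card (t := (Finset.univ.filter fun i => P i ∧ 0 ≤ x i) ∪
    (Finset.univ.filter fun i => P i ∧ ¬ 0 ≤ x i)) fun i hi => ?_).trans
    ((Finset.card_union_le _ _).trans (by omega))
  have hi' : P i := (Finset.mem_filter.1 hi).2
  simp only [Finset.mem_filter, Finset.mem_univ, true_and, Finset.mem_union]
  exact (em (0 ≤ x i)).imp (⟨hi', ·⟩) (⟨hi', ·⟩)

end Neighbors

/-! ### The design of the running variable -/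

/-- The coordinate `x j` is independent of the combination on the right and has no atoms. The case
`i = k` is allowed and covers plain ties. -/
lemma measure_pi_hyperplane_eq_zero {μ : Measure ℝ} [IsProbabilityMeasure μ]
    [NullSingletonClass μ] {n : ℕ} {i j k : Fin n} (hij : i ≠ j) (hkj : k ≠ j) (α β : ℝ) :
    Measure.pi (fun _ : Fin n => μ) {x | x j = α * x i + β * x k} = 0 := by
  set P := Measure.pi (fun _ : Fin n => μ)
  have hind : iIndepFun (fun (i : Fin n) (x : Fin n → ℝ) => x i) P :=
    iIndepFun_pi (X := fun _ => id) fun _ => aemeasurable_id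
  have h2 := (hind.indepFun_prodMk (fun i => measurable_pi_apply i) i k j hij hkj).comp
    (φ := fun p : ℝ × ℝ => α * p.1 + β * p.2) (ψ := id) (by fun_prop) measurable_id
  have hmap := (indepFun_iff_map_prod_eq_prod_map_map (by fun_prop)
    (measurable_id.comp (measurable_pi_apply j)).aemeasurable).1 h2
  have hm : MeasurableSet {p : ℝ × ℝ | p.2 = p.1} := measurableSet_eq_fun (by fun_prop) (by fun_prop)
  have hj : P.map (id ∘ fun x : Fin n → ℝ => x j) = μ := (measurePreserving_eval (fun _ => μ) j).map_eq
  have : P {x | x j = α * x i + β * x k} =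
      (P.map fun x => (((fun p : ℝ × ℝ => α * p.1 + β * p.2) ∘ fun x : Fin n → ℝ => (x i, x k)) x,
        (id ∘ fun x : Fin n → ℝ => x j) x)) {p : ℝ × ℝ | p.2 = p.1} := by
    rw [Measure.map_apply (by fun_prop) hm]; rfl
  rw [this, hmap, hj, Measure.measure_prod_null hm]
  refine ae_of_all _ fun y => ?_
  have : Prod.mk y ⁻¹' {p : ℝ × ℝ | p.2 = p.1} = {y} := by ext z; simp
  simp only [this, measure_singleton, Pi.zero_apply]

/-- Two units equally far from a third one coincide or are reflections of each other in it, `x j = 2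
* x i - x k`. -/
lemma ae_noTies {μ : Measure ℝ} [IsProbabilityMeasure μ] [NullSingletonClass μ] (n : ℕ) :
    ∀ᵐ x ∂(Measure.pi fun _ : Fin n => μ), NoTies x := by
  have h1 : ∀ i j : Fin n, ∀ᵐ x ∂(Measure.pi fun _ : Fin n => μ), i ≠ j → x j ≠ x i := by
    intro i j
    by_cases hij : i = j
    · simp [hij]
    have := measure_pi_hyperplane_eq_zero (μ := μ) hij hij 1 0
    rw [ae_iff]
    convert this using 3
    simp [hij]
  have h2 : ∀ i j k : Fin n, ∀ᵐ x ∂(Measure.pi fun _ : Fin n => μ),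
      i ≠ j → k ≠ j → x j ≠ 2 * x i + (-1) * x k := by
    intro i j k
    by_cases hij : i = j
    · simp [hij]
    by_cases hkj : k = j
    · simp [hkj]
    have := measure_pi_hyperplane_eq_zero (μ := μ) hij hkj 2 (-1)
    rw [ae_iff]
    convert this using 3
    simp [hij, hkj]
  filter_upwards [ae_all_iff.2 fun i => ae_all_iff.2 (h1 i),
    ae_all_iff.2 fun i => ae_all_iff.2 fun j => ae_all_iff.2 (h2 i j)] with x hx1 hx2
  refine ⟨fun i j hij => by_contra fun hne => hx1 i j hne hij.symm, fun i j k hj hk hjk h => ?_⟩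
  rcases abs_eq_abs.1 h with h | h
  · exact hx1 j k hjk (by linarith)
  · exact hx2 i j k hj.symm hjk.symm (by linarith)

/-! ### Kernel averages of the running variable. -/

namespace RDDesign

variable (D : RDDesign)

instance : NullSingletonClass D.lawX := by unfold lawX; infer_instance

lemma lawX_Icc_le {M b : ℝ} (hM : ∀ x ∈ Icc (-b) b, D.fX x ≤ M) (hb : 0 ≤ b) :
    D.lawX.real (Icc (-b) b) ≤ M * (2 * b) := by
  have hM0 : 0 ≤ M := (D.fX_nonneg 0).trans (hM 0 (by simpa using hb))
  rw [measureReal_def]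
  refine ENNReal.toReal_le_of_le_ofReal (by positivity) ?_
  rw [lawX, withDensity_apply _ measurableSet_Icc]
  calc _ ≤ ∫⁻ _ in Icc (-b) b, ENNReal.ofReal M :=
        setLIntegral_mono measurable_const fun x hx => ENNReal.ofReal_le_ofReal (hM x hx)
    _ = _ := by
        rw [setLIntegral_const, Real.volume_Icc, ← ENNReal.ofReal_mul hM0]
        congr 1; ring

lemma integral_lawX (g : ℝ → ℝ) : ∫ x, g x ∂D.lawX = ∫ x, g x * D.fX x := by
  rw [lawX, integral_withDensity_eq_integral_toReal_smul (by exact D.measurable_fX.ennreal_ofReal)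
    (by simp)]
  refine integral_congr_ae (ae_of_all _ fun x => ?_)
  simp [ENNReal.toReal_ofReal (D.fX_nonneg x), mul_comm]

lemma integral_lawX_comp_div (g : ℝ → ℝ) {b : ℝ} (hb : 0 < b) :
    (∫ x, g (x / b) ∂D.lawX) / b = ∫ u, g u * D.fX (b * u) := by
  rw [integral_lawX]
  have := Measure.integral_comp_div (fun u => g u * D.fX (b * u)) b
  rw [abs_of_pos hb, smul_eq_mul] at this
  rw [div_eq_iff hb.ne', mul_comm, ← this]
  refine integral_congr_ae (ae_of_all _ fun x => ?_)
  simp only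
  rw [mul_div_cancel₀ _ hb.ne']

/-- After the substitution x = h u the density is evaluated at h u, which tends to zero; continuity
there gives both the pointwise limit and the dominating bound. -/
lemma tendsto_integral_lawX_comp_div (hf : ContinuousAt D.fX 0) {h : ℕ → ℝ} (hpos : ∀ n, 0 < h n)
    (h0 : Tendsto h atTop (𝓝 0)) {g : ℝ → ℝ} (hg : Measurable g) {k : ℝ} (hk : ∀ u, |g u| ≤ k)
    (hsupp : ∀ u, u ∉ Icc (-1 : ℝ) 1 → g u = 0) :
    Tendsto (fun n => (∫ x, g (x / h n) ∂D.lawX) / h n) atTop (𝓝 (D.fX 0 * ∫ u, g u)) := by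
  simp_rw [fun n => D.integral_lawX_comp_div g (hpos n)]
  rw [← integral_const_mul]
  have hk0 : 0 ≤ k := (abs_nonneg _).trans (hk 0)
  refine tendsto_integral_filter_of_dominated_convergence
    ((Icc (-1 : ℝ) 1).indicator fun _ => k * (|D.fX 0| + 1)) ?_ ?_ ?_ ?_
  · refine Eventually.of_forall fun n => ?_
    exact (hg.mul (D.measurable_fX.comp (by fun_prop))).aestronglyMeasurable
  · obtain ⟨δ, hδ, hd⟩ := Metric.continuousAt_iff.1 hf 1 one_pos
    filter_upwards [h0.eventually (gt_mem_nhds hδ)] with n hn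
    refine ae_of_all _ fun u => ?_
    by_cases hu : u ∈ Icc (-1 : ℝ) 1
    · rw [indicator_of_mem hu, norm_mul]
      have : dist (h n * u) 0 < δ := by
        rw [Real.dist_eq, sub_zero, abs_mul, abs_of_pos (hpos n)]
        exact (mul_le_of_le_one_right (hpos n).le (abs_le.2 hu)).trans_lt hn
      have := hd this
      rw [Real.dist_eq] at this
      refine mul_le_mul (hk u) ?_ (norm_nonneg _) hk0
      have := abs_sub_abs_le_abs_sub (D.fX (h n * u)) (D.fX 0)
      rw [Real.norm_eq_abs]
      linarith
    · rw [hsupp u hu, indicator_of_notMem hu]; simp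
  · exact (integrable_indicator_iff measurableSet_Icc).2 (integrableOn_const (by simp))
  · refine ae_of_all _ fun u => ?_
    rw [mul_comm (D.fX 0)]
    have : Tendsto (fun n => h n * u) atTop (𝓝 0) := by simpa using h0.mul_const u
    exact (hf.tendsto.comp this).const_mul _

/-- Chebyshev's inequality for weighted kernel sums. -/
lemma measure_abs_kernel_sum_ge_le {g : ℝ → ℝ} (hg : Measurable g) {k : ℝ} (hk : ∀ u, |g u| ≤ k)
    (hsupp : ∀ u, u ∉ Icc (-1 : ℝ) 1 → g u = 0) {b M : ℝ} (hb : 0 < b)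
    (hM : ∀ x ∈ Icc (-b) b, D.fX x ≤ M) {n : ℕ} {a : Fin n → ℝ} (ha : ∀ i, |a i| ≤ 1) {t : ℝ}
    (ht : 0 < t) :
    Measure.pi (fun _ : Fin n => D.lawX)
      {x | t ≤ |∑ i, a i * g (x i / b) - (∑ i, a i) * ∫ y, g (y / b) ∂D.lawX|} ≤
      ENNReal.ofReal (2 * k ^ 2 * M * (n * b) / t ^ 2) := by
  set m := ∫ y, g (y / b) ∂D.lawX with hm
  have hk0 : 0 ≤ k := (abs_nonneg _).trans (hk 0)
  have hgm : Measurable fun y => g (y / b) := hg.comp (by fun_prop)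
  have hgL : MemLp (fun y => g (y / b)) 2 D.lawX :=
    MemLp.of_bound hgm.aestronglyMeasurable k (ae_of_all _ fun y => hk _)
  have hmem : ∀ i, MemLp (fun y => a i * (g (y / b) - m)) 2 D.lawX := fun i =>
    (hgL.sub (memLp_const m)).const_mul (a i)
  have hmean : ∀ i, ∫ y, a i * (g (y / b) - m) ∂D.lawX = 0 := fun i => by
    rw [integral_const_mul, integral_sub (hgL.integrable (by norm_num)) (integrable_const _)]
    simp [hm]
  have h := measure_pi_abs_sum_ge_le (ν := fun _ : Fin n => D.lawX) hmem hmean ht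
  have hsq : ∀ i, ∫ y, (a i * (g (y / b) - m)) ^ 2 ∂D.lawX ≤ k ^ 2 * (M * (2 * b)) := by
    intro i
    have e1 : ∫ y, (a i * (g (y / b) - m)) ^ 2 ∂D.lawX =
        a i ^ 2 * variance (fun y => g (y / b)) D.lawX := by
      rw [variance_eq_integral hgm.aemeasurable, ← integral_const_mul]
      refine integral_congr_ae (ae_of_all _ fun y => ?_)
      simp only [← hm]; ring
    have e2 : variance (fun y => g (y / b)) D.lawX ≤ ∫ y, g (y / b) ^ 2 ∂D.lawX :=
      variance_le_expectation_sq hgm.aestronglyMeasurable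
    have e3 : ∫ y, g (y / b) ^ 2 ∂D.lawX ≤ k ^ 2 * D.lawX.real (Icc (-b) b) := by
      rw [← integral_indicator_one measurableSet_Icc, ← integral_const_mul]
      refine integral_mono hgL.integrable_sq
        (((integrable_const 1).indicator measurableSet_Icc).const_mul _) fun y => ?_
      by_cases hy : y ∈ Icc (-b) b
      · simp only [indicator_of_mem hy, Pi.one_apply, mul_one]
        rw [← sq_abs]
        exact pow_le_pow_left₀ (abs_nonneg _) (hk _) 2
      · have : y / b ∉ Icc (-1 : ℝ) 1 := by
          rw [mem_Icc, ← abs_le, abs_div, abs_of_pos hb, div_le_one hb, abs_le]; exact hy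
        simp [hsupp _ this, hy]
    have ha2 : a i ^ 2 ≤ 1 := by rw [sq_le_one_iff_abs_le_one]; exact ha i
    rw [e1]
    calc _ ≤ variance (fun y => g (y / b)) D.lawX :=
          mul_le_of_le_one_left (variance_nonneg _ _) ha2
      _ ≤ _ := e2.trans (e3.trans (mul_le_mul_of_nonneg_left (D.lawX_Icc_le hM hb.le)
          (sq_nonneg k)))
  have hset : {x : Fin n → ℝ | t ≤ |∑ i, a i * g (x i / b) - (∑ i, a i) * m|} =
      {x | t ≤ |∑ i, a i * (g (x i / b) - m)|} := by
    ext x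
    simp only [mem_ofPred_eq, mul_sub, Finset.sum_sub_distrib, Finset.sum_mul]
  rw [hset]
  refine h.trans (ENNReal.ofReal_le_ofReal ?_)
  gcongr
  calc _ ≤ ∑ _i : Fin n, k ^ 2 * (M * (2 * b)) := Finset.sum_le_sum fun i _ => hsq i
    _ = _ := by simp; ring

end RDDesign

/-- The two sides of the cutoff. -/
def side (p : Bool) : Set ℝ := if p then Ici 0 else Iio 0

lemma isCone_side (p : Bool) : IsCone (side p) := by
  cases p <;> simp only [side] <;> [exact isCone_Iio; exact isCone_Ici]

lemma measurableSet_side (p : Bool) : MeasurableSet (side p) := by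
  cases p <;> simp [side]

/-- One-sided moments of the kernel. -/
def sideInt (K : ℝ → ℝ) (p : Bool) (m : ℕ) : ℝ := ∫ u, (side p).indicator K u * u ^ m

/-- Positivity of the density puts a neighbourhood of the cutoff into the support, so that off zero
derivatives within the support become ordinary ones. Continuity bounds the density on the shrinking
windows. -/
lemma exists_fX_bound (D : RDDesign) {h : ℕ → ℝ} {K : ℝ → ℝ} (hReg : Regularity D h K) :
    ContinuousAt D.fX 0 ∧ 0 < D.fX 0 ∧ (∃ ε > 0, Ioo (-ε) ε ⊆ D.suppX) ∧
    ∃ M > 0, ∀ᶠ n in atTop, ∀ x ∈ Icc (-h n) (h n), D.fX x ≤ M := by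
  obtain ⟨U, hU, h0, hc, c, hc0, hcU⟩ := hReg.density
  have hca : ContinuousAt D.fX 0 := hc.continuousAt (hU.mem_nhds h0)
  refine ⟨hca, hc0.trans_le (hcU 0 h0), ?_, |D.fX 0| + 1, by positivity, ?_⟩
  · obtain ⟨ε, hε, hεU⟩ := Metric.isOpen_iff.1 hU 0 h0
    refine ⟨ε, hε, fun x hx => ?_⟩
    rw [RDDesign.suppX, Measure.mem_support_iff_forall]
    intro V hV
    have hxU : U ∈ 𝓝 x := hU.mem_nhds (hεU (by
      rw [Metric.mem_ball, Real.dist_eq, sub_zero]; exact abs_lt.2 hx))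
    obtain ⟨W, hW, hWo, hxW⟩ := mem_nhds_iff.1 (inter_mem hV hxU)
    refine lt_of_lt_of_le ?_ (measure_mono (hW.trans inter_subset_left))
    rw [RDDesign.lawX, withDensity_apply _ hWo.measurableSet]
    calc 0 < ENNReal.ofReal c * volume W :=
          ENNReal.mul_pos (by simpa using hc0) (hWo.measure_pos _ ⟨x, hxW⟩).ne'
      _ = ∫⁻ _ in W, ENNReal.ofReal c := by rw [setLIntegral_const]
      _ ≤ _ := setLIntegral_mono D.measurable_fX.ennreal_ofReal fun y hy =>
          ENNReal.ofReal_le_ofReal (hcU y (hW hy).2)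
  · obtain ⟨δ, hδ, hd⟩ := Metric.continuousAt_iff.1 hca 1 one_pos
    filter_upwards [hReg.bandwidth_zero.eventually (gt_mem_nhds hδ)] with n hn x hx
    have : dist x 0 < δ := by
      rw [Real.dist_eq, sub_zero]; exact (abs_le.2 hx).trans_lt hn
    have := hd this
    rw [Real.dist_eq] at this
    have := (abs_lt.1 this).2
    linarith [le_abs_self (D.fX 0)]

/-! ### One-sided kernel moments and the limiting design. -/

section KernelMoments

variable {D : RDDesign} {K : ℝ → ℝ} {h : ℕ → ℝ}

lemma integrable_indicator_kernel (hReg : Regularity D h K) (p : Bool) {φ : ℝ → ℝ}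
    (hφ : Continuous φ) : Integrable fun u => (side p).indicator K u * φ u := by
  obtain ⟨k, hk⟩ := hReg.kernel_bounded
  have hk0 : 0 ≤ k := (hReg.kernel_nonneg 0).trans (hk 0)
  obtain ⟨C, hC⟩ := (isCompact_Icc (a := (-1 : ℝ)) (b := 1)).exists_bound_of_continuousOn
    hφ.continuousOn
  have hi : Integrable ((Icc (-1 : ℝ) 1).indicator fun _ => k * C) :=
    (integrable_indicator_iff measurableSet_Icc).2 (integrableOn_const (by simp))
  refine hi.mono' (((hReg.kernel_measurable.indicator (measurableSet_side p)).mul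
    hφ.measurable).aestronglyMeasurable) (ae_of_all _ fun u => ?_)
  by_cases hu : u ∈ Icc (-1 : ℝ) 1
  · rw [indicator_of_mem hu, norm_mul]
    refine mul_le_mul ?_ (hC u hu) (norm_nonneg _) hk0
    rw [Real.norm_of_nonneg (indicator_nonneg (fun u _ => hReg.kernel_nonneg u) _)]
    exact (indicator_le_self' (fun u _ => hReg.kernel_nonneg u) _).trans (hk _)
  · have : (side p).indicator K u = 0 := by
      rw [indicator_apply_eq_zero]; exact fun _ => hReg.kernel_zero u hu
    rw [this, indicator_of_notMem hu]; simp

/-- Symmetry of the kernel under reflection. Zero belongs to one side only and is discarded as a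
null set. -/
lemma sideInt_false (hReg : Regularity D h K) (m : ℕ) :
    sideInt K false m = (-1) ^ m * sideInt K true m := by
  rw [sideInt, ← integral_neg_eq_self, sideInt, ← integral_const_mul]
  refine integral_congr_ae ?_
  have : ∀ᵐ u : ℝ, u ≠ 0 := by simp [ae_iff]
  filter_upwards [this] with u hu
  have e : (side false).indicator K (-u) = (side true).indicator K u := by
    rcases lt_or_gt_of_ne hu with h0 | h0
    · have h1 : -u ∉ side false := by simp [side, h0.le]
      have h2 : u ∉ side true := by simp [side, h0]
      rw [indicator_of_notMem h1, indicator_of_notMem h2]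
    · have h1 : -u ∈ side false := by simp [side, h0]
      have h2 : u ∈ side true := by simp [side, h0.le]
      rw [indicator_of_mem h1, indicator_of_mem h2, hReg.kernel_symm]
  rw [e, neg_pow u m]
  ring

lemma sideInt_zero_pos (hReg : Regularity D h K) (p : Bool) : 0 < sideInt K p 0 := by
  have h1 : sideInt K false 0 = sideInt K true 0 := by simpa using sideInt_false hReg 0
  have h2 : sideInt K false 0 + sideInt K true 0 = 1 := by
    rw [sideInt, sideInt, ← integral_add (integrable_indicator_kernel hReg false (by fun_prop))
      (integrable_indicator_kernel hReg true (by fun_prop)), ← hReg.kernel_integral]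
    refine integral_congr_ae (ae_of_all _ fun u => ?_)
    rcases lt_or_ge u 0 with h0 | h0
    · simp [side, indicator, h0, not_le.2 h0]
    · simp [side, indicator, h0, not_lt.2 h0]
  cases p <;> linarith

/-- With c = s₁ / s₀ the determinant is s₀ ∫ K(u) (u - c)² du over the side, positive because the
kernel mass cannot sit at the single point c. -/
lemma sideInt_det_pos (hReg : Regularity D h K) (p : Bool) :
    0 < sideInt K p 0 * sideInt K p 2 - sideInt K p 1 ^ 2 := by
  set s := sideInt K p
  have h0 : 0 < s 0 := sideInt_zero_pos hReg p
  set c := s 1 / s 0 with hc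
  have hnn : ∀ u, 0 ≤ (side p).indicator K u := fun u =>
    indicator_nonneg (fun u _ => hReg.kernel_nonneg u) u
  have e : ∫ u, (side p).indicator K u * (u - c) ^ 2 = s 2 - 2 * c * s 1 + c ^ 2 * s 0 := by
    have i2 := integrable_indicator_kernel hReg p (φ := fun u => u ^ 2) (by fun_prop)
    have i1 := integrable_indicator_kernel hReg p (φ := fun u => u ^ 1) (by fun_prop)
    have i0 := integrable_indicator_kernel hReg p (φ := fun u => u ^ 0) (by fun_prop)
    simp only [s, sideInt]
    have := integral_add (i2.sub (i1.const_mul (2 * c))) (i0.const_mul (c ^ 2))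
    simp only [Pi.sub_apply] at this
    rw [integral_sub i2 (i1.const_mul _), integral_const_mul, integral_const_mul] at this
    rw [← this]
    refine integral_congr_ae (ae_of_all _ fun u => ?_)
    simp only; ring
  have hpos : 0 < ∫ u, (side p).indicator K u * (u - c) ^ 2 := by
    rw [integral_pos_iff_support_of_nonneg (fun u => mul_nonneg (hnn u) (sq_nonneg _))
      (integrable_indicator_kernel hReg p (φ := fun u => (u - c) ^ 2)
        ((continuous_id.sub continuous_const).pow 2))]
    have h1 : 0 < volume (Function.support fun u => (side p).indicator K u * u ^ 0) := by
      rw [← integral_pos_iff_support_of_nonneg (fun u => by simpa using hnn u)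
        (integrable_indicator_kernel hReg p (by fun_prop))]
      exact h0
    have h2 : Function.support (fun u => (side p).indicator K u * u ^ 0) \ {c} ⊆
        Function.support fun u => (side p).indicator K u * (u - c) ^ 2 := by
      rintro u ⟨hu, huc⟩
      simp only [Function.mem_support, pow_zero, mul_one, mem_singleton_iff] at hu huc ⊢
      exact mul_ne_zero hu (pow_ne_zero 2 (sub_ne_zero.2 huc))
    refine lt_of_lt_of_le ?_ (measure_mono h2)
    rwa [measure_sdiff_null (by simp)]
  rw [e, hc] at hpos
  have := mul_pos h0 hpos
  field_simp at this
  nlinarith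

/-- Limits of the normalized kernel moments. -/
def limitMoment (D : RDDesign) (K : ℝ → ℝ) (p : Bool) (m : Fin 4) : ℝ := D.fX 0 * sideInt K p m

lemma limitMoment_det_pos (hReg : Regularity D h K) (p : Bool) :
    0 < limitMoment D K p 0 * limitMoment D K p 2 - limitMoment D K p 1 ^ 2 := by
  have h1 := sideInt_det_pos hReg p
  have h2 := (exists_fX_bound D hReg).2.1
  have := mul_pos (mul_pos h2 h2) h1
  simp only [limitMoment, Fin.val_zero, Fin.val_one, Fin.val_two]
  nlinarith

/-- Passing to the other side only flips the odd moments, which occur in products of two. The common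
limit removes from the bias any curvature shared by both sides. -/
lemma limitMoment_curv_eq (hReg : Regularity D h K) :
    (limitMoment D K false 2 ^ 2 - limitMoment D K false 1 * limitMoment D K false 3) /
      (limitMoment D K false 0 * limitMoment D K false 2 - limitMoment D K false 1 ^ 2) =
    (limitMoment D K true 2 ^ 2 - limitMoment D K true 1 * limitMoment D K true 3) /
      (limitMoment D K true 0 * limitMoment D K true 2 - limitMoment D K true 1 ^ 2) := by
  have h3 : ((3 : Fin 4) : ℕ) = 3 := rfl
  simp only [limitMoment, sideInt_false hReg, Fin.val_zero, Fin.val_one, Fin.val_two, h3]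
  congr 1 <;> ring

end KernelMoments

/-! ### Regular realizations of the running variable -/

/-- Share of fold `k`. -/
def foldShare {S n : ℕ} (s : Fin n → Fin S) (k : Fin S) : ℝ :=
  ((Finset.univ.filter fun i => s i = k).card : ℝ) / n

/-- Indicator of fold `k`. -/
def foldInd {S n : ℕ} (s : Fin n → Fin S) (k : Fin S) (i : Fin n) : ℝ := if s i = k then 1 else 0

/-- Realizations of the running variable for which the local linear weights behave regularly. -/
structure GoodDesign (D : RDDesign) (K : ℝ → ℝ) (b η ρ C : ℝ) {S n : ℕ} (s : Fin n → Fin S)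
    (x : Fin n → ℝ) : Prop where
  mem : ∀ i, x i ∈ D.suppX \ {0}
  noTies : NoTies x
  window : ((Finset.univ.filter fun i => |x i| ≤ b).card : ℝ) ≤ C * (n * b)
  moment : ∀ (p : Bool) (m : Fin 4),
    |kMoment K b (side p) 1 x m / (n * b) - limitMoment D K p m| < η
  fold : ∀ (p : Bool) (k : Fin S), ∀ m < 3, |kMoment K b (side p) (foldInd s k) x m / (n * b) -
    foldShare s k * (kMoment K b (side p) 1 x m / (n * b))| ≤ ρ

section GoodDesignProb

variable {D : RDDesign} {K : ℝ → ℝ} {h : ℕ → ℝ}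

lemma abs_indicator_mul_pow_le (hReg : Regularity D h K) {k : ℝ} (hk : ∀ u, K u ≤ k) (p : Bool)
    (m : ℕ) (u : ℝ) : |(side p).indicator K u * u ^ m| ≤ k := by
  have hk0 : 0 ≤ k := (hReg.kernel_nonneg 0).trans (hk 0)
  by_cases hu : u ∈ Icc (-1 : ℝ) 1
  · rw [abs_mul, abs_pow]
    refine (mul_le_of_le_one_right (abs_nonneg _)
      (pow_le_one₀ (abs_nonneg _) (abs_le.2 hu))).trans ?_
    rw [abs_of_nonneg (indicator_nonneg (fun u _ => hReg.kernel_nonneg u) _)]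
    exact (indicator_le_self' (fun u _ => hReg.kernel_nonneg u) _).trans (hk _)
  · have : (side p).indicator K u = 0 := by
      rw [indicator_apply_eq_zero]; exact fun _ => hReg.kernel_zero u hu
    rw [this]; simpa using hk0

/-- Deviation of a normalized kernel sum from its limit. -/
lemma tendsto_measure_kernel_sum (hReg : Regularity D h K) {g : ℝ → ℝ} (hg : Measurable g) {k : ℝ}
    (hk : ∀ u, |g u| ≤ k) (hsupp : ∀ u, u ∉ Icc (-1 : ℝ) 1 → g u = 0) {η : ℝ} (hη : 0 < η) :
    Tendsto (fun n => Measure.pi (fun _ : Fin n => D.lawX)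
      {x | η ≤ |(∑ i, g (x i / h n)) / (n * h n) - D.fX 0 * ∫ u, g u|}) atTop (𝓝 0) := by
  obtain ⟨hc, -, -, M, -, hM⟩ := exists_fX_bound D hReg
  have ht := D.tendsto_integral_lawX_comp_div hc hReg.bandwidth_pos hReg.bandwidth_zero hg hk hsupp
  have hb : Tendsto (fun n : ℕ => ENNReal.ofReal (2 * k ^ 2 * M * (4 / η ^ 2) / (n * h n))) atTop
      (𝓝 0) := by
    have := (tendsto_const_nhds (x := 2 * k ^ 2 * M * (4 / η ^ 2))).div_atTop hReg.effective_size
    simpa using ENNReal.tendsto_ofReal this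
  refine tendsto_of_tendsto_of_tendsto_of_le_of_le' tendsto_const_nhds hb
    (Eventually.of_forall fun _ => zero_le) ?_
  filter_upwards [hM, hReg.effective_size.eventually_gt_atTop 0,
    Metric.tendsto_nhds.1 ht (η / 2) (half_pos hη)] with n hMn hN hm
  have hbn := hReg.bandwidth_pos n
  have hcheb := D.measure_abs_kernel_sum_ge_le hg hk hsupp hbn hMn (n := n) (a := 1)
    (fun _ => by simp) (t := η / 2 * (n * h n)) (by positivity)
  refine (measure_mono fun x hx => ?_).trans (hcheb.trans (ENNReal.ofReal_le_ofReal (le_of_eq ?_)))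
  · rw [mem_ofPred_eq] at hx ⊢
    set m := ∫ y, g (y / h n) ∂D.lawX
    simp only [Pi.one_apply, one_mul, Finset.sum_const, Finset.card_univ, Fintype.card_fin,
      nsmul_eq_mul, mul_one]
    rw [Real.dist_eq] at hm
    have e : (∑ i, g (x i / h n) - n * m) = ((∑ i, g (x i / h n)) / (n * h n) - m / h n) *
        (n * h n) := by
      have : (n : ℝ) ≠ 0 := by rintro h0; rw [h0, zero_mul] at hN; exact lt_irrefl _ hN
      field_simp
    rw [e, abs_mul, abs_of_pos hN]
    refine mul_le_mul_of_nonneg_right ?_ hN.le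
    have := abs_sub_le ((∑ i, g (x i / h n)) / (n * h n)) (m / h n) (D.fX 0 * ∫ u, g u)
    linarith
  · field_simp
    ring

/-- Regular realizations have probability close to one. -/
lemma exists_goodDesign_prob (hReg : Regularity D h K) (S : ℕ) : ∃ Cw > 0, ∀ ε > 0, ∃ C > 0,
    ∀ η > 0, ∀ᶠ n in atTop, ∀ s : Fin n → Fin S,
    Measure.pi (fun _ : Fin n => D.lawX)
      {x | GoodDesign D K (h n) η (C / √(n * h n)) Cw s x}ᶜ ≤ ENNReal.ofReal ε := by
  obtain ⟨hc, hf0, -, M, hM0, hM⟩ := exists_fX_bound D hReg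
  obtain ⟨k, hk⟩ := hReg.kernel_bounded
  have hk0 : 0 ≤ k := (hReg.kernel_nonneg 0).trans (hk 0)
  refine ⟨D.fX 0 * 2 + 1, by positivity, fun ε hε => ?_⟩
  -- Number of bad events: one for the window count, eight for the moments 0 to 3 on two sides, and
  -- 2 · 3 · S for the fold moments.
  set T : ℝ := 9 + 6 * S
  have hT : 0 < T := by positivity
  have hεT : 0 < ε / T := by positivity
  -- Makes Chebyshev's bound at radius C / √(n h) equal to ε / T, whatever η is.
  refine ⟨√(2 * (k + 1) ^ 2 * M / (ε / T)), by positivity, fun η hη => ?_⟩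
  have hmeas : ∀ p m, Measurable fun u => (side p).indicator K u * u ^ m := fun p m =>
    (hReg.kernel_measurable.indicator (measurableSet_side p)).mul (by fun_prop)
  have hzero : ∀ p m, ∀ u, u ∉ Icc (-1 : ℝ) 1 → (side p).indicator K u * u ^ m = 0 := by
    intro p m u hu
    have : (side p).indicator K u = 0 := by
      rw [indicator_apply_eq_zero]; exact fun _ => hReg.kernel_zero u hu
    rw [this, zero_mul]
  have hev : ∀ {f : ℕ → ENNReal}, Tendsto f atTop (𝓝 0) →
      ∀ᶠ n in atTop, f n ≤ ENNReal.ofReal (ε / T) := fun hf =>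
    (hf.eventually (gt_mem_nhds (by simpa using hεT))).mono fun _ => le_of_lt
  have hmom : ∀ᶠ n in atTop, ∀ p : Bool, ∀ m : Fin 4, Measure.pi (fun _ : Fin n => D.lawX)
      {x | η ≤ |kMoment K (h n) (side p) 1 x m / (n * h n) - limitMoment D K p m|} ≤
        ENNReal.ofReal (ε / T) := by
    refine eventually_all.2 fun p => eventually_all.2 fun m => ?_
    refine hev ?_
    have := tendsto_measure_kernel_sum hReg (hmeas p m) (abs_indicator_mul_pow_le hReg hk p m)
      (hzero p m) hη
    simpa [kMoment, limitMoment, sideInt] using this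
  have hwin := hev (tendsto_measure_kernel_sum hReg (g := (Icc (-1 : ℝ) 1).indicator 1)
    (measurable_one.indicator measurableSet_Icc) (k := 1)
    (fun u => by
      by_cases hu : u ∈ Icc (-1 : ℝ) 1
      · rw [indicator_of_mem hu]; simp
      · rw [indicator_of_notMem hu]; simp)
    (fun u hu => indicator_of_notMem hu _) one_pos)
  filter_upwards [hM, hReg.effective_size.eventually_gt_atTop 0, hmom, hwin] with n hMn hN h1 h2 s
  have hbn := hReg.bandwidth_pos n
  have hn0 : (n : ℝ) ≠ 0 := by rintro h0; rw [h0, zero_mul] at hN; exact lt_irrefl _ hN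
  set P := Measure.pi (fun _ : Fin n => D.lawX)
  set ρ := √(2 * (k + 1) ^ 2 * M / (ε / T)) / √(n * h n) with hρ
  have hρ0 : 0 < ρ := by positivity
  have hfold : ∀ q : Bool × Fin S × Fin 3, P {x | ρ ≤ |kMoment K (h n) (side q.1)
      (foldInd s q.2.1) x q.2.2 / (n * h n) - foldShare s q.2.1 *
      (kMoment K (h n) (side q.1) 1 x q.2.2 / (n * h n))|} ≤ ENNReal.ofReal (ε / T) := by
    rintro ⟨p, l, m⟩
    simp only
    have hcard : ((Finset.univ.filter fun i => s i = l).card : ℝ) ≤ n := by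
      have := Finset.card_le_univ (Finset.univ.filter fun i => s i = l)
      rw [Fintype.card_fin] at this
      exact_mod_cast this
    have hsh0 : 0 ≤ foldShare s l := by unfold foldShare; positivity
    have hsh1 : foldShare s l ≤ 1 := by
      unfold foldShare; exact div_le_one_of_le₀ hcard (by positivity)
    -- The centred fold indicators sum to zero, so the kernel mean drops out and only the
    -- fluctuation remains.
    have hcheb := D.measure_abs_kernel_sum_ge_le (hmeas p m)
      (k := k + 1) (fun u => (abs_indicator_mul_pow_le hReg hk p m u).trans (by linarith))
      (hzero p m) hbn hMn (n := n) (a := fun i => foldInd s l i - foldShare s l)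
      (fun i => by
        rw [abs_le]; unfold foldInd
        split_ifs <;> constructor <;> linarith) (t := ρ * (n * h n)) (by positivity)
    refine (measure_mono fun x hx => ?_).trans
      (hcheb.trans (ENNReal.ofReal_le_ofReal (le_of_eq ?_)))
    · rw [mem_ofPred_eq] at hx ⊢
      have hs0 : ∑ i, (foldInd s l i - foldShare s l) = 0 := by
        simp only [Finset.sum_sub_distrib, foldInd, Finset.sum_boole, Finset.sum_const,
          Finset.card_univ, Fintype.card_fin, nsmul_eq_mul, foldShare]
        field_simp
        simp
      rw [hs0, zero_mul, sub_zero]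
      have e : ∑ i, (foldInd s l i - foldShare s l) *
          ((side p).indicator K (x i / h n) * (x i / h n) ^ (m : ℕ)) =
          (kMoment K (h n) (side p) (foldInd s l) x m / (n * h n) - foldShare s l *
            (kMoment K (h n) (side p) 1 x m / (n * h n))) * (n * h n) := by
        rw [sub_mul, mul_assoc, div_mul_cancel₀ _ hN.ne', div_mul_cancel₀ _ hN.ne', kMoment,
          kMoment, Finset.mul_sum, ← Finset.sum_sub_distrib]
        refine Finset.sum_congr rfl fun i _ => ?_
        simp; ring
      rw [e, abs_mul, abs_of_pos hN]
      exact mul_le_mul_of_nonneg_right hx hN.le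
    · rw [hρ, mul_pow, div_pow, Real.sq_sqrt (by positivity), Real.sq_sqrt hN.le]
      field_simp
  have hmom' : ∀ q : Bool × Fin 4, P {x | η ≤ |kMoment K (h n) (side q.1) 1 x q.2 / (n * h n) -
      limitMoment D K q.1 q.2|} ≤ ENNReal.ofReal (ε / T) := fun q => h1 q.1 q.2
  have hnull : P {x | NoTies x ∧ ∀ i, x i ∈ D.suppX \ {0}}ᶜ = 0 := by
    have hae : ∀ᵐ y ∂D.lawX, y ∈ D.suppX \ {0} := by
      have h1 : ∀ᵐ y ∂D.lawX, y ∈ D.suppX := Measure.support_mem_ae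
      have h2 : ∀ᵐ y ∂D.lawX, y ≠ 0 := by simp [ae_iff]
      filter_upwards [h1, h2] with y hy hy' using ⟨hy, by simpa using hy'⟩
    have : ∀ᵐ x ∂P, NoTies x ∧ ∀ i, x i ∈ D.suppX \ {0} :=
      (ae_noTies n).and (ae_all_iff.2 fun i =>
        (measurePreserving_eval (fun _ : Fin n => D.lawX) i).quasiMeasurePreserving.ae hae)
    exact this
  have hsub : {x | GoodDesign D K (h n) η ρ (D.fX 0 * 2 + 1) s x}ᶜ ⊆
      {x | NoTies x ∧ ∀ i, x i ∈ D.suppX \ {0}}ᶜ ∪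
      ({x | 1 ≤ |(∑ i, (Icc (-1 : ℝ) 1).indicator 1 (x i / h n)) / (n * h n) -
        D.fX 0 * ∫ u, (Icc (-1 : ℝ) 1).indicator 1 u|} ∪
      ((⋃ q : Bool × Fin 4, {x | η ≤ |kMoment K (h n) (side q.1) 1 x q.2 / (n * h n) -
        limitMoment D K q.1 q.2|}) ∪
      ⋃ q : Bool × Fin S × Fin 3, {x | ρ ≤ |kMoment K (h n) (side q.1)
      (foldInd s q.2.1) x q.2.2 / (n * h n) - foldShare s q.2.1 *
      (kMoment K (h n) (side q.1) 1 x q.2.2 / (n * h n))|})) := by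
    intro x hx
    by_contra hcon
    simp only [mem_union, mem_compl_iff, mem_ofPred_eq, mem_iUnion, not_or, not_not, not_exists,
      not_le] at hcon
    obtain ⟨⟨c1, c2⟩, c3, c4, c5⟩ := hcon
    refine hx ⟨c2, c1, ?_, fun p m => c4 (p, m), fun p l m hm => (c5 (p, l, ⟨m, hm⟩)).le⟩
    have e1 : ∫ u, (Icc (-1 : ℝ) 1).indicator (1 : ℝ → ℝ) u = 2 := by
      rw [integral_indicator_one measurableSet_Icc]; norm_num [Measure.real, Real.volume_Icc]
    have e2 : ∑ i, (Icc (-1 : ℝ) 1).indicator (1 : ℝ → ℝ) (x i / h n) =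
        ((Finset.univ.filter fun i => |x i| ≤ h n).card : ℝ) := by
      rw [← Finset.sum_boole]
      refine Finset.sum_congr rfl fun i _ => ?_
      have : x i / h n ∈ Icc (-1 : ℝ) 1 ↔ |x i| ≤ h n := by
        rw [mem_Icc, ← abs_le, abs_div, abs_of_pos hbn, div_le_one hbn]
      simp only [indicator, this, Pi.one_apply]
    rw [e1, e2] at c3
    rw [← div_le_iff₀ hN]
    linarith [(abs_lt.1 c3).2]
  refine (measure_mono hsub).trans ((measure_union_le _ _).trans ?_)
  rw [hnull, zero_add]
  refine (measure_union_le _ _).trans ((add_le_add h2 ((measure_union_le _ _).trans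
    (add_le_add (measure_iUnion_le _) (measure_iUnion_le _)))).trans ?_)
  rw [tsum_fintype, tsum_fintype]
  refine (add_le_add le_rfl (add_le_add (Finset.sum_le_sum fun q _ => hmom' q)
    (Finset.sum_le_sum fun q _ => hfold q))).trans (le_of_eq ?_)
  simp only [Finset.sum_const, Finset.card_univ, Fintype.card_prod, Fintype.card_bool,
    Fintype.card_fin, nsmul_eq_mul]
  rw [← ENNReal.ofReal_natCast, ← ENNReal.ofReal_natCast, ← ENNReal.ofReal_mul (by positivity),
    ← ENNReal.ofReal_mul (by positivity), ← ENNReal.ofReal_add (by positivity) (by positivity),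
    ← ENNReal.ofReal_add (by positivity) (by positivity)]
  congr 1
  push_cast
  simp only [T]
  field_simp
  ring

end GoodDesignProb

/-! ### One-sided Taylor expansions -/

/-- The hypothesis makes `φ` Cauchy along 0⁺; letting `y` tend to zero in it gives the rate. -/
lemma exists_right_limit {φ : ℝ → ℝ} {δ M : ℝ} {k : ℕ} (hδ : 0 < δ) (hM : 0 ≤ M)
    (h : ∀ x y, 0 < y → y ≤ x → x ≤ δ → |φ x - φ y| ≤ M * x ^ k * (x - y)) :
    ∃ a, Tendsto φ (𝓝[>] 0) (𝓝 a) ∧ ∀ x ∈ Ioc 0 δ, |φ x - a| ≤ M * x ^ (k + 1) := by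
  have hC : Cauchy (map φ (𝓝[>] (0 : ℝ))) := by
    rw [Metric.cauchy_iff]
    refine ⟨inferInstance, fun ε hε => ?_⟩
    set c := min δ (ε / (M * δ ^ k + 1))
    have hc : 0 < c := lt_min hδ (by positivity)
    refine ⟨φ '' Ioo 0 c, image_mem_map (Ioo_mem_nhdsGT hc), ?_⟩
    have key : ∀ x y, y ∈ Ioo 0 c → x ∈ Ioo 0 c → y ≤ x → dist (φ x) (φ y) < ε := by
      intro x y hy hx hyx
      rw [Real.dist_eq]
      have hxδ : x ≤ δ := hx.2.le.trans (min_le_left _ _)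
      have hxk : x ^ k ≤ δ ^ k := pow_le_pow_left₀ hx.1.le hxδ k
      calc _ ≤ M * x ^ k * (x - y) := h x y hy.1 hyx hxδ
        _ ≤ (M * δ ^ k + 1) * x := by
            have := hx.1
            have := hy.1
            have e1 : M * x ^ k ≤ M * δ ^ k + 1 := by
              have := mul_le_mul_of_nonneg_left hxk hM; linarith
            exact mul_le_mul e1 (by linarith) (by linarith) (by positivity)
        _ < (M * δ ^ k + 1) * (ε / (M * δ ^ k + 1)) := by
            refine mul_lt_mul_of_pos_left (hx.2.trans_le (min_le_right _ _)) (by positivity)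
        _ = ε := by field_simp
    rintro _ ⟨x, hx, rfl⟩ _ ⟨y, hy, rfl⟩
    rcases le_total y x with hyx | hyx
    · exact key x y hy hx hyx
    · rw [dist_comm]; exact key y x hx hy hyx
  obtain ⟨a, ha⟩ := cauchy_map_iff_exists_tendsto.1 hC
  refine ⟨a, ha, fun x hx => ?_⟩
  have h1 : Tendsto (fun y => |φ x - φ y|) (𝓝[>] 0) (𝓝 |φ x - a|) := (ha.const_sub _).abs
  have h2 : Tendsto (fun y => M * x ^ k * (x - y)) (𝓝[>] 0) (𝓝 (M * x ^ k * (x - 0))) :=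
    ((tendsto_const_nhds.sub tendsto_id).const_mul _).mono_left nhdsWithin_le_nhds
  have h3 := le_of_tendsto_of_tendsto h1 h2 (by
    filter_upwards [Ioo_mem_nhdsGT hx.1] with y hy using h x y hy.1 hy.2.le hx.2)
  rw [sub_zero, mul_assoc, ← pow_succ] at h3
  exact h3

lemma exists_right_limit_of_deriv {φ φ' : ℝ → ℝ} {δ M : ℝ} {k : ℕ} (hδ : 0 < δ) (hM : 0 ≤ M)
    (hd : ∀ x ∈ Ioc 0 δ, HasDerivAt φ (φ' x) x) (hb : ∀ x ∈ Ioc 0 δ, |φ' x| ≤ M * x ^ k) :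
    ∃ a, Tendsto φ (𝓝[>] 0) (𝓝 a) ∧ ∀ x ∈ Ioc 0 δ, |φ x - a| ≤ M * x ^ (k + 1) := by
  refine exists_right_limit hδ hM fun x y hy hyx hx => ?_
  have h := (convex_Icc y x).norm_image_sub_le_of_norm_hasDerivWithin_le (f := φ) (f' := φ')
    (C := M * x ^ k) (fun t ht => (hd t ⟨hy.trans_le ht.1, ht.2.trans hx⟩).hasDerivWithinAt)
    (fun t ht => by
      refine (hb t ⟨hy.trans_le ht.1, ht.2.trans hx⟩).trans ?_
      have := pow_le_pow_left₀ (hy.le.trans ht.1) ht.2 k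
      exact mul_le_mul_of_nonneg_left this hM) (left_mem_Icc.2 hyx) (right_mem_Icc.2 hyx)
  rwa [Real.norm_eq_abs, Real.norm_eq_abs, abs_of_nonneg (sub_nonneg.2 hyx)] at h

/-- Second order expansion at the right of zero of a function with Lipschitz second derivative. -/
lemma exists_right_quadratic {f : ℝ → ℝ} {δ L : ℝ} (hδ : 0 < δ) (hL : 0 ≤ L)
    (hf : ∀ x ∈ Ioc 0 δ, ContDiffAt ℝ 2 f x)
    (hlip : ∀ x ∈ Ioc 0 δ, ∀ y ∈ Ioc 0 δ,
      |iteratedDeriv 2 f x - iteratedDeriv 2 f y| ≤ L * |x - y|) :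
    ∃ a b c, Tendsto f (𝓝[>] 0) (𝓝 a) ∧ Tendsto (iteratedDeriv 2 f) (𝓝[>] 0) (𝓝 c) ∧
      ∀ x ∈ Ioc 0 δ, |f x - (a + b * x + c / 2 * x ^ 2)| ≤ L * x ^ 3 := by
  have h2 : iteratedDeriv 2 f = deriv (deriv f) := by
    rw [iteratedDeriv_succ, iteratedDeriv_one]
  -- Three limits at 0⁺: `c` of f'', then `b` of f' - c x, then `a` of f - b x - c x² / 2, with
  -- errors L x, L x² and L x³.
  obtain ⟨c, hc, hc'⟩ := exists_right_limit (φ := iteratedDeriv 2 f) (k := 0) hδ hL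
    fun x y hy hyx hx => by
      have := hlip x ⟨hy.trans_le hyx, hx⟩ y ⟨hy, hyx.trans hx⟩
      rwa [abs_of_nonneg (sub_nonneg.2 hyx), ← mul_one L, ← pow_zero x] at this
  rw [h2] at hc'
  have d1 : ∀ x ∈ Ioc 0 δ, HasDerivAt f (deriv f x) x := fun x hx =>
    ((hf x hx).differentiableAt (by norm_num)).hasDerivAt
  have d2 : ∀ x ∈ Ioc 0 δ, HasDerivAt (deriv f) (deriv (deriv f) x) x := fun x hx => by
    have : ContDiffAt ℝ 1 (deriv f) x := (hf x hx).derivWithin (m := 1) (by norm_num)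
    exact (this.differentiableAt (by norm_num)).hasDerivAt
  obtain ⟨b, -, hb⟩ := exists_right_limit_of_deriv (φ := fun x => deriv f x - c * x)
    (φ' := fun x => deriv (deriv f) x - c) (k := 1) hδ hL
    (fun x hx => by
      have := (d2 x hx).fun_sub ((hasDerivAt_id' x).const_mul c)
      rwa [mul_one] at this) hc'
  obtain ⟨a, ha, ha'⟩ := exists_right_limit_of_deriv (φ := fun x => f x - (b * x + c / 2 * x ^ 2))
    (φ' := fun x => deriv f x - c * x - b) (k := 2) hδ hL
    (fun x hx => by
      have := (d1 x hx).fun_sub (((hasDerivAt_id' x).const_mul b).fun_add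
        (((hasDerivAt_id' x).fun_pow 2).const_mul (c / 2)))
      refine this.congr_deriv ?_
      simp only [mul_one, Nat.cast_ofNat, Nat.add_one_sub_one, pow_one]
      ring) hb
  refine ⟨a, b, c, ?_, hc, fun x hx => ?_⟩
  · have : Tendsto (fun x : ℝ => b * x + c / 2 * x ^ 2) (𝓝[>] 0) (𝓝 0) := by
      have : Continuous fun x : ℝ => b * x + c / 2 * x ^ 2 := by fun_prop
      simpa using (this.tendsto 0).mono_left nhdsWithin_le_nhds
    simpa using ha.add this
  · convert ha' x hx using 2
    ring

lemma tendsto_comp_neg_nhdsLT {f : ℝ → ℝ} {a : ℝ}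
    (h : Tendsto (fun x => f (-x)) (𝓝[>] 0) (𝓝 a)) : Tendsto f (𝓝[<] 0) (𝓝 a) := by
  have h1 : Tendsto (fun x : ℝ => -x) (𝓝[<] 0) (𝓝[>] 0) := by
    have := tendsto_neg_nhdsLT (a := (0 : ℝ)); rwa [neg_zero] at this
  simpa [Function.comp_def] using h.comp h1

/-- Expansions on both sides of zero. -/
lemma exists_two_sided_quadratic {f : ℝ → ℝ} {δ L : ℝ} (hδ : 0 < δ) (hL : 0 ≤ L)
    (hf : ∀ x, x ≠ 0 → |x| ≤ δ → ContDiffAt ℝ 2 f x)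
    (hlip : ∀ x y, 0 < x * y → |x| ≤ δ → |y| ≤ δ →
      |iteratedDeriv 2 f x - iteratedDeriv 2 f y| ≤ L * |x - y|) :
    ∃ a b c a' b' c', Tendsto f (𝓝[>] 0) (𝓝 a) ∧ Tendsto f (𝓝[<] 0) (𝓝 a') ∧
      Tendsto (iteratedDeriv 2 f) (𝓝[>] 0) (𝓝 c) ∧ Tendsto (iteratedDeriv 2 f) (𝓝[<] 0) (𝓝 c') ∧
      (∀ x, 0 < x → x ≤ δ → |f x - (a + b * x + c / 2 * x ^ 2)| ≤ L * |x| ^ 3) ∧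
      (∀ x, x < 0 → -δ ≤ x → |f x - (a' + b' * x + c' / 2 * x ^ 2)| ≤ L * |x| ^ 3) := by
  obtain ⟨a, b, c, ha, hc, h⟩ := exists_right_quadratic (f := f) hδ hL
    (fun x hx => hf x hx.1.ne' (by rw [abs_of_pos hx.1]; exact hx.2))
    (fun x hx y hy => hlip x y (mul_pos hx.1 hy.1) (by rw [abs_of_pos hx.1]; exact hx.2)
      (by rw [abs_of_pos hy.1]; exact hy.2))
  have hneg : ∀ x, iteratedDeriv 2 (fun x => f (-x)) x = iteratedDeriv 2 f (-x) := fun x => by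
    rw [iteratedDeriv_comp_neg]; simp
  obtain ⟨a', b', c', ha', hc', h'⟩ := exists_right_quadratic (f := fun x => f (-x)) hδ hL
    (fun x hx => ContDiffAt.comp x (hf (-x) (by simpa using hx.1.ne')
      (by rw [abs_neg, abs_of_pos hx.1]; exact hx.2)) contDiff_neg.contDiffAt)
    (fun x hx y hy => by
      rw [hneg, hneg]
      refine (hlip (-x) (-y) (by rw [neg_mul_neg]; exact mul_pos hx.1 hy.1)
        (by rw [abs_neg, abs_of_pos hx.1]; exact hx.2)
        (by rw [abs_neg, abs_of_pos hy.1]; exact hy.2)).trans_eq ?_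
      rw [neg_sub_neg, abs_sub_comm])
  -- Reflection flips only the first order coefficient.
  refine ⟨a, b, c, a', -b', c', ha, tendsto_comp_neg_nhdsLT ha', hc, tendsto_comp_neg_nhdsLT ?_,
    fun x h0 hx => ?_, fun x h0 hx => ?_⟩
  · exact hc'.congr hneg
  · rw [abs_of_pos h0]; exact h x ⟨h0, hx⟩
  · have := h' (-x) ⟨by linarith, by linarith⟩
    rw [neg_neg] at this
    rw [abs_of_neg h0]
    convert this using 2
    ring

/-- Linear expansion at the right of zero of a function that is smooth at zero. -/
lemma abs_sub_linear_le_right {f : ℝ → ℝ} {δ V : ℝ} (hδ : 0 < δ) (hV : 0 ≤ V)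
    (h0 : ContDiffAt ℝ 1 f 0) (h1 : ∀ x ∈ Ioc 0 δ, DifferentiableAt ℝ f x)
    (h2 : ∀ x ∈ Ioc 0 δ, DifferentiableAt ℝ (deriv f) x)
    (hb : ∀ x ∈ Ioc 0 δ, |deriv (deriv f) x| ≤ V) :
    ∀ x ∈ Ioc 0 δ, |f x - (f 0 + deriv f 0 * x)| ≤ V * x ^ 2 := by
  have hcd : ContinuousAt (deriv f) 0 :=
    (h0.derivWithin (m := 0) (by norm_num) : ContDiffAt ℝ 0 (deriv f) 0).continuousAt
  obtain ⟨b, hbt, hb'⟩ := exists_right_limit_of_deriv (φ := deriv f) (k := 0) hδ hV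
    (fun x hx => (h2 x hx).hasDerivAt) (by simpa using hb)
  have eb : b = deriv f 0 := tendsto_nhds_unique hbt (hcd.tendsto.mono_left nhdsWithin_le_nhds)
  subst eb
  obtain ⟨a, ha, ha'⟩ := exists_right_limit_of_deriv (φ := fun x => f x - deriv f 0 * x)
    (φ' := fun x => deriv f x - deriv f 0) (k := 1) hδ hV
    (fun x hx => by
      have := (h1 x hx).hasDerivAt.fun_sub ((hasDerivAt_id' x).const_mul (deriv f 0))
      rwa [mul_one] at this) hb'
  have hct : ContinuousAt (fun x => f x - deriv f 0 * x) 0 :=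
    h0.continuousAt.sub (by fun_prop)
  have ea := tendsto_nhds_unique ha (hct.tendsto.mono_left nhdsWithin_le_nhds)
  rw [mul_zero, sub_zero] at ea
  subst ea
  intro x hx
  convert ha' x hx using 2
  ring

/-- Continuous differentiability at zero makes the one-sided intercepts and slopes agree, so one
linear function serves both sides; second derivatives are needed only away from zero. -/
lemma abs_sub_linear_le {f : ℝ → ℝ} {δ V : ℝ} (hδ : 0 < δ) (hV : 0 ≤ V)
    (h0 : ContDiffAt ℝ 1 f 0) (h1 : ∀ x, x ≠ 0 → |x| ≤ δ → DifferentiableAt ℝ f x)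
    (h2 : ∀ x, x ≠ 0 → |x| ≤ δ → DifferentiableAt ℝ (deriv f) x)
    (hb : ∀ x, x ≠ 0 → |x| ≤ δ → |deriv (deriv f) x| ≤ V) (x : ℝ) (hx0 : x ≠ 0) (hx : |x| ≤ δ) :
    |f x - (f 0 + deriv f 0 * x)| ≤ V * x ^ 2 := by
  have hd : deriv (fun x => f (-x)) = fun x => -deriv f (-x) := funext fun y => deriv_comp_neg f y
  have hdd : ∀ y, deriv (deriv fun x => f (-x)) y = deriv (deriv f) (-y) := fun y => by
    rw [hd, deriv.fun_neg, deriv_comp_neg (deriv f) y, neg_neg]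
  rcases lt_or_gt_of_ne hx0 with hneg | hpos
  · have := abs_sub_linear_le_right (f := fun x => f (-x)) hδ hV
      (ContDiffAt.comp 0 (by simpa using h0) contDiff_neg.contDiffAt)
      (fun y hy => (h1 (-y) (by simpa using hy.1.ne')
        (by rw [abs_neg, abs_of_pos hy.1]; exact hy.2)).comp y differentiableAt_id.neg)
      (fun y hy => by
        rw [hd]
        exact ((h2 (-y) (by simpa using hy.1.ne')
          (by rw [abs_neg, abs_of_pos hy.1]; exact hy.2)).comp y differentiableAt_id.neg).neg)
      (fun y hy => by
        rw [hdd]; exact hb (-y) (by simpa using hy.1.ne')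
          (by rw [abs_neg, abs_of_pos hy.1]; exact hy.2)) (-x)
      ⟨by linarith, by rwa [abs_of_neg hneg] at hx⟩
    rw [hd] at this
    simpa using this
  · exact abs_sub_linear_le_right hδ hV h0
      (fun y hy => h1 y hy.1.ne' (by rw [abs_of_pos hy.1]; exact hy.2))
      (fun y hy => h2 y hy.1.ne' (by rw [abs_of_pos hy.1]; exact hy.2))
      (fun y hy => hb y hy.1.ne' (by rw [abs_of_pos hy.1]; exact hy.2)) x
      ⟨hpos, by rwa [abs_of_pos hpos] at hx⟩

/-! ### Expansions of the conditional means -/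

lemma iteratedDerivWithin_eq_iteratedDeriv_of_mem_nhds {s : Set ℝ} {x : ℝ} (hs : s ∈ 𝓝 x) (k : ℕ)
    (f : ℝ → ℝ) : iteratedDerivWithin k f s x = iteratedDeriv k f x := by
  rw [← iteratedDerivWithin_univ]
  unfold iteratedDerivWithin
  rw [iteratedFDerivWithin_congr_set (t := univ)]
  exact eventuallyEq_univ.2 hs

namespace RDDesign

variable (D : RDDesign)

lemma suppX_diff_zero_mem_nhds {δ : ℝ} (hδ : Ioo (-δ) δ ⊆ D.suppX) {x : ℝ} (h0 : x ≠ 0)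
    (hx : |x| < δ) : D.suppX \ {0} ∈ 𝓝 x := by
  rw [abs_lt] at hx
  have : Ioo (-δ) δ ∩ {0}ᶜ ∈ 𝓝 x :=
    inter_mem (Ioo_mem_nhds hx.1 hx.2) (isOpen_compl_singleton.mem_nhds h0)
  exact mem_of_superset this fun y hy => ⟨hδ hy.1, hy.2⟩

/-- Second order expansions of `E[M(η̄) | X = x]` on both sides of the cutoff, uniformly in `n`. -/
lemma exists_adjMean_expansion {K : ℝ → ℝ} {h : ℕ → ℝ} (hReg : Regularity D h K)
    {ηbar : (n : ℕ) → D.Cov n → ℝ} (hadm : ∀ n, D.Admissible (ηbar n))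
    (hMom : MomentRegularity D ηbar) {BY : ℝ} (hBY : OutcomeCurvatureBound D BY) :
    ∃ δ > 0, ∃ L : ℝ, 0 ≤ L ∧ ∃ Cm : ℝ, ∀ n, ∃ a b c a' b' c' m,
      D.tau n = a - a' ∧ |c + m| ≤ BY ∧ |c' + m| ≤ BY ∧ |m| ≤ Cm ∧
      (∀ x, 0 < x → x ≤ δ → |D.adjMean (ηbar n) x - (a + b * x + c / 2 * x ^ 2)| ≤ L * |x| ^ 3) ∧
      (∀ x, x < 0 → -δ ≤ x →
        |D.adjMean (ηbar n) x - (a' + b' * x + c' / 2 * x ^ 2)| ≤ L * |x| ^ 3) := by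
  obtain ⟨-, -, ⟨ε, hε, hεs⟩, -⟩ := exists_fX_bound D hReg
  obtain ⟨C, hC, L, q, hq, hM⟩ := hMom
  refine ⟨ε / 2, by positivity, max L 0, le_max_right _ _, C + BY, fun n => ?_⟩
  obtain ⟨hint, hcd, hlip, hbd, -⟩ := hM n
  set f := D.adjMean (ηbar n) with hf
  have hnh : ∀ x, x ≠ 0 → |x| ≤ ε / 2 → D.suppX \ {0} ∈ 𝓝 x := fun x h0 hx =>
    D.suppX_diff_zero_mem_nhds hεs h0 (by linarith)
  have hfc : ∀ x, x ≠ 0 → |x| ≤ ε / 2 → ContDiffAt ℝ 2 f x := fun x h0 hx =>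
    hcd.contDiffAt (hnh x h0 hx)
  have hne : ∀ x y : ℝ, 0 < x * y → x ≠ 0 ∧ y ≠ 0 := fun x y hxy =>
    ⟨by rintro rfl; simp at hxy, by rintro rfl; simp at hxy⟩
  obtain ⟨a, b, c, a', b', c', ha, ha', hc, hc', he, he'⟩ :=
    exists_two_sided_quadratic (f := f) (δ := ε / 2) (L := max L 0) (by positivity)
      (le_max_right _ _) hfc (fun x y hxy hx hy => by
        obtain ⟨h0x, h0y⟩ := hne x y hxy
        rw [← iteratedDerivWithin_eq_iteratedDeriv_of_mem_nhds (hnh x h0x hx),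
          ← iteratedDerivWithin_eq_iteratedDeriv_of_mem_nhds (hnh y h0y hy)]
        refine (hlip x (mem_of_mem_nhds (hnh x h0x hx)) y (mem_of_mem_nhds (hnh y h0y hy))
          hxy).trans ?_
        exact mul_le_mul_of_nonneg_right (le_max_left _ _) (abs_nonneg _))
  obtain ⟨hmeas, ε', hε', hη, hηc⟩ := hadm n
  set g := D.covMean (ηbar n) with hg
  set y := D.condMean n (D.outcome n) with hy
  obtain ⟨ε₂, hε₂, hb2⟩ := hBY n
  -- Near the cutoff E[Y | X] = E[M(η̄) | X] + E[η̄(Z) | X] with a last term smooth across it, so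
  -- both conditional means have the same jump τ.
  have hdec : ∀ x ∈ Ioo (-ε) ε ∩ Ioo (-ε') ε', y x = f x + g x := by
    intro x hx
    have h1 := hint x (hεs hx.1)
    have h2 := hη x hx.2
    rw [hf, hg, hy]
    unfold adjMean covMean condMean at *
    rw [← integral_add h1 h2]
    refine integral_congr_ae (ae_of_all _ fun p => ?_)
    simp [outcome, adj]
  have hopen : IsOpen (Ioo (-ε) ε ∩ Ioo (-ε') ε') := isOpen_Ioo.inter isOpen_Ioo
  have h0mem : (0 : ℝ) ∈ Ioo (-ε) ε ∩ Ioo (-ε') ε' := by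
    constructor <;> constructor <;> linarith
  have hev0 : ∀ᶠ x in 𝓝 (0 : ℝ), x ∈ Ioo (-ε) ε ∩ Ioo (-ε') ε' := hopen.mem_nhds h0mem
  have hgc : ContDiffAt ℝ 2 g 0 := hηc.contDiffAt (Ioo_mem_nhds (by linarith) hε')
  have hg2 : ContinuousAt (iteratedDeriv 2 g) 0 := by
    have h1 := hgc.derivWithin (m := 1) (by norm_num)
    have h2 := ContDiffAt.derivWithin (m := 0) h1 (by norm_num)
    have e : iteratedDeriv 2 g = deriv (deriv g) := by rw [iteratedDeriv_succ, iteratedDeriv_one]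
    rw [e]
    exact ContDiffAt.continuousAt (n := 0) h2
  have hlim : ∀ (l : Filter ℝ) (a : ℝ), l ≤ 𝓝 0 → Tendsto f l (𝓝 a) → Tendsto y l (𝓝 (a + g 0)) :=
    fun l a hl h => (h.add (hgc.continuousAt.tendsto.mono_left hl)).congr' (by
      filter_upwards [hl hev0] with x hx using (hdec x hx).symm)
  -- The curvature bound for E[Y | X] holds on a neighbourhood depending on `n`, so only its limit
  -- at zero is used: it bounds c + m, with m the second derivative of E[η̄(Z) | X] at zero. The
  -- bound for |c| then bounds |m| uniformly in `n`.
  have hlim2 : ∀ (l : Filter ℝ) (c : ℝ), l.NeBot → l ≤ 𝓝[≠] 0 → Tendsto (iteratedDeriv 2 f) l (𝓝 c) →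
      |c + iteratedDeriv 2 g 0| ≤ BY ∧ |c| ≤ C := by
    intro l c _ hl h
    have hl0 : l ≤ 𝓝 0 := hl.trans nhdsWithin_le_nhds
    have hlne : ∀ᶠ x in l, x ≠ 0 := hl self_mem_nhdsWithin
    have hball : ∀ ρ : ℝ, 0 < ρ → ∀ᶠ x in l, |x| < ρ := fun ρ hρ => by
      refine hl0 ?_
      filter_upwards [Ioo_mem_nhds (neg_lt_zero.2 hρ) hρ] with x hx using abs_lt.2 hx
    constructor
    · refine le_of_tendsto (h.add (hg2.tendsto.mono_left hl0)).abs ?_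
      filter_upwards [hlne, hball (ε / 2) (by positivity), hball ε' hε', hball ε₂ hε₂] with x h0 h1 h2 h3
      have hx : x ∈ Ioo (-ε) ε ∩ Ioo (-ε') ε' := ⟨abs_lt.1 (by linarith), abs_lt.1 h2⟩
      have := hb2 x (abs_pos.2 h0) h3
      have e : y =ᶠ[𝓝 x] fun t => f t + g t := by
        filter_upwards [hopen.mem_nhds hx] with t ht using hdec t ht
      rw [← hy, e.iteratedDeriv_eq 2, iteratedDeriv_fun_add (hfc x h0 h1.le)
        (hηc.contDiffAt (isOpen_Ioo.mem_nhds hx.2))] at this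
      exact this
    · refine le_of_tendsto h.abs ?_
      filter_upwards [hlne, hball (ε / 2) (by positivity)] with x h0 h1
      rw [← iteratedDerivWithin_eq_iteratedDeriv_of_mem_nhds (hnh x h0 h1.le)]
      exact hbd x (mem_of_mem_nhds (hnh x h0 h1.le))
  have hgt := hlim2 (𝓝[>] 0) c inferInstance (nhdsWithin_mono _ fun x hx => ne_of_gt hx) hc
  have hlt := hlim2 (𝓝[<] 0) c' inferInstance (nhdsWithin_mono _ fun x hx => ne_of_lt hx) hc'
  refine ⟨a, b, c, a', b', c', iteratedDeriv 2 g 0, ?_, hgt.1, hlt.1, ?_, he, he'⟩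
  · unfold tau
    rw [(hlim _ a nhdsWithin_le_nhds ha).limUnder_eq, (hlim _ a' nhdsWithin_le_nhds ha').limUnder_eq]
    ring
  · have := abs_sub (c + iteratedDeriv 2 g 0) c
    rw [add_sub_cancel_left] at this
    linarith [hgt.1, hgt.2]

/-- Linear expansions of `E[η(Z) - η̄(Z) | X = x]` at the cutoff, uniformly over the realization
sets. -/
lemma exists_covMean_expansion {S : ℕ} {F : CrossFit D S} {K : ℝ → ℝ} {h : ℕ → ℝ}
    (hReg : Regularity D h K) {T : (n : ℕ) → Set (D.Cov n → ℝ)} {ηbar : (n : ℕ) → D.Cov n → ℝ}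
    (hFirst : FirstStage D F T ηbar (fun n => D.suppXh (h n)))
    (hDeriv : Derivatives D T ηbar h 2) :
    ∃ v : ℕ → ℝ, (∀ n, 0 ≤ v n) ∧ Tendsto v atTop (𝓝 0) ∧ ∀ᶠ n in atTop, ∀ η ∈ T n, ∃ a b,
      |a| ≤ v n ∧ |b| ≤ v n ∧ ∀ t, t ≠ 0 → |t| ≤ h n →
        |D.covMean (fun z => η z - ηbar n z) t - (a + b * t)| ≤ v n * t ^ 2 := by
  obtain ⟨-, -, ⟨ε, hε, hεs⟩, -⟩ := exists_fX_bound D hReg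
  obtain ⟨r, hr, cr, hrate⟩ := hFirst.rate
  obtain ⟨v1, hv1, c1, h1⟩ := hDeriv 0 (by norm_num)
  obtain ⟨v2, hv2, c2, h2⟩ := hDeriv 1 (by norm_num)
  -- The three rates control intercept, slope and curvature; their sum serves for all three.
  refine ⟨fun n => √|cr| * |r n| + |c1| * |v1 n| + |c2| * |v2 n|, fun n => by positivity, ?_, ?_⟩
  · have := ((hr.abs.const_mul (√|cr|)).add (hv1.abs.const_mul |c1|)).add (hv2.abs.const_mul |c2|)
    simpa using this
  have hsm : ∀ᶠ n in atTop, h n < ε := hReg.bandwidth_zero.eventually_lt_const hε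
  filter_upwards [hrate, h1, h2, hsm] with n hrate h1 h2 hsm η hη
  have hpos := hReg.bandwidth_pos n
  set f := D.covMean (fun z => η z - ηbar n z) with hf
  obtain ⟨hme, ε₁, hε₁, hi₁, hc₁⟩ := hFirst.admissible n η hη
  obtain ⟨hmb, ε₂, hε₂, hi₂, hc₂⟩ := hFirst.admissible n _ (hFirst.bar_mem n)
  have hfc : ContDiffAt ℝ 2 f 0 := by
    have e : f =ᶠ[𝓝 0] fun t => D.covMean η t - D.covMean (ηbar n) t := by
      filter_upwards [Ioo_mem_nhds (neg_lt_zero.2 hε₁) hε₁, Ioo_mem_nhds (neg_lt_zero.2 hε₂) hε₂]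
        with t ht₁ ht₂
      exact integral_sub (hi₁ t ht₁) (hi₂ t ht₂)
    refine ContDiffAt.congr_of_eventuallyEq ?_ e
    exact (hc₁.contDiffAt (Ioo_mem_nhds (neg_lt_zero.2 hε₁) hε₁)).sub
      (hc₂.contDiffAt (Ioo_mem_nhds (neg_lt_zero.2 hε₂) hε₂))
  have hsupp : ∀ x, |x| ≤ h n → x ∈ D.suppXh (h n) := fun x hx =>
    ⟨hεs (abs_lt.1 (hx.trans_lt hsm)), abs_le.1 hx⟩
  have hnh : ∀ x, x ≠ 0 → |x| ≤ h n → D.suppX \ {0} ∈ 𝓝 x := fun x h0 hx =>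
    D.suppX_diff_zero_mem_nhds hεs h0 (hx.trans_lt hsm)
  have hDW : ∀ k x, x ≠ 0 → |x| ≤ h n →
      iteratedDerivWithin k f (D.suppX \ {0}) =ᶠ[𝓝 x] iteratedDeriv k f := fun k x h0 hx => by
    filter_upwards [eventually_mem_nhds_iff.2 (hnh x h0 hx)] with y hy
    exact iteratedDerivWithin_eq_iteratedDeriv_of_mem_nhds hy k f
  have hdiff : ∀ k x, x ≠ 0 → |x| ≤ h n → DifferentiableWithinAt ℝ
      (iteratedDerivWithin k f (D.suppX \ {0})) (D.suppX \ {0}) x →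
      DifferentiableAt ℝ (iteratedDeriv k f) x := fun k x h0 hx hd =>
    ((hd.differentiableAt (hnh x h0 hx)).congr_of_eventuallyEq (hDW k x h0 hx).symm)
  have e2 : iteratedDeriv 2 f = deriv (deriv f) := by rw [iteratedDeriv_succ, iteratedDeriv_one]
  have d1 : ∀ x, x ≠ 0 → |x| ≤ h n → DifferentiableAt ℝ f x ∧ |deriv f x| ≤ |c1| * |v1 n| := by
    intro x h0 hx
    have := h1 η hη x ⟨hsupp x hx, h0⟩
    refine ⟨by simpa using hdiff 0 x h0 hx this.1, ?_⟩
    have h3 := this.2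
    rw [← hf, (hDW 1 x h0 hx).eq_of_nhds, iteratedDeriv_one] at h3
    exact h3.trans (mul_le_mul_of_nonneg_right (le_abs_self _) (abs_nonneg _))
  have d2 : ∀ x, x ≠ 0 → |x| ≤ h n →
      DifferentiableAt ℝ (deriv f) x ∧ |deriv (deriv f) x| ≤ |c2| * |v2 n| := by
    intro x h0 hx
    have := h2 η hη x ⟨hsupp x hx, h0⟩
    refine ⟨by simpa [iteratedDeriv_one] using hdiff 1 x h0 hx this.1, ?_⟩
    have h3 := this.2
    rw [← hf, (hDW 2 x h0 hx).eq_of_nhds, e2] at h3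
    exact h3.trans (mul_le_mul_of_nonneg_right (le_abs_self _) (abs_nonneg _))
  have hV := abs_sub_linear_le (f := f) hpos (V := |c2| * |v2 n|) (by positivity)
    (hfc.of_le (by norm_num)) (fun x h0 hx => (d1 x h0 hx).1) (fun x h0 hx => (d2 x h0 hx).1)
    (fun x h0 hx => (d2 x h0 hx).2)
  refine ⟨f 0, deriv f 0, ?_, ?_, fun t h0 ht => (hV t h0 ht).trans ?_⟩
  · have h3 := hrate η hη 0 (hsupp 0 (by simpa using hpos.le))
    have hm : Measurable fun p : ℝ × D.Cov n => η p.2 - ηbar n p.2 :=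
      (hme.comp measurable_snd).sub (hmb.comp measurable_snd)
    -- Jensen's inequality at the cutoff, which lies in the support. A negative `cr * r n ^ 2` is
    -- truncated to zero by `ENNReal.ofReal`, and then the mean vanishes.
    have h4 : (f 0) ^ 2 ≤ cr * r n ^ 2 ∨ f 0 = 0 := by
      have hL : MemLp (fun p : ℝ × D.Cov n => η p.2 - ηbar n p.2) 2 (D.condLaw n 0) := by
        rw [memLp_two_iff_integrable_sq hm.aestronglyMeasurable]
        refine ⟨(hm.pow_const 2).aestronglyMeasurable, ?_⟩
        rw [hasFiniteIntegral_iff_ofReal (ae_of_all _ fun p => sq_nonneg _)]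
        exact h3.trans_lt ENNReal.ofReal_lt_top
      have h5 : (∫ p : ℝ × D.Cov n, (η p.2 - ηbar n p.2) ∂(D.condLaw n 0)) ^ 2 ≤
          ∫ p : ℝ × D.Cov n, (η p.2 - ηbar n p.2) ^ 2 ∂(D.condLaw n 0) := by
        have := variance_nonneg (fun p : ℝ × D.Cov n => η p.2 - ηbar n p.2) (D.condLaw n 0)
        rw [variance_eq_sub hL] at this
        simpa using this
      rw [← ofReal_integral_eq_lintegral_ofReal hL.integrable_sq
        (ae_of_all _ fun p => sq_nonneg _)] at h3
      rcases le_or_gt 0 (cr * r n ^ 2) with hc | hc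
      · exact Or.inl (h5.trans ((ENNReal.ofReal_le_ofReal_iff hc).1 h3))
      · right
        rw [ENNReal.ofReal_of_nonpos hc.le, nonpos_iff_eq_zero, ENNReal.ofReal_eq_zero] at h3
        have : f 0 ^ 2 ≤ 0 := h5.trans h3
        exact pow_eq_zero_iff two_ne_zero |>.1 (le_antisymm this (sq_nonneg _))
    have h6 : |f 0| ≤ √|cr| * |r n| := by
      rcases h4 with h4 | h4
      · rw [← Real.sqrt_sq_eq_abs, ← Real.sqrt_sq_eq_abs (r n), ← Real.sqrt_mul (abs_nonneg _)]
        refine Real.sqrt_le_sqrt (h4.trans ?_)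
        exact mul_le_mul_of_nonneg_right (le_abs_self _) (sq_nonneg _)
      · rw [h4, abs_zero]; positivity
    have : 0 ≤ |c1| * |v1 n| := by positivity
    have : 0 ≤ |c2| * |v2 n| := by positivity
    linarith
  · have hcd : ContinuousAt (deriv f) 0 :=
      ContDiffAt.continuousAt (n := 0) ((hfc.of_le (by norm_num : (1 : WithTop ℕ∞) ≤ 2)).derivWithin
        (m := 0) (by norm_num))
    -- The derivative bound is given off zero and reaches zero by continuity.
    have h3 : |deriv f 0| ≤ |c1| * |v1 n| := by
      refine le_of_tendsto (hcd.tendsto.mono_left (nhdsWithin_le_nhds (s := Ioi 0))).abs ?_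
      filter_upwards [Ioo_mem_nhdsGT hpos] with x hx
      exact (d1 x hx.1.ne' (by rw [abs_of_pos hx.1]; exact hx.2.le)).2
    have : 0 ≤ √|cr| * |r n| := by positivity
    have : 0 ≤ |c2| * |v2 n| := by positivity
    linarith
  · refine mul_le_mul_of_nonneg_right ?_ (sq_nonneg _)
    have : 0 ≤ √|cr| * |r n| := by positivity
    have : 0 ≤ |c1| * |v1 n| := by positivity
    linarith

end RDDesign

/-! ### Conditional bounds under cross-fitting -/

section CrossFitting

variable {ι E : Type} [Fintype ι] [MeasurableSpace E] {ν : ι → Measure E}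
  [∀ i, IsProbabilityMeasure (ν i)]

lemma measurableSet_forall_le {ι α β : Type*} [Countable ι] [MeasurableSpace α]
    [MeasurableSpace β] [TopologicalSpace β] [PartialOrder β] [OrderClosedTopology β]
    [SecondCountableTopology β] [OpensMeasurableSpace β] (Q : Set ι) {f : ι → α → β}
    (hf : ∀ i, Measurable (f i)) (c : β) : MeasurableSet {a | ∀ i ∈ Q, f i a ≤ c} := by
  refine MeasurableSet.congr (s := ⋂ i ∈ Q, {a | f i a ≤ c}) (MeasurableSet.biInter (to_countable _)
    fun i _ => measurableSet_le (hf i) measurable_const) ?_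
  ext p; simp

/-- Fubini over `J` and its complement: conditioning on the data outside a fold, a bound valid for
every realization there is a bound for the whole. -/
lemma measure_pi_split_le (J : Finset ι)
    {B : Set (({i // i ∈ J} → E) × ({i // i ∉ J} → E))} (hB : MeasurableSet B) (ε : ENNReal)
    [Fintype {i // i ∉ J}]
    (hε : ∀ u, Measure.pi (fun i : {i // i ∉ J} => ν i) {v | (u, v) ∈ B} ≤ ε) :
    Measure.pi ν {y | ((fun i => y i : {i // i ∈ J} → E), (fun i => y i : {i // i ∉ J} → E)) ∈ B}
      ≤ ε := by
  classical
  have hmp := measurePreserving_piEquivPiSubtypeProd ν (fun i => i ∈ J)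
  have h := hmp.measure_preimage hB.nullMeasurableSet
  refine le_of_eq_of_le h ?_
  rw [Measure.prod_apply hB]
  refine (lintegral_mono (g := fun _ => ε) fun u => ?_).trans (by simp)
  refine le_of_eq_of_le ?_ (hε u)
  congr!

variable {J : Finset ι} {g : ({i // i ∈ J} → E) → E → ℝ} {w : ι → ℝ} {Q : Set ι} {c : ℝ}

/-- Chebyshev's inequality for summands estimated from an independent part of the sample. -/
lemma measure_pi_crossfit_abs_sum_ge_le (hg : Measurable fun p : ({i // i ∈ J} → E) × E => g p.1 p.2)
    (hQ : ∀ i, w i ≠ 0 → i ∈ Q) (hc : 0 ≤ c) [DecidableEq ι] {t : ℝ} (ht : 0 < t) :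
    Measure.pi ν {y | (∀ i ∈ Q, ∫⁻ z, ENNReal.ofReal (g (fun j => y j) z ^ 2) ∂(ν i) ≤
        ENNReal.ofReal c) ∧
      t ≤ |∑ i with i ∉ J, w i * (g (fun j => y j) (y i) - ∫ z, g (fun j => y j) z ∂(ν i))|} ≤
      ENNReal.ofReal ((∑ i, w i ^ 2) * c / t ^ 2) := by
  classical
  set B : Set (({i // i ∈ J} → E) × ({i // i ∉ J} → E)) :=
    {p | (∀ i ∈ Q, ∫⁻ z, ENNReal.ofReal (g p.1 z ^ 2) ∂(ν i) ≤ ENNReal.ofReal c) ∧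
      t ≤ |∑ i : {i // i ∉ J}, w i * (g p.1 (p.2 i) - ∫ z, g p.1 z ∂(ν i))|} with hBdef
  have hm1 : ∀ i, Measurable fun u : {i // i ∈ J} → E =>
      ∫⁻ z, ENNReal.ofReal (g u z ^ 2) ∂(ν i) := fun i =>
    (hg.pow_const 2).ennreal_ofReal.lintegral_prod_right'
  have hm2 : ∀ i, Measurable fun u : {i // i ∈ J} → E => ∫ z, g u z ∂(ν i) := fun i =>
    (hg.stronglyMeasurable.integral_prod_right (ν := ν i)).measurable
  have hB : MeasurableSet B := by
    rw [hBdef, ofPred_and]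
    refine MeasurableSet.inter ?_ (measurableSet_le measurable_const ?_)
    · exact measurable_fst (measurableSet_forall_le Q hm1 (ENNReal.ofReal c))
    · refine (Finset.measurable_sum _ fun i _ => Measurable.const_mul ?_ _).abs
      refine Measurable.sub ?_ ((hm2 i).comp measurable_fst)
      exact hg.comp (measurable_fst.prodMk ((measurable_pi_apply i).comp measurable_snd))
  have key := measure_pi_split_le (ν := ν) J hB (ENNReal.ofReal ((∑ i, w i ^ 2) * c / t ^ 2)) ?_
  · refine (measure_mono fun y hy => ?_).trans key
    refine ⟨hy.1, ?_⟩
    have e := Finset.sum_subtype (F := inferInstance) (Finset.univ.filter fun i => i ∉ J) (p := fun i => i ∉ J)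
      (fun i => by simp) (fun i => w i * (g (fun j => y j) (y i) - ∫ z, g (fun j => y j) z ∂(ν i)))
    have h2 := hy.2
    rw [e] at h2
    exact h2
  intro u
  -- Realizations violating the second moment bound contribute nothing, since the bound is part of
  -- the event.
  by_cases hu : ∀ i ∈ Q, ∫⁻ z, ENNReal.ofReal (g u z ^ 2) ∂(ν i) ≤ ENNReal.ofReal c
  swap
  · refine le_of_eq_of_le ?_ zero_le
    convert measure_empty (μ := Measure.pi fun i : {i // i ∉ J} => ν i)
    ext v; simp only [hBdef, mem_ofPred_eq, mem_empty_iff_false, iff_false]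
    exact fun h => hu h.1
  have hgu : Measurable (g u) := hg.comp (measurable_const.prodMk measurable_id)
  have hL : ∀ i ∈ Q, MemLp (g u) 2 (ν i) ∧ ∫ z, g u z ^ 2 ∂(ν i) ≤ c := by
    intro i hi
    have hL : MemLp (g u) 2 (ν i) := by
      rw [memLp_two_iff_integrable_sq hgu.aestronglyMeasurable]
      refine ⟨(hgu.pow_const 2).aestronglyMeasurable, ?_⟩
      rw [hasFiniteIntegral_iff_ofReal (ae_of_all _ fun p => sq_nonneg _)]
      exact (hu i hi).trans_lt ENNReal.ofReal_lt_top
    refine ⟨hL, ?_⟩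
    have := hu i hi
    rwa [← ofReal_integral_eq_lintegral_ofReal hL.integrable_sq
      (ae_of_all _ fun p => sq_nonneg _), ENNReal.ofReal_le_ofReal_iff hc] at this
  have hchb := measure_pi_abs_sum_ge_le (ν := fun i : {i // i ∉ J} => ν i)
    (e := fun i z => w i * (g u z - ∫ z, g u z ∂(ν i))) (fun i => by
      by_cases hw : w i = 0
      · simp [hw]
      · exact ((hL i (hQ i hw)).1.sub (memLp_const _)).const_mul _)
    (fun i => by
      rw [integral_const_mul]
      by_cases hw : w i = 0
      · simp [hw]
      · rw [integral_sub ((hL i (hQ i hw)).1.integrable (by norm_num)) (integrable_const _)]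
        simp) ht
  refine (measure_mono fun v hv => ?_).trans (hchb.trans (ENNReal.ofReal_le_ofReal ?_))
  · exact hv.2
  refine div_le_div_of_nonneg_right ?_ (sq_nonneg t)
  rw [Finset.sum_mul]
  have hle : ∀ i : ι, 0 ≤ w i ^ 2 * c := fun i => by positivity
  calc _ ≤ ∑ i : {i // i ∉ J}, w i ^ 2 * c := by
        refine Finset.sum_le_sum fun i _ => ?_
        by_cases hw : w i = 0
        · simp [hw]
        obtain ⟨h1, h2⟩ := hL i (hQ i hw)
        simp_rw [mul_pow]
        rw [integral_const_mul]
        refine mul_le_mul_of_nonneg_left (le_trans ?_ h2) (sq_nonneg _)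
        have := variance_eq_sub h1
        rw [variance_eq_integral h1.1.aemeasurable] at this
        rw [this]
        simp only [Pi.pow_apply]
        linarith [sq_nonneg (∫ z, g u z ∂(ν i))]
    _ ≤ ∑ i, w i ^ 2 * c := by
        rw [← Finset.sum_subtype (Finset.univ.filter fun i => i ∉ J) (p := fun i => i ∉ J)
          (fun i => by simp) (fun i => w i ^ 2 * c)]
        exact Finset.sum_le_sum_of_subset_of_nonneg (Finset.filter_subset _ _) fun i _ _ => hle i

/-- Markov's inequality for the mean square of summands estimated from an independent part of the
sample. -/
lemma measure_pi_crossfit_sum_sq_ge_le (Q : Finset ι)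
    (hg : Measurable fun p : ({i // i ∈ J} → E) × E => g p.1 p.2)
    [DecidableEq ι] {t : ℝ} (ht : 0 < t) :
    Measure.pi ν {y | (∀ i ∈ Q, ∫⁻ z, ENNReal.ofReal (g (fun j => y j) z ^ 2) ∂(ν i) ≤
        ENNReal.ofReal c) ∧
      t ≤ ∑ i ∈ Q with i ∉ J, g (fun j => y j) (y i) ^ 2} ≤
      ENNReal.ofReal (Q.card * c / t) := by
  classical
  have hm1 : ∀ i, Measurable fun u : {i // i ∈ J} → E =>
      ∫⁻ z, ENNReal.ofReal (g u z ^ 2) ∂(ν i) := fun i =>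
    (hg.pow_const 2).ennreal_ofReal.lintegral_prod_right'
  set B : Set (({i // i ∈ J} → E) × ({i // i ∉ J} → E)) :=
    {p | (∀ i ∈ Q, ∫⁻ z, ENNReal.ofReal (g p.1 z ^ 2) ∂(ν i) ≤ ENNReal.ofReal c) ∧
      t ≤ ∑ i : {i // i ∉ J}, if (i : ι) ∈ Q then g p.1 (p.2 i) ^ 2 else 0} with hBdef
  have hB : MeasurableSet B := by
    rw [hBdef, ofPred_and]
    refine MeasurableSet.inter ?_ (measurableSet_le measurable_const ?_)
    · exact measurable_fst (measurableSet_forall_le (Q : Set ι) hm1 (ENNReal.ofReal c))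
    · refine Finset.measurable_sum _ fun i _ => ?_
      by_cases hi : (i : ι) ∈ Q
      · simp only [hi, if_true]
        exact (hg.comp (measurable_fst.prodMk ((measurable_pi_apply i).comp measurable_snd))).pow_const 2
      · simp only [hi, if_false]; exact measurable_const
  have key := measure_pi_split_le (ν := ν) J hB (ENNReal.ofReal (Q.card * c / t)) ?_
  · refine (measure_mono fun y hy => ?_).trans key
    refine ⟨hy.1, ?_⟩
    have e := Finset.sum_subtype (F := inferInstance) (Finset.univ.filter fun i => i ∉ J) (p := fun i => i ∉ J)
      (fun i => by simp) (fun i => if i ∈ Q then g (fun j => y j) (y i) ^ 2 else 0)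
    have h2 := hy.2
    rw [← Finset.sum_filter, Finset.filter_filter] at e
    have e3 : Finset.filter (fun i => i ∉ J ∧ i ∈ Q) Finset.univ = Q.filter fun i => i ∉ J := by
      ext i; simp [and_comm]
    rw [e3] at e
    rw [e] at h2
    exact h2
  intro u
  by_cases hu : ∀ i ∈ Q, ∫⁻ z, ENNReal.ofReal (g u z ^ 2) ∂(ν i) ≤ ENNReal.ofReal c
  swap
  · refine le_of_eq_of_le ?_ zero_le
    convert measure_empty (μ := Measure.pi fun i : {i // i ∉ J} => ν i)
    ext v; simp only [hBdef, mem_ofPred_eq, mem_empty_iff_false, iff_false]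
    exact fun h => hu h.1
  have hgu : Measurable (g u) := hg.comp (measurable_const.prodMk measurable_id)
  set f : {i // i ∉ J} → ({i // i ∉ J} → E) → ENNReal := fun i v =>
    if (i : ι) ∈ Q then ENNReal.ofReal (g u (v i) ^ 2) else 0
  have hf : ∀ i, Measurable (f i) := fun i => by
    by_cases hi : (i : ι) ∈ Q
    · simp only [f, hi, if_true]
      exact ((hgu.comp (measurable_pi_apply i)).pow_const 2).ennreal_ofReal
    · simp only [f, hi, if_false]; exact measurable_const
  have hfi : ∀ i, ∫⁻ v, f i v ∂(Measure.pi fun i : {i // i ∉ J} => ν i) ≤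
      if (i : ι) ∈ Q then ENNReal.ofReal c else 0 := fun i => by
    by_cases hi : (i : ι) ∈ Q
    · simp only [f, hi, if_true]
      refine le_of_eq_of_le ?_ (hu i hi)
      exact (measurePreserving_eval (fun i : {i // i ∉ J} => ν i) i).lintegral_comp
        (hgu.pow_const 2).ennreal_ofReal
    · simp [f, hi]
  have hsum : ∫⁻ v, ∑ i, f i v ∂(Measure.pi fun i : {i // i ∉ J} => ν i) ≤
      ENNReal.ofReal (Q.card * c) := by
    rw [lintegral_finsetSum _ fun i _ => hf i]
    refine (Finset.sum_le_sum fun i _ => hfi i).trans ?_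
    rw [← Finset.sum_subtype (Finset.univ.filter fun i => i ∉ J) (p := fun i => i ∉ J)
      (fun i => by simp) (fun i => if i ∈ Q then ENNReal.ofReal c else 0)]
    refine (Finset.sum_le_sum_of_subset (Finset.filter_subset _ _)).trans_eq ?_
    rw [Finset.sum_ite_mem, Finset.univ_inter, Finset.sum_const, nsmul_eq_mul,
      ENNReal.ofReal_mul (by positivity), ENNReal.ofReal_natCast]
  have hmk := mul_meas_ge_le_lintegral (μ := Measure.pi fun i : {i // i ∉ J} => ν i)
    (Finset.measurable_sum Finset.univ fun i _ => hf i) (ENNReal.ofReal t)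
  rw [ENNReal.ofReal_div_of_pos ht, ENNReal.le_div_iff_mul_le (by simp [ht]) (by simp), mul_comm]
  refine le_trans ?_ (hmk.trans hsum)
  gcongr with v
  intro h2
  have h3 := h2.2
  refine (ENNReal.ofReal_le_ofReal h3).trans_eq ?_
  rw [ENNReal.ofReal_sum_of_nonneg]
  · refine Finset.sum_congr rfl fun i _ => ?_
    simp only [f]
    split_ifs <;> simp
  · intro i _; split_ifs <;> positivity

end CrossFitting

/-! ### The nearest-neighbour standard error -/

lemma sq_sum_div_card_le {ι : Type*} (s : Finset ι) (f : ι → ℝ) :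
    ((∑ j ∈ s, f j) / s.card) ^ 2 ≤ (∑ j ∈ s, f j ^ 2) / s.card := by
  rcases s.eq_empty_or_nonempty with rfl | hs
  · simp
  have h0 : (0 : ℝ) < s.card := by exact_mod_cast hs.card_pos
  rw [div_pow, div_le_div_iff₀ (by positivity) h0]
  have := sq_sum_le_card_mul_sum_sq (s := s) (f := f)
  nlinarith

section NeighborVariance

variable {ι : Type*} [Fintype ι] [DecidableEq ι] {R : ℕ} {J : Finset ι} {nb : ι → Finset ι}

/-- After Jensen over the neighbours, each unit of `J` is counted once as itself and at most 2R
times as a neighbour. Division by `R` and (a - b)² ≤ 2a² + 2b² give the constant 2 + 4. -/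
lemma sum_neighbor_dev_sq_le (hR : 1 ≤ R) (hcard : ∀ i ∈ J, (nb i).card = R)
    (hrev : ∀ j, (Finset.univ.filter fun i => j ∈ nb i).card ≤ 2 * R) {w Δ : ι → ℝ} {W : ℝ}
    (hw : ∀ i, w i ^ 2 ≤ W) :
    ∑ i ∈ J with nb i ⊆ J, w i ^ 2 * (Δ i - (∑ j ∈ nb i, Δ j) / R) ^ 2 ≤
      6 * W * ∑ j ∈ J, Δ j ^ 2 := by
  have hR0 : (0 : ℝ) < R := by exact_mod_cast hR
  set G := J.filter fun i => nb i ⊆ J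
  have hW : ∀ i : ι, 0 ≤ W := fun i => (sq_nonneg _).trans (hw i)
  have h1 : ∀ i ∈ G, w i ^ 2 * (Δ i - (∑ j ∈ nb i, Δ j) / R) ^ 2 ≤
      W * (2 * Δ i ^ 2 + 2 / R * ∑ j ∈ nb i, Δ j ^ 2) := by
    intro i hi
    obtain ⟨hiJ, -⟩ := Finset.mem_filter.1 hi
    refine mul_le_mul (hw i) ?_ (sq_nonneg _) (hW i)
    have h2 := sq_sum_div_card_le (nb i) Δ
    rw [hcard i hiJ] at h2
    have e : 2 / R * ∑ j ∈ nb i, Δ j ^ 2 = 2 * ((∑ j ∈ nb i, Δ j ^ 2) / R) := by ring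
    rw [e]
    nlinarith [sq_nonneg (Δ i + (∑ j ∈ nb i, Δ j) / R)]
  have h3 : ∑ i ∈ G, ∑ j ∈ nb i, Δ j ^ 2 ≤ 2 * R * ∑ j ∈ J, Δ j ^ 2 := by
    have e1 : ∀ i ∈ G, ∑ j ∈ nb i, Δ j ^ 2 = ∑ j ∈ J, if j ∈ nb i then Δ j ^ 2 else 0 := by
      intro i hi
      rw [Finset.sum_ite_mem, Finset.inter_eq_right.2 (Finset.mem_filter.1 hi).2]
    rw [Finset.sum_congr rfl e1, Finset.sum_comm, Finset.mul_sum]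
    refine Finset.sum_le_sum fun j _ => ?_
    rw [← Finset.sum_filter, Finset.sum_const, nsmul_eq_mul]
    refine mul_le_mul_of_nonneg_right ?_ (sq_nonneg _)
    have h5 : (G.filter fun i => j ∈ nb i).card ≤ 2 * R :=
      (Finset.card_le_card (Finset.filter_subset_filter _ (Finset.subset_univ _))).trans (hrev j)
    exact_mod_cast h5
  rcases J.eq_empty_or_nonempty with h0 | ⟨i₀, -⟩
  · simp [G, h0]
  have hW0 := hW i₀
  have h4 : ∑ i ∈ G, Δ i ^ 2 ≤ ∑ i ∈ J, Δ i ^ 2 :=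
    Finset.sum_le_sum_of_subset_of_nonneg (Finset.filter_subset _ _) fun _ _ _ => sq_nonneg _
  refine (Finset.sum_le_sum h1).trans ?_
  rw [← Finset.mul_sum, Finset.sum_add_distrib, ← Finset.mul_sum, ← Finset.mul_sum]
  have h5 : 2 / R * ∑ i ∈ G, ∑ j ∈ nb i, Δ j ^ 2 ≤ 4 * ∑ j ∈ J, Δ j ^ 2 := by
    calc _ ≤ 2 / R * (2 * R * ∑ j ∈ J, Δ j ^ 2) := mul_le_mul_of_nonneg_left h3 (by positivity)
      _ = _ := by field_simp; ring
  nlinarith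

/-- Lower bound for the squared nearest-neighbour standard error. -/
lemma sum_sq_neighbor_ge (hR : 1 ≤ R) (hcard : ∀ i ∈ J, (nb i).card = R)
    (hrev : ∀ j, (Finset.univ.filter fun i => j ∈ nb i).card ≤ 2 * R) {w e μ Δ : ι → ℝ} {W t δ : ℝ}
    (hw : ∀ i, w i ^ 2 ≤ W) (hδ : 0 < δ) (hδ1 : δ ≤ 1)
    (hμ : ∀ i ∈ J, ∀ j ∈ nb i, j ∈ J → |μ i - μ j| ≤ t) :
    (1 - δ) * (∑ i ∈ J with nb i ⊆ J, w i ^ 2 * e i ^ 2 -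
      2 * ∑ i ∈ J with nb i ⊆ J, w i ^ 2 * (e i * ((∑ j ∈ nb i, e j) / R))) -
      2 / δ * (t ^ 2 * ∑ i ∈ J, w i ^ 2 + 6 * W * ∑ j ∈ J, Δ j ^ 2) ≤
    ∑ i, w i ^ 2 * ((μ i + e i - Δ i) - (∑ j ∈ nb i, (μ j + e j - Δ j)) / R) ^ 2 := by
  have hR0 : (0 : ℝ) < R := by exact_mod_cast hR
  set G := J.filter fun i => nb i ⊆ J with hG
  have hd := sum_neighbor_dev_sq_le (Δ := Δ) hR hcard hrev hw
  rw [← hG] at hd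
  have hm : ∀ i ∈ G, (μ i - (∑ j ∈ nb i, μ j) / R) ^ 2 ≤ t ^ 2 := by
    intro i hi
    obtain ⟨hiJ, hiG⟩ := Finset.mem_filter.1 hi
    have e : μ i - (∑ j ∈ nb i, μ j) / R = (∑ j ∈ nb i, (μ i - μ j)) / R := by
      rw [Finset.sum_sub_distrib, Finset.sum_const, hcard i hiJ, nsmul_eq_mul]
      field_simp
    have h1 : |μ i - (∑ j ∈ nb i, μ j) / R| ≤ t := by
      rw [e, abs_div, abs_of_pos hR0, div_le_iff₀ hR0]
      refine (Finset.abs_sum_le_sum_abs _ _).trans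
        ((Finset.sum_le_sum fun j hj => hμ i hiJ j hj (hiG hj)).trans_eq ?_)
      rw [Finset.sum_const, hcard i hiJ, nsmul_eq_mul, mul_comm]
    rw [← sq_abs]
    exact pow_le_pow_left₀ (abs_nonneg _) h1 2
  have hw2 : ∑ i ∈ G, w i ^ 2 ≤ ∑ i ∈ J, w i ^ 2 :=
    Finset.sum_le_sum_of_subset_of_nonneg (Finset.filter_subset _ _) fun _ _ _ => sq_nonneg _
  have hpt : ∀ i ∈ G, (1 - δ) * (w i ^ 2 * e i ^ 2 -
      2 * (w i ^ 2 * (e i * ((∑ j ∈ nb i, e j) / R)))) -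
      2 / δ * (t ^ 2 * w i ^ 2 + w i ^ 2 * (Δ i - (∑ j ∈ nb i, Δ j) / R) ^ 2) ≤
      w i ^ 2 * ((μ i + e i - Δ i) - (∑ j ∈ nb i, (μ j + e j - Δ j)) / R) ^ 2 := by
    intro i hi
    have h1 := hm i hi
    have e1 : (∑ j ∈ nb i, (μ j + e j - Δ j)) / R =
        (∑ j ∈ nb i, μ j) / R + (∑ j ∈ nb i, e j) / R - (∑ j ∈ nb i, Δ j) / R := by
      rw [Finset.sum_sub_distrib, Finset.sum_add_distrib]; ring
    rw [e1]
    set m := μ i - (∑ j ∈ nb i, μ j) / R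
    set d := Δ i - (∑ j ∈ nb i, Δ j) / R
    set b := (∑ j ∈ nb i, e j) / R
    have e2 : (μ i + e i - Δ i) - ((∑ j ∈ nb i, μ j) / R + b - (∑ j ∈ nb i, Δ j) / R) =
        (e i - b) + (m - d) := by simp only [m, d]; ring
    rw [e2]
    -- The square b² is dropped from (e - b)², and Young's inequality (x + r)² ≥ (1 - δ) x² - r² / δ
    -- separates the noise from the mean differences and the first-stage errors.
    have h2 : (1 - δ) * (e i ^ 2 - 2 * (e i * b)) - 2 / δ * (t ^ 2 + d ^ 2) ≤
        ((e i - b) + (m - d)) ^ 2 := by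
      have h3 : (1 - δ) * (e i ^ 2 - 2 * (e i * b)) ≤ (1 - δ) * (e i - b) ^ 2 :=
        mul_le_mul_of_nonneg_left (by nlinarith [sq_nonneg b]) (by linarith)
      have h4 : (m - d) ^ 2 ≤ 2 * (t ^ 2 + d ^ 2) := by nlinarith [sq_nonneg (m + d)]
      have h5 : (m - d) ^ 2 / δ ≤ 2 / δ * (t ^ 2 + d ^ 2) := by
        rw [div_mul_eq_mul_div]; exact div_le_div_of_nonneg_right h4 hδ.le
      have h6 : 0 ≤ (δ * (e i - b) + (m - d)) ^ 2 / δ := by positivity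
      have h7 : (δ * (e i - b) + (m - d)) ^ 2 / δ =
          δ * (e i - b) ^ 2 + 2 * (e i - b) * (m - d) + (m - d) ^ 2 / δ := by field_simp; ring
      nlinarith [sq_nonneg (m - d)]
    have := mul_le_mul_of_nonneg_left h2 (sq_nonneg (w i))
    refine le_trans (le_of_eq ?_) this
    ring
  have hsub : ∑ i ∈ G, w i ^ 2 * ((μ i + e i - Δ i) - (∑ j ∈ nb i, (μ j + e j - Δ j)) / R) ^ 2 ≤
      ∑ i, w i ^ 2 * ((μ i + e i - Δ i) - (∑ j ∈ nb i, (μ j + e j - Δ j)) / R) ^ 2 :=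
    Finset.sum_le_sum_of_subset_of_nonneg (Finset.subset_univ _) fun _ _ _ => by positivity
  refine le_trans ?_ ((Finset.sum_le_sum hpt).trans hsub)
  rw [Finset.sum_sub_distrib, ← Finset.mul_sum, Finset.sum_sub_distrib, ← Finset.mul_sum,
    ← Finset.mul_sum, Finset.sum_add_distrib, ← Finset.mul_sum]
  refine sub_le_sub_left (mul_le_mul_of_nonneg_left ?_ (by positivity)) _
  exact add_le_add (mul_le_mul_of_nonneg_left hw2 (sq_nonneg t)) hd

end NeighborVariance

/-! ### Conditional laws of large numbers and central limit theorem -/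

lemma memLp_two_of_lintegral_sq_le {E : Type*} [MeasurableSpace E] {ν : Measure E} {f : E → ℝ}
    (hf : Measurable f) {B : ℝ} (hB : 0 ≤ B) (h : ∫⁻ z, ENNReal.ofReal (f z ^ 2) ∂ν ≤ ENNReal.ofReal B) :
    MemLp f 2 ν ∧ ∫ z, f z ^ 2 ∂ν ≤ B := by
  have hL : MemLp f 2 ν := by
    rw [memLp_two_iff_integrable_sq hf.aestronglyMeasurable]
    refine ⟨(hf.pow_const 2).aestronglyMeasurable, ?_⟩
    rw [hasFiniteIntegral_iff_ofReal (ae_of_all _ fun p => sq_nonneg _)]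
    exact h.trans_lt ENNReal.ofReal_lt_top
  refine ⟨hL, ?_⟩
  rwa [← ofReal_integral_eq_lintegral_ofReal hL.integrable_sq
    (ae_of_all _ fun p => sq_nonneg _), ENNReal.ofReal_le_ofReal_iff hB] at h

lemma sq_sq_le_of_abs_le {x a : ℝ} (h : |x| ≤ a) : (x ^ 2) ^ 2 ≤ a ^ 4 := by
  have e : (x ^ 2) ^ 2 = |x| ^ 4 := by rw [← sq_abs x, ← pow_mul]
  rw [e]
  exact pow_le_pow_left₀ (abs_nonneg _) h 4

/-- Centered noise with a bounded fourth moment. -/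
structure CenteredNoise {ι E : Type} [MeasurableSpace E] (ν : ι → Measure E) (e : ι → E → ℝ)
    (B : ℝ) : Prop where
  measurable : ∀ i, Measurable (e i)
  mean : ∀ i, ∫ z, e i z ∂(ν i) = 0
  fourth : ∀ i, ∫⁻ z, ENNReal.ofReal (e i z ^ 4) ∂(ν i) ≤ ENNReal.ofReal B

namespace CenteredNoise

variable {ι E : Type} [MeasurableSpace E] {ν : ι → Measure E} {e : ι → E → ℝ} {B : ℝ}

lemma sq_memLp (h : CenteredNoise ν e B) (hB : 0 ≤ B) (i : ι) :
    MemLp (fun z => e i z ^ 2) 2 (ν i) ∧ ∫ z, e i z ^ 4 ∂(ν i) ≤ B := by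
  have := memLp_two_of_lintegral_sq_le ((h.measurable i).pow_const 2) hB (ν := ν i)
    (by simpa only [← pow_mul] using h.fourth i)
  simpa only [← pow_mul] using this

lemma integrable_fourth (h : CenteredNoise ν e B) (hB : 0 ≤ B) (i : ι) :
    Integrable (fun z => e i z ^ 4) (ν i) := by
  have := (h.sq_memLp hB i).1.integrable_sq
  simpa only [← pow_mul] using this

variable [∀ i, IsProbabilityMeasure (ν i)]

lemma integrable_sq (h : CenteredNoise ν e B) (hB : 0 ≤ B) (i : ι) :
    Integrable (fun z => e i z ^ 2) (ν i) := (h.sq_memLp hB i).1.integrable (by norm_num)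

lemma memLp (h : CenteredNoise ν e B) (hB : 0 ≤ B) (i : ι) : MemLp (e i) 2 (ν i) :=
  (memLp_two_iff_integrable_sq (h.measurable i).aestronglyMeasurable).2 (h.integrable_sq hB i)

lemma integral_sq_le (h : CenteredNoise ν e B) (hB : 0 ≤ B) (i : ι) :
    ∫ z, e i z ^ 2 ∂(ν i) ≤ 1 + B := by
  calc _ ≤ ∫ z, (1 + e i z ^ 4) ∂(ν i) := by
        refine integral_mono (h.integrable_sq hB i)
          ((integrable_const _).add (h.integrable_fourth hB i)) fun z => ?_
        show e i z ^ 2 ≤ 1 + e i z ^ 4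
        nlinarith [sq_nonneg (e i z ^ 2 - 1), sq_nonneg (e i z ^ 2)]
    _ = 1 + ∫ z, e i z ^ 4 ∂(ν i) := by
        rw [integral_add (integrable_const _) (h.integrable_fourth hB i)]; simp
    _ ≤ 1 + B := by linarith [(h.sq_memLp hB i).2]

lemma abs_cube_le (x : ℝ) : |x| ^ 3 ≤ 1 + x ^ 4 := by
  have h0 := abs_nonneg x
  have e : x ^ 4 = |x| ^ 4 := by rw [← abs_pow, abs_of_nonneg (by positivity)]
  rw [e]
  rcases le_total |x| 1 with h1 | h1
  · have := pow_le_one₀ (n := 3) h0 h1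
    have : 0 ≤ |x| ^ 4 := by positivity
    linarith
  · have : |x| ^ 3 * 1 ≤ |x| ^ 3 * |x| := mul_le_mul_of_nonneg_left h1 (by positivity)
    nlinarith

lemma integrable_cube (h : CenteredNoise ν e B) (hB : 0 ≤ B) (i : ι) :
    Integrable (fun z => |e i z| ^ 3) (ν i) := by
  refine ((integrable_const 1).add (h.integrable_fourth hB i)).mono'
    (((h.measurable i).abs.pow_const 3).aestronglyMeasurable) (ae_of_all _ fun z => ?_)
  rw [Real.norm_eq_abs, abs_of_nonneg (by positivity)]
  exact abs_cube_le _

lemma integral_cube_le (h : CenteredNoise ν e B) (hB : 0 ≤ B) (i : ι) :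
    ∫ z, |e i z| ^ 3 ∂(ν i) ≤ 1 + B := by
  calc _ ≤ ∫ z, (1 + e i z ^ 4) ∂(ν i) :=
        integral_mono (h.integrable_cube hB i)
          ((integrable_const _).add (h.integrable_fourth hB i)) fun z => abs_cube_le _
    _ = 1 + ∫ z, e i z ^ 4 ∂(ν i) := by
        rw [integral_add (integrable_const _) (h.integrable_fourth hB i)]; simp
    _ ≤ 1 + B := by linarith [(h.sq_memLp hB i).2]

variable [Fintype ι] [DecidableEq ι] {w : ι → ℝ} {a : ℝ}

/-- Dividing by `se` makes the total variance one, and the error is Lyapunov's sum. With weights of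
order 1/N on about N units and `se` of order N^(-1/2), it is of order N^(-1/2). -/
lemma exists_abs_sum_tail_le (δ : ℝ) (hδ : 0 < δ) : ∃ M > 0, ∀ {ι E : Type} [Fintype ι]
    [MeasurableSpace E] {ν : ι → Measure E} [∀ i, IsProbabilityMeasure (ν i)] {e : ι → E → ℝ}
    {B : ℝ}, CenteredNoise ν e B → 0 ≤ B → ∀ {w : ι → ℝ} {a : ℝ} {J : Finset ι},
    (∀ i, |w i| ≤ a) → (∀ i, w i ≠ 0 → i ∈ J) → ∀ {se : ℝ}, 0 < se →
    ∑ i, w i ^ 2 * ∫ z, e i z ^ 2 ∂(ν i) = se ^ 2 → ∀ u β : ℝ,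
    Measure.pi ν {y | u ≤ |(∑ i, w i * e i (y i)) / se + β|} ≤
      ENNReal.ofReal ((gaussianReal 0 1).real {x | u - δ ≤ |x + β|} +
        M * (J.card * ((a / se) ^ 3 * (1 + B) ^ 2))) := by
  obtain ⟨M, hM, H⟩ := exists_normal_abs_tail_le δ hδ
  have hg0 : 0 ≤ gaussAbsThird := integral_nonneg fun _ => by positivity
  refine ⟨M * (1 + gaussAbsThird), by positivity, ?_⟩
  intro ι E _ _ ν _ e B h hB w a J hw hJ se hse hvar u β
  set σ : ι → ℝ := fun i => ∫ z, e i z ^ 2 ∂(ν i)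
  have hσ0 : ∀ i, 0 ≤ σ i := fun i => integral_nonneg fun _ => sq_nonneg _
  have hmp := fun i => measurePreserving_eval ν i
  have hcomp : ∀ i (φ : E → ℝ), AEStronglyMeasurable φ (ν i) →
      ∫ y, φ (y i) ∂(Measure.pi ν) = ∫ z, φ z ∂(ν i) := fun i φ hφ => by
    have := integral_map (hmp i).measurable.aemeasurable (f := φ) (by rw [(hmp i).map_eq]; exact hφ)
    rw [(hmp i).map_eq] at this
    exact this.symm
  set ξ : ι → (ι → E) → ℝ := fun i y => w i / se * e i (y i) with hξ
  have hind : iIndepFun ξ (Measure.pi ν) := iIndepFun_pi (X := fun i z => w i / se * e i z)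
    fun i => ((h.measurable i).const_mul _).aemeasurable
  have habs : ∀ i y, |ξ i y| ^ 3 = |w i / se| ^ 3 * |e i (y i)| ^ 3 := fun i y => by
    rw [hξ, abs_mul, mul_pow]
  set v : ι → NNReal := fun i => ⟨(w i / se) ^ 2 * σ i, mul_nonneg (sq_nonneg _) (hσ0 i)⟩ with hv
  have hvc : ∀ i, (v i : ℝ) = (w i / se) ^ 2 * σ i := fun i => rfl
  have hsum : ∀ f : ι → ℝ, ∑ i ∈ J, w i * f i = ∑ i, w i * f i := fun f => by
    refine Finset.sum_subset (Finset.subset_univ _) fun i _ hi => ?_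
    rw [not_imp_comm.1 (hJ i) hi, zero_mul]
  have hfin := H (ξ := ξ) (P := Measure.pi ν) hind
    (fun i => ((h.measurable i).comp (measurable_pi_apply i)).const_mul _)
    (fun i => by
      simp only [habs]
      exact ((hmp i).integrable_comp_of_integrable (h.integrable_cube hB i)).const_mul _)
    (fun i => by
      rw [hξ, integral_const_mul, hcomp i (e i) (h.measurable i).aestronglyMeasurable, h.mean,
        mul_zero]) (v := v)
    (fun i => by
      simp only [hξ, mul_pow]
      rw [integral_const_mul, hcomp i (fun z => e i z ^ 2)
        ((h.measurable i).pow_const 2).aestronglyMeasurable]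
      rfl) J (by
      rw [← NNReal.coe_inj, NNReal.coe_sum, NNReal.coe_one]
      have e1 : ∀ i, (v i : ℝ) = w i * (w i * σ i / se ^ 2) := fun i => by
        rw [hvc]; ring
      simp only [e1]
      rw [hsum]
      have e2 : ∀ i, w i * (w i * σ i / se ^ 2) = w i ^ 2 * σ i / se ^ 2 := fun i => by ring
      simp only [e2]
      rw [← Finset.sum_div, hvar, div_self (by positivity)]) u β
  have hset : {y : ι → E | u ≤ |(∑ i, w i * e i (y i)) / se + β|} =
      {y | u ≤ |∑ i ∈ J, ξ i y + β|} := by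
    ext y
    simp only [mem_ofPred_eq, hξ]
    have e3 : ∀ i, w i / se * e i (y i) = w i * (e i (y i) / se) := fun i => by ring
    simp only [e3]
    rw [hsum fun i => e i (y i) / se]
    simp only [mul_div_assoc', ← Finset.sum_div]
  rw [hset]
  refine (ofReal_measureReal (measure_ne_top _ _)).symm.le.trans
    (ENNReal.ofReal_le_ofReal (hfin.trans ?_))
  refine add_le_add le_rfl ?_
  rw [mul_assoc]
  refine mul_le_mul_of_nonneg_left ?_ hM.le
  -- The third moment of the noise is at most 1 + B, and the cubed standard deviation at most (1 +
  -- B)^(3/2); (1 + B)² dominates both.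
  have hpt : ∀ i ∈ J, ∫ y, |ξ i y| ^ 3 ∂(Measure.pi ν) + √(v i) ^ 3 * gaussAbsThird ≤
      (1 + gaussAbsThird) * ((a / se) ^ 3 * (1 + B) ^ 2) := by
    intro i _
    have ha : 0 ≤ a := (abs_nonneg _).trans (hw i)
    have hwa : |w i / se| ≤ a / se := by
      rw [abs_div, abs_of_pos hse]; exact div_le_div_of_nonneg_right (hw i) hse.le
    have hwa3 := pow_le_pow_left₀ (abs_nonneg _) hwa 3
    have h1 : ∫ y, |ξ i y| ^ 3 ∂(Measure.pi ν) ≤ (a / se) ^ 3 * (1 + B) ^ 2 := by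
      simp only [habs]
      rw [integral_const_mul, hcomp i (fun z => |e i z| ^ 3)
        ((h.measurable i).abs.pow_const 3).aestronglyMeasurable]
      refine mul_le_mul hwa3 ((h.integral_cube_le hB i).trans ?_)
        (integral_nonneg fun _ => by positivity) (by positivity)
      nlinarith
    have h2 : √(v i) ^ 3 ≤ (a / se) ^ 3 * (1 + B) ^ 2 := by
      have e4 : √(v i : ℝ) = |w i / se| * √(σ i) := by
        rw [hvc, Real.sqrt_mul (sq_nonneg _), Real.sqrt_sq_eq_abs]
      rw [e4, mul_pow]
      refine mul_le_mul hwa3 ?_ (by positivity) (by positivity)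
      have h5 : √(σ i) ≤ √(1 + B) := Real.sqrt_le_sqrt (h.integral_sq_le hB i)
      refine (pow_le_pow_left₀ (Real.sqrt_nonneg _) h5 3).trans ?_
      have h6 : 1 ≤ √(1 + B) := Real.one_le_sqrt.2 (by linarith)
      have h7 : √(1 + B) ^ 2 = 1 + B := Real.sq_sqrt (by linarith)
      calc √(1 + B) ^ 3 ≤ √(1 + B) ^ 4 := pow_le_pow_right₀ h6 (by norm_num)
        _ = (√(1 + B) ^ 2) ^ 2 := by ring
        _ = _ := by rw [h7]
    nlinarith [mul_le_mul_of_nonneg_right h2 hg0]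
  refine (Finset.sum_le_sum hpt).trans_eq ?_
  rw [Finset.sum_const, nsmul_eq_mul]
  ring

/-- Weak law of large numbers for weighted squares. -/
lemma measure_abs_sum_sq_sub_ge_le (h : CenteredNoise ν e B) (hB : 0 ≤ B) (G : Finset ι)
    (hw : ∀ i, |w i| ≤ a) {t : ℝ} (ht : 0 < t) :
    Measure.pi ν {y | t ≤ |∑ i ∈ G, w i ^ 2 * (e i (y i) ^ 2 - ∫ z, e i z ^ 2 ∂(ν i))|} ≤
      ENNReal.ofReal (G.card * a ^ 4 * B / t ^ 2) := by
  have hL : ∀ i, MemLp (fun z => e i z ^ 2 - ∫ z, e i z ^ 2 ∂(ν i)) 2 (ν i) := fun i =>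
    (h.sq_memLp hB i).1.sub (memLp_const _)
  have hchb := measure_pi_abs_sum_ge_le (ν := ν)
    (e := fun i z => if i ∈ G then w i ^ 2 * (e i z ^ 2 - ∫ z, e i z ^ 2 ∂(ν i)) else 0)
    (fun i => by
      by_cases hi : i ∈ G
      · simpa only [hi, if_true] using (hL i).const_mul _
      · simp [hi])
    (fun i => by
      by_cases hi : i ∈ G
      · simp only [hi, if_true]
        rw [integral_const_mul, integral_sub (h.integrable_sq hB i) (integrable_const _)]
        simp
      · simp [hi]) ht
  simp only [Finset.sum_ite_mem, Finset.univ_inter] at hchb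
  refine hchb.trans (ENNReal.ofReal_le_ofReal (div_le_div_of_nonneg_right ?_ (sq_nonneg t)))
  have e1 : ∀ i, ∫ z, (if i ∈ G then w i ^ 2 * (e i z ^ 2 - ∫ z, e i z ^ 2 ∂(ν i)) else 0) ^ 2 ∂(ν i)
      ≤ if i ∈ G then a ^ 4 * B else 0 := by
    intro i
    by_cases hi : i ∈ G
    · simp only [hi, if_true, mul_pow]
      rw [integral_const_mul]
      have hw4 := sq_sq_le_of_abs_le (hw i)
      refine mul_le_mul hw4 ?_ (integral_nonneg fun _ => sq_nonneg _) (by positivity)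
      refine le_trans ?_ (h.sq_memLp hB i).2
      have := variance_eq_sub (h.sq_memLp hB i).1
      rw [variance_eq_integral (h.sq_memLp hB i).1.1.aemeasurable] at this
      rw [this]
      simp only [Pi.pow_apply, ← pow_mul]
      linarith [sq_nonneg (∫ z, e i z ^ 2 ∂(ν i))]
    · simp [hi]
  refine (Finset.sum_le_sum fun i _ => e1 i).trans_eq ?_
  rw [Finset.sum_ite_mem, Finset.univ_inter, Finset.sum_const, nsmul_eq_mul, mul_assoc]

/-- Cross products of neighbouring noise terms average out. -/
lemma measure_abs_sum_neighbor_ge_le (h : CenteredNoise ν e B) (hB : 0 ≤ B) (G : Finset ι)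
    (hw : ∀ i, |w i| ≤ a) {nb : ι → Finset ι} {R : ℕ} (hR : 1 ≤ R)
    (hnb : ∀ i ∈ G, (nb i).card = R ∧ i ∉ nb i) {t : ℝ} (ht : 0 < t) :
    Measure.pi ν {y | t ≤ |∑ i ∈ G, w i ^ 2 * (e i (y i) * ((∑ j ∈ nb i, e j (y j)) / R))|} ≤
      ENNReal.ofReal (2 * (1 + B) ^ 2 * (G.card * a ^ 4) / t ^ 2) := by
  have hR0 : (1 : ℝ) ≤ R := by exact_mod_cast hR
  -- A quadratic form with coefficients w_i² / R: its diagonal vanishes because no unit neighbours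
  -- itself, and a row has squared norm at most a⁴ / R.
  set c : ι → ι → ℝ := fun i j => if i ∈ G then if j ∈ nb i then w i ^ 2 / R else 0 else 0
  have hq := measure_pi_abs_quadratic_ge_le (ν := ν) (e := e) (fun i => h.memLp hB i) h.mean
    (fun i => h.integral_sq_le hB i) (c := c) (fun i => by
      by_cases hi : i ∈ G
      · simp [c, (hnb i hi).2]
      · simp [c, hi]) ht
  have e1 : ∀ y : ι → E, ∑ i, ∑ j, c i j * (e i (y i) * e j (y j)) =
      ∑ i ∈ G, w i ^ 2 * (e i (y i) * ((∑ j ∈ nb i, e j (y j)) / R)) := by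
    intro y
    rw [← Finset.univ_inter G, ← Finset.sum_ite_mem]
    refine Finset.sum_congr rfl fun i _ => ?_
    by_cases hi : i ∈ G
    · simp only [c, hi, if_true, ite_mul, zero_mul, Finset.sum_ite_mem, Finset.univ_inter,
        Finset.sum_div, Finset.mul_sum]
      exact Finset.sum_congr rfl fun j _ => by ring
    · simp [c, hi]
  simp only [e1] at hq
  refine hq.trans (ENNReal.ofReal_le_ofReal (div_le_div_of_nonneg_right ?_ (sq_nonneg t)))
  refine mul_le_mul_of_nonneg_left ?_ (by positivity)
  have e2 : ∀ i, ∑ j, c i j ^ 2 ≤ if i ∈ G then a ^ 4 else 0 := by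
    intro i
    by_cases hi : i ∈ G
    · simp only [c, hi, if_true, ite_pow, zero_pow two_ne_zero, Finset.sum_ite_mem,
        Finset.univ_inter, Finset.sum_const, (hnb i hi).1, nsmul_eq_mul]
      have hw4 := sq_sq_le_of_abs_le (hw i)
      calc (R : ℝ) * (w i ^ 2 / R) ^ 2 = (w i ^ 2) ^ 2 / R := by field_simp
        _ ≤ (w i ^ 2) ^ 2 := div_le_self (by positivity) hR0
        _ ≤ a ^ 4 := hw4
    · simp [c, hi]
  refine (Finset.sum_le_sum fun i _ => e2 i).trans_eq ?_
  rw [Finset.sum_ite_mem, Finset.univ_inter, Finset.sum_const, nsmul_eq_mul]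

end CenteredNoise

/-! ### Coverage given the running variable -/

/-- The sampling model given the running variable: outcomes `M i = μ i + e i` on the estimation
window `J`, regression weights `w`, neighbour sets `nb` and effective sample size `N`. -/
structure ConditionalModel {ι E : Type} [Fintype ι] [DecidableEq ι] [MeasurableSpace E]
    (ν : ι → Measure E) (M e : ι → E → ℝ) (w μ : ι → ℝ) (J : Finset ι) (nb : ι → Finset ι) (R : ℕ)
    (W Cw C B N t : ℝ) : Prop where
  noise : CenteredNoise ν e B
  eq : ∀ i ∈ J, ∀ z, M i z = μ i + e i z
  var : ∀ i ∈ J, 1 / C ≤ ∫ z, e i z ^ 2 ∂(ν i)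
  weight : ∀ i, |w i| ≤ W / N
  support : ∀ i, w i ≠ 0 → i ∈ J
  card : (J.card : ℝ) ≤ Cw * N
  weight_sq : 1 / (Cw * N) ≤ ∑ i, w i ^ 2
  nb_card : ∀ i ∈ J, (nb i).card = R
  nb_self : ∀ i ∈ J, i ∉ nb i
  nb_rev : ∀ j, (Finset.univ.filter fun i => j ∈ nb i).card ≤ 2 * R
  nb_out : (J.filter fun i => ¬ nb i ⊆ J).card ≤ 2 * R
  smooth : ∀ i ∈ J, ∀ j ∈ nb i, j ∈ J → |μ i - μ j| ≤ t

namespace ConditionalModel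

variable {ι E : Type} [Fintype ι] [DecidableEq ι] [MeasurableSpace E]
  {ν : ι → Measure E} {M e : ι → E → ℝ} {w μ : ι → ℝ}
  {J : Finset ι} {nb : ι → Finset ι} {R : ℕ} {W Cw C B N t : ℝ}

lemma sum_eq (h : ConditionalModel ν M e w μ J nb R W Cw C B N t) (f : ι → ℝ) :
    ∑ i ∈ J, w i * f i = ∑ i, w i * f i := by
  refine Finset.sum_subset (Finset.subset_univ _) fun i _ hi => ?_
  rw [not_imp_comm.1 (h.support i) hi, zero_mul]

/-- Conditional variances are bounded below, so the standard error is at least of order N^(-1/2),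
the scale against which all errors are measured. -/
lemma var_ge (h : ConditionalModel ν M e w μ J nb R W Cw C B N t) (hC : 0 < C) :
    1 / (C * Cw) / N ≤ ∑ i, w i ^ 2 * ∫ z, e i z ^ 2 ∂(ν i) := by
  calc 1 / (C * Cw) / N = 1 / C * (1 / (Cw * N)) := by rw [div_div, one_div_mul_one_div, mul_assoc]
    _ ≤ 1 / C * ∑ i, w i ^ 2 := mul_le_mul_of_nonneg_left h.weight_sq (by positivity)
    _ = ∑ i, w i ^ 2 * (1 / C) := by rw [Finset.mul_sum]; exact Finset.sum_congr rfl fun _ _ => mul_comm _ _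
    _ ≤ _ := Finset.sum_le_sum fun i _ => by
        by_cases hw : w i = 0
        · simp [hw]
        · exact mul_le_mul_of_nonneg_left (h.var i (h.support i hw)) (sq_nonneg _)

lemma sum_sq_le (h : ConditionalModel ν M e w μ J nb R W Cw C B N t) (hN : 0 < N) :
    ∑ i ∈ J, w i ^ 2 ≤ Cw * W ^ 2 / N := by
  have h1 : ∀ i ∈ J, w i ^ 2 ≤ (W / N) ^ 2 := fun i _ => by
    rw [← sq_abs]; exact pow_le_pow_left₀ (abs_nonneg _) (h.weight i) 2
  refine (Finset.sum_le_sum h1).trans ?_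
  rw [Finset.sum_const, nsmul_eq_mul]
  refine (mul_le_mul_of_nonneg_right h.card (sq_nonneg _)).trans_eq ?_
  field_simp

variable [∀ i, IsProbabilityMeasure (ν i)]

/-- On an event of high probability the nearest-neighbour standard error is not too small. -/
lemma le_sum_sq_neighbor (h : ConditionalModel ν M e w μ J nb R W Cw C B N t) (hR : 1 ≤ R)
    (hC : 0 < C) (hB : 0 ≤ B) (hN : 0 < N) {δ ε q : ℝ} (hδ : 0 < δ) (hδ1 : δ ≤ 1)
    (hε : 0 ≤ ε)
    (hjunk : 2 * R * W ^ 2 * (1 + B) / N + 3 * ε + 2 / δ * (t ^ 2 * (Cw * W ^ 2) + 6 * W ^ 2 * q) ≤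
      δ * (1 - δ) * (1 / (C * Cw)))
    {y : ι → E} {Δ : ι → ℝ}
    (h1 : |∑ i ∈ J with nb i ⊆ J, w i ^ 2 * (e i (y i) ^ 2 - ∫ z, e i z ^ 2 ∂(ν i))| ≤ ε / N)
    (h2 : |∑ i ∈ J with nb i ⊆ J, w i ^ 2 * (e i (y i) * ((∑ j ∈ nb i, e j (y j)) / R))| ≤ ε / N)
    (h3 : ∑ i ∈ J, Δ i ^ 2 ≤ q * N) :
    (1 - δ) ^ 2 * ∑ i, w i ^ 2 * ∫ z, e i z ^ 2 ∂(ν i) ≤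
      ∑ i, w i ^ 2 * ((M i (y i) - Δ i) - (∑ j ∈ nb i, (M j (y j) - Δ j)) / R) ^ 2 := by
  set σ : ι → ℝ := fun i => ∫ z, e i z ^ 2 ∂(ν i) with hσ
  have hσ0 : ∀ i, 0 ≤ σ i := fun i => integral_nonneg fun _ => sq_nonneg _
  set V := ∑ i, w i ^ 2 * σ i with hV
  have hw2 : ∀ i, w i ^ 2 ≤ W ^ 2 / N ^ 2 := fun i => by
    rw [← sq_abs, ← div_pow]; exact pow_le_pow_left₀ (abs_nonneg _) (h.weight i) 2
  have key := sum_sq_neighbor_ge (w := w) (e := fun i => M i (y i) - μ i) (μ := μ) (Δ := Δ)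
    (δ := δ) hR h.nb_card h.nb_rev hw2 hδ hδ1 h.smooth
  have em : ∀ i, μ i + (M i (y i) - μ i) - Δ i = M i (y i) - Δ i := fun i => by ring
  simp only [em] at key
  refine le_trans ?_ key
  have c1 : ∑ i ∈ J with nb i ⊆ J, w i ^ 2 * (M i (y i) - μ i) ^ 2 =
      ∑ i ∈ J with nb i ⊆ J, w i ^ 2 * (e i (y i) ^ 2 - σ i) +
      ∑ i ∈ J with nb i ⊆ J, w i ^ 2 * σ i := by
    rw [← Finset.sum_add_distrib]
    refine Finset.sum_congr rfl fun i hi => ?_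
    rw [h.eq i (Finset.mem_filter.1 hi).1]; ring
  have c2 : ∑ i ∈ J with nb i ⊆ J, w i ^ 2 * ((M i (y i) - μ i) *
      ((∑ j ∈ nb i, (M j (y j) - μ j)) / R)) =
      ∑ i ∈ J with nb i ⊆ J, w i ^ 2 * (e i (y i) * ((∑ j ∈ nb i, e j (y j)) / R)) := by
    refine Finset.sum_congr rfl fun i hi => ?_
    obtain ⟨hi1, hi2⟩ := Finset.mem_filter.1 hi
    have e1 : ∑ j ∈ nb i, (M j (y j) - μ j) = ∑ j ∈ nb i, e j (y j) :=
      Finset.sum_congr rfl fun j hj => by rw [h.eq j (hi2 hj)]; ring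
    rw [e1, h.eq i hi1]; ring
  -- Units with a neighbour outside the window are discarded; there are at most 2R of them, each
  -- carrying variance at most W² (1 + B) / N².
  have c3 : V - 2 * R * W ^ 2 * (1 + B) / N / N ≤ ∑ i ∈ J with nb i ⊆ J, w i ^ 2 * σ i := by
    have e1 : V = ∑ i ∈ J, w i ^ 2 * σ i := by
      have := h.sum_eq fun i => w i * σ i
      simp only [← mul_assoc, ← sq] at this
      exact this.symm
    rw [e1, ← Finset.sum_filter_add_sum_filter_not J (fun i => nb i ⊆ J)]
    have e2 : ∑ i ∈ J with ¬ nb i ⊆ J, w i ^ 2 * σ i ≤ 2 * R * W ^ 2 * (1 + B) / N / N := by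
      calc _ ≤ ∑ i ∈ J with ¬ nb i ⊆ J, W ^ 2 / N ^ 2 * (1 + B) := Finset.sum_le_sum fun i _ =>
            mul_le_mul (hw2 i) (h.noise.integral_sq_le hB i) (hσ0 i) (by positivity)
        _ = (J.filter fun i => ¬ nb i ⊆ J).card * (W ^ 2 / N ^ 2 * (1 + B)) := by
            rw [Finset.sum_const, nsmul_eq_mul]
        _ ≤ (2 * R : ℕ) * (W ^ 2 / N ^ 2 * (1 + B)) :=
            mul_le_mul_of_nonneg_right (by exact_mod_cast h.nb_out) (by positivity)
        _ = _ := by push_cast; field_simp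
    linarith
  rw [c1, c2]
  have hs := h.sum_sq_le hN
  have hV0 := h.var_ge hC
  rw [← hV] at hV0
  have a1 := (abs_le.1 h1).1
  have a2 := (abs_le.1 h2).2
  set X1 := ∑ i ∈ J with nb i ⊆ J, w i ^ 2 * (e i (y i) ^ 2 - σ i)
  set X2 := ∑ i ∈ J with nb i ⊆ J, w i ^ 2 * (e i (y i) * ((∑ j ∈ nb i, e j (y j)) / R))
  set X3 := ∑ i ∈ J with nb i ⊆ J, w i ^ 2 * σ i
  have p1 : (1 - δ) * (V - (2 * R * W ^ 2 * (1 + B) / N / N + 3 * ε / N)) ≤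
      (1 - δ) * (X1 + X3 - 2 * X2) := by
    refine mul_le_mul_of_nonneg_left ?_ (by linarith)
    have : 3 * ε / N = ε / N + 2 * (ε / N) := by ring
    linarith
  have p2 : 2 / δ * (t ^ 2 * ∑ i ∈ J, w i ^ 2 + 6 * (W ^ 2 / N ^ 2) * ∑ j ∈ J, Δ j ^ 2) ≤
      2 / δ * (t ^ 2 * (Cw * W ^ 2) + 6 * W ^ 2 * q) / N := by
    rw [mul_div_assoc]
    refine mul_le_mul_of_nonneg_left ?_ (by positivity)
    have q1 := mul_le_mul_of_nonneg_left hs (sq_nonneg t)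
    have q2 : 6 * (W ^ 2 / N ^ 2) * ∑ j ∈ J, Δ j ^ 2 ≤ 6 * (W ^ 2 / N ^ 2) * (q * N) :=
      mul_le_mul_of_nonneg_left h3 (by positivity)
    have q3 : 6 * (W ^ 2 / N ^ 2) * (q * N) = 6 * W ^ 2 * q / N := by field_simp
    rw [add_div, mul_div_assoc]
    linarith
  -- By `hjunk` and the lower bound for `V` the errors fit into δ (1 - δ) V, and (1 - δ) V - δ (1 -
  -- δ) V = (1 - δ)² V.
  have p3 : (2 * R * W ^ 2 * (1 + B) / N / N + 3 * ε / N) +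
      2 / δ * (t ^ 2 * (Cw * W ^ 2) + 6 * W ^ 2 * q) / N ≤ δ * (1 - δ) * V := by
    rw [← add_div, ← add_div]
    refine (div_le_div_of_nonneg_right hjunk hN.le).trans ?_
    rw [mul_div_assoc]
    exact mul_le_mul_of_nonneg_left hV0 (mul_nonneg hδ.le (by linarith))
  have p4 : 0 ≤ δ * (2 * R * W ^ 2 * (1 + B) / N / N + 3 * ε / N) := by positivity
  nlinarith

/-- Turns noncoverage, with its random critical value, into a tail event for the normalized noise.
For γ ≥ 1/2 the half-length is nondecreasing in the standard error, so a lower bound for the latter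
suffices; lowering the bias ratio from b / ((1 - δ) se) to b / se only lowers the quantile. -/
lemma le_abs_of_notMem_bias_aware {γ : ℝ} (h0 : 1 / 2 ≤ γ) (h1 : γ < 1) {se s' δ X b₀ b f F τ T : ℝ}
    (hse : 0 < se) (hδ1 : δ < 1) (hs : (1 - δ) ^ 2 * se ^ 2 ≤ s' ^ 2) (hs0 : 0 ≤ s')
    (hδ : 0 ≤ δ) (hb : 0 ≤ b) (hT : T - τ = X + b₀ - F) (hF : |F| ≤ f)
    (hnot : τ ∉ Icc (T - absNormalQuantile γ (b / s') * s') (T + absNormalQuantile γ (b / s') * s')) :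
    (1 - δ) * absNormalQuantile γ (b / se) - f / se ≤ |X / se + b₀ / se| := by
  have hs1 : (1 - δ) * se ≤ s' := by
    rwa [← sq_le_sq₀ (mul_nonneg (by linarith) hse.le) hs0, mul_pow]
  have hpos : 0 < (1 - δ) * se := mul_pos (by linarith) hse
  have q1 := absNormalQuantile_scale_mono (b := b) h0 h1 hpos hs1
  have q2 : absNormalQuantile γ (b / se) ≤ absNormalQuantile γ (b / ((1 - δ) * se)) :=
    absNormalQuantile_mono (by linarith) h1 (by positivity)
      (div_le_div_of_nonneg_left hb hpos (mul_le_of_le_one_left hse.le (by linarith)))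
  have q3 := mul_le_mul_of_nonneg_right q2 hpos.le
  set z := absNormalQuantile γ (b / s') * s'
  have h2 : z < |T - τ| := by
    by_contra hcon
    have := abs_le.1 (not_lt.1 hcon)
    exact hnot ⟨by linarith, by linarith⟩
  have h3 : |T - τ| ≤ |X + b₀| + f := by rw [hT]; exact (abs_sub _ _).trans (by linarith)
  rw [← add_div, abs_div, abs_of_pos hse, le_div_iff₀ hse, sub_mul, div_mul_cancel₀ _ hse.ne']
  linarith

/-- Bound for the conditional probability of noncoverage. -/
lemma noncoverage_le (h : ConditionalModel ν M e w μ J nb R W Cw C B N t) (hR : 1 ≤ R)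
    (hC : 0 < C) (hCw : 0 < Cw) (hW : 0 ≤ W) (hB : 0 ≤ B) (hN : 0 < N) {γ : ℝ} (h0 : 1 / 2 ≤ γ)
    (h1 : γ < 1) {δ d' Mc Kb c₀ : ℝ} (hδ : 0 < δ) (hδ1 : δ < 1) (hε : 0 < t) (hd' : 0 < d')
    (hMc : 0 < Mc) (hc₀ : 0 < c₀) (hc₀' : c₀ ^ 2 = 1 / (C * Cw)) {S : ℕ}
    (hclt : ∀ {se : ℝ}, 0 < se → ∑ i, w i ^ 2 * ∫ z, e i z ^ 2 ∂(ν i) = se ^ 2 → ∀ u β : ℝ,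
      Measure.pi ν {y | u ≤ |(∑ i, w i * e i (y i)) / se + β|} ≤
      ENNReal.ofReal ((gaussianReal 0 1).real {x | u - d' ≤ |x + β|} +
        Mc * (J.card * (((W / N) / se) ^ 3 * (1 + B) ^ 2))))
    (hjunk : 2 * R * W ^ 2 * (1 + B) / N + 3 * t +
      2 / δ * (t ^ 2 * (Cw * W ^ 2) + 6 * W ^ 2 * (S * t ^ 2)) ≤ δ * (1 - δ) * (1 / (C * Cw)))
    (s : ι → Fin S) {g : (k : Fin S) → ({i // i ∈ Finset.univ.filter fun i => s i ≠ k} → E) → E → ℝ}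
    (hg : ∀ k, Measurable fun p : ({i // i ∈ Finset.univ.filter fun i => s i ≠ k} → E) × E =>
      g k p.1 p.2) {b τ : ℝ}
    (hb : 0 ≤ b) (hbK : b ≤ Kb / √N) (hbias : |∑ i, w i * μ i - τ| ≤ b + t / √N) :
    Measure.pi ν {y | (∀ k, (∀ i ∈ J, ∫⁻ z, ENNReal.ofReal (g k (fun j => y j) z ^ 2) ∂(ν i) ≤
        ENNReal.ofReal (t ^ 4)) ∧
        |∑ i with s i = k, w i * ∫ z, g k (fun j => y j) z ∂(ν i)| ≤ t / √N) ∧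
      ∀ T s', T = ∑ i, w i * (M i (y i) - g (s i) (fun j => y j) (y i)) →
      s' = √(∑ i, w i ^ 2 * ((M i (y i) - g (s i) (fun j => y j) (y i)) -
        (∑ j ∈ nb i, (M j (y j) - g (s j) (fun j => y j) (y j))) / R) ^ 2) →
      τ ∉ Icc (T - absNormalQuantile γ (b / s') * s') (T + absNormalQuantile γ (b / s') * s')} ≤
      ENNReal.ofReal (1 - γ + 2 * (δ * (absNormalQuantile γ 0 + Kb / c₀) + 2 * S * t / c₀ + d' +
          2 * (t / c₀)) + S * Cw * (W ^ 2 + 1) * t ^ 2 +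
          (Cw * W ^ 4 * B + 2 * (1 + B) ^ 2 * Cw * W ^ 4) / (N * t ^ 2) +
          Mc * Cw * W ^ 3 * (1 + B) ^ 2 / (c₀ ^ 3 * √N)) := by
  have hsN : 0 < √N := Real.sqrt_pos.2 hN
  have hsN2 : √N ^ 2 = N := Real.sq_sqrt hN.le
  set σ : ι → ℝ := fun i => ∫ z, e i z ^ 2 ∂(ν i) with hσ
  set V := ∑ i, w i ^ 2 * σ i with hV
  have hV0 : c₀ ^ 2 / N ≤ V := by rw [hc₀']; exact h.var_ge hC
  have hVpos : 0 < V := lt_of_lt_of_le (by positivity) hV0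
  set se := √V with hse
  have hse0 : 0 < se := Real.sqrt_pos.2 hVpos
  have hse2 : se ^ 2 = V := Real.sq_sqrt hVpos.le
  have hsec : c₀ / √N ≤ se := by
    rw [hse]; refine Real.le_sqrt_of_sq_le ?_
    rw [div_pow, hsN2]; exact hV0
  have hdiv : ∀ x : ℝ, 0 ≤ x → x / √N / se ≤ x / c₀ := fun x hx => by
    rw [div_div]
    refine div_le_div_of_nonneg_left hx hc₀ ?_
    rwa [div_le_iff₀ hsN, mul_comm] at hsec
  set z := absNormalQuantile γ (b / se) with hz
  -- The factor 1 - δ pays for the estimated standard error. The subtracted term pays for the first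
  -- stage: t / √N per fold for the centred part and as much for the conditional mean.
  set u := (1 - δ) * z - (2 * S * t / √N) / se with hu
  set β := (∑ i, w i * μ i - τ) / se with hβ
  set G := J.filter fun i => nb i ⊆ J with hG
  have hGJ : (G.card : ℝ) ≤ Cw * N :=
    le_trans (by exact_mod_cast Finset.card_le_card (Finset.filter_subset _ _)) h.card
  -- Five kinds of bad events: squares of the noise, products with neighbours, centred first-stage
  -- sums, first-stage mean squares, and the normal tail. Outside of them an accurate first stage
  -- excludes noncoverage.
  set A1 := {y : ι → E | t / N ≤ |∑ i ∈ G, w i ^ 2 * (e i (y i) ^ 2 - σ i)|} with hA1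
  set A2 := {y : ι → E | t / N ≤
    |∑ i ∈ G, w i ^ 2 * (e i (y i) * ((∑ j ∈ nb i, e j (y j)) / R))|} with hA2
  set A3 : Fin S → Set (ι → E) := fun k => {y | (∀ i ∈ (J : Set ι),
      ∫⁻ z, ENNReal.ofReal (g k (fun j => y j) z ^ 2) ∂(ν i) ≤ ENNReal.ofReal (t ^ 4)) ∧
    t / √N ≤ |∑ i with i ∉ Finset.univ.filter fun i => s i ≠ k,
      w i * (g k (fun j => y j) (y i) - ∫ z, g k (fun j => y j) z ∂(ν i))|} with hA3
  set A4 : Fin S → Set (ι → E) := fun k => {y | (∀ i ∈ J,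
      ∫⁻ z, ENNReal.ofReal (g k (fun j => y j) z ^ 2) ∂(ν i) ≤ ENNReal.ofReal (t ^ 4)) ∧
    t ^ 2 * N ≤ ∑ i ∈ J with i ∉ Finset.univ.filter fun i => s i ≠ k,
      g k (fun j => y j) (y i) ^ 2} with hA4
  set A5 := {y : ι → E | u ≤ |(∑ i, w i * e i (y i)) / se + β|} with hA5
  have b1 : Measure.pi ν A1 ≤ ENNReal.ofReal (Cw * W ^ 4 * B / (N * t ^ 2)) := by
    refine (h.noise.measure_abs_sum_sq_sub_ge_le hB G h.weight (by positivity)).trans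
      (ENNReal.ofReal_le_ofReal ?_)
    have e1 : Cw * W ^ 4 * B / (N * t ^ 2) = Cw * N * (W / N) ^ 4 * B / (t / N) ^ 2 := by field_simp
    rw [e1]
    gcongr
  have b2 : Measure.pi ν A2 ≤ ENNReal.ofReal (2 * (1 + B) ^ 2 * Cw * W ^ 4 / (N * t ^ 2)) := by
    refine (h.noise.measure_abs_sum_neighbor_ge_le hB G h.weight hR (fun i hi => ?_)
      (by positivity)).trans (ENNReal.ofReal_le_ofReal ?_)
    · have := (Finset.mem_filter.1 hi).1
      exact ⟨h.nb_card i this, h.nb_self i this⟩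
    · have e1 : 2 * (1 + B) ^ 2 * Cw * W ^ 4 / (N * t ^ 2) =
        2 * (1 + B) ^ 2 * (Cw * N * (W / N) ^ 4) / (t / N) ^ 2 := by field_simp
      rw [e1]
      gcongr
  have b3 : ∀ k, Measure.pi ν (A3 k) ≤ ENNReal.ofReal (Cw * W ^ 2 * t ^ 2) := fun k => by
    refine (measure_pi_crossfit_abs_sum_ge_le (hg k) (Q := (J : Set ι)) (fun i hi => h.support i hi)
      (by positivity) (by positivity)).trans (ENNReal.ofReal_le_ofReal ?_)
    have e0 : ∑ i, w i ^ 2 = ∑ i ∈ J, w i ^ 2 := by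
      have := h.sum_eq w
      simp only [← sq] at this
      exact this.symm
    have e1 : Cw * W ^ 2 * t ^ 2 = (Cw * W ^ 2 / N) * t ^ 4 / (t / √N) ^ 2 := by
      rw [div_pow, hsN2]; field_simp
    rw [e1, e0]
    have := h.sum_sq_le hN
    gcongr
  have b4 : ∀ k, Measure.pi ν (A4 k) ≤ ENNReal.ofReal (Cw * t ^ 2) := fun k => by
    refine (measure_pi_crossfit_sum_sq_ge_le J (hg k) (by positivity)).trans
      (ENNReal.ofReal_le_ofReal ?_)
    have e1 : Cw * t ^ 2 = Cw * N * t ^ 4 / (t ^ 2 * N) := by field_simp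
    rw [e1]
    have := h.card
    gcongr
  have hKb : 0 ≤ Kb := by
    have := hb.trans hbK
    rwa [le_div_iff₀ hsN, zero_mul] at this
  have hr : b / se ≤ Kb / c₀ := (div_le_div_of_nonneg_right hbK hse0.le).trans (hdiv Kb hKb)
  have hz0 : 0 ≤ z := absNormalQuantile_nonneg (by linarith) _
  have hzle : z ≤ absNormalQuantile γ 0 + Kb / c₀ := by
    have := absNormalQuantile_le_add (by linarith : 0 < γ) h1 0 (b / se)
    rw [sub_zero, abs_of_nonneg (by positivity)] at this
    linarith
  have b5 : Measure.pi ν A5 ≤ ENNReal.ofReal (1 - γ +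
      2 * (δ * (absNormalQuantile γ 0 + Kb / c₀) + 2 * S * t / c₀ + d' + 2 * (t / c₀)) +
      Mc * Cw * W ^ 3 * (1 + B) ^ 2 / (c₀ ^ 3 * √N)) := by
    refine (hclt hse0 hse2.symm u β).trans (ENNReal.ofReal_le_ofReal (add_le_add ?_ ?_))
    · have hβ1 : |β| ≤ b / se + t / c₀ := by
        rw [hβ, abs_div, abs_of_pos hse0]
        refine (div_le_div_of_nonneg_right hbias hse0.le).trans ?_
        rw [add_div]
        exact add_le_add le_rfl (hdiv t hε.le)
      have hu1 : u - d' ≤ z := by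
        have : 0 ≤ (2 * S * t / √N) / se := by positivity
        have : 0 ≤ δ * z := by positivity
        rw [hu]; linarith
      refine (gaussianReal_abs_ge_le (by linarith) h1 (by positivity) hβ1 hu1).trans ?_
      have e1 : δ * z ≤ δ * (absNormalQuantile γ 0 + Kb / c₀) := mul_le_mul_of_nonneg_left hzle hδ.le
      have e2 : (2 * S * t / √N) / se ≤ 2 * S * t / c₀ := hdiv _ (by positivity)
      rw [← hz, hu]
      linarith
    · have e1 : W / N / se ≤ W / (c₀ * √N) := by
        have e3 : W / N = W / √N / √N := by rw [div_div, ← sq, hsN2]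
        rw [e3]
        refine (hdiv (W / √N) (by positivity)).trans_eq ?_
        rw [div_div, mul_comm]
      have e2 : Mc * Cw * W ^ 3 * (1 + B) ^ 2 / (c₀ ^ 3 * √N) =
          Mc * ((Cw * N) * ((W / (c₀ * √N)) ^ 3 * (1 + B) ^ 2)) := by
        have : N = √N ^ 2 := hsN2.symm
        rw [div_pow, mul_pow]
        nth_rw 2 [this]
        field_simp
      rw [e2]
      have := h.card
      gcongr
  refine (measure_mono (t := A1 ∪ A2 ∪ (⋃ k, A3 k) ∪ (⋃ k, A4 k) ∪ A5) ?_).trans ?_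
  · rintro y ⟨hy, hcov⟩
    by_contra hcon
    simp only [mem_union, mem_iUnion, not_or, not_exists] at hcon
    obtain ⟨⟨⟨⟨n1, n2⟩, n3⟩, n4⟩, n5⟩ := hcon
    set Δ : ι → ℝ := fun i => g (s i) (fun j => y j) (y i) with hΔ
    have hk : ∀ k i, i ∉ (Finset.univ.filter fun i => s i ≠ k) ↔ s i = k := fun k i => by simp
    have n3' : ∀ k, |∑ i with s i = k, w i * (g k (fun j => y j) (y i) -
        ∫ z, g k (fun j => y j) z ∂(ν i))| ≤ t / √N := fun k => by
      have := fun h3 => n3 k ⟨fun i hi => (hy k).1 i hi, h3⟩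
      simp only [hk] at this
      exact le_of_lt (not_le.1 this)
    have n4' : ∀ k, ∑ i ∈ J with s i = k, Δ i ^ 2 ≤ t ^ 2 * N := fun k => by
      have := fun h3 => n4 k ⟨fun i hi => (hy k).1 i hi, h3⟩
      simp only [hk] at this
      refine le_trans (le_of_eq ?_) (le_of_lt (not_le.1 this))
      refine Finset.sum_congr rfl fun i hi => ?_
      obtain ⟨-, rfl⟩ := Finset.mem_filter.1 hi
      rfl
    have hΔsum : ∑ i ∈ J, Δ i ^ 2 ≤ (S * t ^ 2) * N := by
      rw [← Finset.sum_fiberwise J s]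
      refine (Finset.sum_le_sum fun k _ => n4' k).trans_eq ?_
      rw [Finset.sum_const, Finset.card_univ, Fintype.card_fin, nsmul_eq_mul, mul_assoc]
    have hlow := h.le_sum_sq_neighbor hR hC hB hN hδ hδ1.le hε.le hjunk
      (le_of_lt (lt_of_not_ge fun h => n1 h)) (le_of_lt (lt_of_not_ge fun h => n2 h)) hΔsum
    rw [← hV, ← hse2] at hlow
    set s' := √(∑ i, w i ^ 2 * ((M i (y i) - Δ i) - (∑ j ∈ nb i, (M j (y j) - Δ j)) / R) ^ 2) with hs'
    have hs'2 : s' ^ 2 = ∑ i, w i ^ 2 * ((M i (y i) - Δ i) -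
        (∑ j ∈ nb i, (M j (y j) - Δ j)) / R) ^ 2 :=
      Real.sq_sqrt (Finset.sum_nonneg fun i _ => by positivity)
    -- Each fold splits into a part centred given the data outside the fold and its conditional
    -- mean.
    have hfs : ∑ i, w i * Δ i = ∑ k, (∑ i with s i = k, w i * (g k (fun j => y j) (y i) -
        ∫ z, g k (fun j => y j) z ∂(ν i)) + ∑ i with s i = k, w i * ∫ z, g k (fun j => y j) z ∂(ν i)) := by
      rw [← Finset.sum_fiberwise Finset.univ s]
      refine Finset.sum_congr rfl fun k _ => ?_
      rw [← Finset.sum_add_distrib]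
      refine Finset.sum_congr rfl fun i hi => ?_
      obtain ⟨-, rfl⟩ := Finset.mem_filter.1 hi
      ring
    have hfsb : |∑ i, w i * Δ i| ≤ 2 * S * t / √N := by
      rw [hfs]
      refine (Finset.abs_sum_le_sum_abs _ _).trans
        ((Finset.sum_le_sum fun k _ => (abs_add_le _ _).trans (add_le_add (n3' k) (hy k).2)).trans_eq ?_)
      rw [Finset.sum_const, Finset.card_univ, Fintype.card_fin, nsmul_eq_mul]
      ring
    refine n5 (le_abs_of_notMem_bias_aware h0 h1 hse0 hδ1 (by rw [hs'2]; exact hlow)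
      (Real.sqrt_nonneg _) hδ.le hb (T := ∑ i, w i * (M i (y i) - Δ i)) (τ := τ) ?_ hfsb
      (hcov _ _ rfl rfl))
    have e1 : ∑ i, w i * M i (y i) = ∑ i, w i * (μ i + e i (y i)) := by
      refine Finset.sum_congr rfl fun i _ => ?_
      by_cases hw : w i = 0
      · simp [hw]
      · rw [h.eq i (h.support i hw)]
    simp only [mul_sub, Finset.sum_sub_distrib]
    rw [e1]
    simp only [mul_add, Finset.sum_add_distrib]
    ring
  · have hun : ∀ (A : Fin S → Set (ι → E)) (x : ℝ),
        (∀ k, Measure.pi ν (A k) ≤ ENNReal.ofReal x) →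
        Measure.pi ν (⋃ k, A k) ≤ ENNReal.ofReal (S * x) := fun A x hA => by
      refine (measure_iUnion_fintype_le _ _).trans ((Finset.sum_le_sum fun k _ => hA k).trans_eq ?_)
      rw [Finset.sum_const, Finset.card_univ, Fintype.card_fin, nsmul_eq_mul,
        ENNReal.ofReal_mul (by positivity), ENNReal.ofReal_natCast]
    have hz00 : 0 ≤ absNormalQuantile γ 0 := absNormalQuantile_nonneg (by linarith) _
    refine ((measure_union_le _ _).trans (add_le_add ((measure_union_le _ _).trans (add_le_add
      ((measure_union_le _ _).trans (add_le_add ((measure_union_le _ _).trans (add_le_add b1 b2))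
        (hun _ _ b3))) (hun _ _ b4))) b5)).trans_eq ?_
    have g0 : 0 ≤ 1 - γ := by linarith
    rw [← ENNReal.ofReal_add (by positivity) (by positivity),
      ← ENNReal.ofReal_add (by positivity) (by positivity),
      ← ENNReal.ofReal_add (by positivity) (by positivity),
      ← ENNReal.ofReal_add (by positivity) (by positivity)]
    congr 1
    ring

end ConditionalModel

/-- Given the running variable, the bias-aware interval undercovers by at most `d` once the
first-stage errors are small and the effective sample size is large. -/
lemma exists_noncoverage_le {γ : ℝ} (h0 : 1 / 2 ≤ γ) (h1 : γ < 1) {C Cw W B Kb : ℝ} (hC : 0 < C)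
    (hCw : 0 < Cw) (hW : 0 ≤ W) (hB : 0 ≤ B) (hKb : 0 ≤ Kb) (S : ℕ) {R : ℕ} (hR : 1 ≤ R) {d : ℝ}
    (hd : 0 < d) :
    ∃ ε > 0, ∃ N₀ > 0, ∀ {ι E : Type} [Fintype ι] [DecidableEq ι] [MeasurableSpace E]
      {ν : ι → Measure E} [∀ i, IsProbabilityMeasure (ν i)] {M e : ι → E → ℝ} {w μ : ι → ℝ}
      {J : Finset ι} {nb : ι → Finset ι} {N : ℝ}, N₀ ≤ N →
      ConditionalModel ν M e w μ J nb R W Cw C B N ε → ∀ (s : ι → Fin S)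
      {g : (k : Fin S) → ({i // i ∈ Finset.univ.filter fun i => s i ≠ k} → E) → E → ℝ},
      (∀ k, Measurable fun p : ({i // i ∈ Finset.univ.filter fun i => s i ≠ k} → E) × E =>
        g k p.1 p.2) → ∀ {b τ : ℝ}, 0 ≤ b → b ≤ Kb / √N → |∑ i, w i * μ i - τ| ≤ b + ε / √N →
      Measure.pi ν {y | (∀ k, (∀ i ∈ J, ∫⁻ z, ENNReal.ofReal (g k (fun j => y j) z ^ 2) ∂(ν i) ≤
        ENNReal.ofReal (ε ^ 4)) ∧
        |∑ i with s i = k, w i * ∫ z, g k (fun j => y j) z ∂(ν i)| ≤ ε / √N) ∧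
      ∀ T s', T = ∑ i, w i * (M i (y i) - g (s i) (fun j => y j) (y i)) →
      s' = √(∑ i, w i ^ 2 * ((M i (y i) - g (s i) (fun j => y j) (y i)) -
        (∑ j ∈ nb i, (M j (y j) - g (s j) (fun j => y j) (y j))) / R) ^ 2) →
      τ ∉ Icc (T - absNormalQuantile γ (b / s') * s') (T + absNormalQuantile γ (b / s') * s')} ≤
      ENNReal.ofReal (1 - γ + d) := by
  set c₀ := √(1 / (C * Cw))
  have hc₀ : 0 < c₀ := Real.sqrt_pos.2 (by positivity)
  have hc₀' : c₀ ^ 2 = 1 / (C * Cw) := Real.sq_sqrt (by positivity)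
  set Z := absNormalQuantile γ 0 + Kb / c₀ with hZ
  have hZ0 : 0 ≤ Z := add_nonneg (absNormalQuantile_nonneg (by linarith) _) (by positivity)
  -- `Z` bounds the critical value, so the loss δ Z from the estimated standard error is at most d /
  -- 16.
  set δ := min (1 / 2) (d / (16 * (Z + 1))) with hδ
  have hδ0 : 0 < δ := lt_min (by norm_num) (by positivity)
  have hδ1 : δ < 1 := (min_le_left _ _).trans_lt (by norm_num)
  have hδZ : δ * Z ≤ d / 16 := by
    calc δ * Z ≤ d / (16 * (Z + 1)) * (Z + 1) :=
          mul_le_mul (min_le_right _ _) (by linarith) hZ0 (by positivity)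
      _ = d / 16 := by field_simp
  obtain ⟨Mc, hMc, hclt⟩ := CenteredNoise.exists_abs_sum_tail_le (d / 16) (by positivity)
  set m := δ * (1 - δ) * (1 / (C * Cw)) with hm
  have hm0 : 0 < m := mul_pos (mul_pos hδ0 (by linarith)) (by positivity)
  have ev1 : ∀ᶠ ε in 𝓝[>] (0 : ℝ), 3 * ε +
      2 / δ * (ε ^ 2 * (Cw * W ^ 2) + 6 * W ^ 2 * (S * ε ^ 2)) < m / 2 := by
    have hc : Continuous fun ε : ℝ => 3 * ε +
      2 / δ * (ε ^ 2 * (Cw * W ^ 2) + 6 * W ^ 2 * (S * ε ^ 2)) := by fun_prop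
    refine (hc.tendsto 0).mono_left nhdsWithin_le_nhds |>.eventually_lt_const ?_
    simpa using hm0
  have ev2 : ∀ᶠ ε in 𝓝[>] (0 : ℝ), 2 * (2 * S * ε / c₀ + 2 * (ε / c₀)) +
      S * Cw * (W ^ 2 + 1) * ε ^ 2 < d / 4 := by
    have hc : Continuous fun ε : ℝ => 2 * (2 * S * ε / c₀ + 2 * (ε / c₀)) +
      S * Cw * (W ^ 2 + 1) * ε ^ 2 := by fun_prop
    refine (hc.tendsto 0).mono_left nhdsWithin_le_nhds |>.eventually_lt_const ?_
    simpa using hd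
  -- With δ fixed, ε beats the terms free of N; `N₀` then beats, for this ε, the terms that vanish
  -- as N grows.
  obtain ⟨ε, ⟨hε1, hε2⟩, hε⟩ := ((ev1.and ev2).and self_mem_nhdsWithin).exists
  replace hε : 0 < ε := hε
  have ev3 : ∀ᶠ N : ℝ in atTop, 2 * R * W ^ 2 * (1 + B) / N < m / 2 :=
    (tendsto_const_nhds.div_atTop tendsto_id).eventually_lt_const (by positivity)
  have ev4 : ∀ᶠ N : ℝ in atTop, (Cw * W ^ 4 * B + 2 * (1 + B) ^ 2 * Cw * W ^ 4) / (N * ε ^ 2) +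
      Mc * Cw * W ^ 3 * (1 + B) ^ 2 / (c₀ ^ 3 * √N) < d / 4 := by
    have t1 : Tendsto (fun N : ℝ => (Cw * W ^ 4 * B + 2 * (1 + B) ^ 2 * Cw * W ^ 4) / (N * ε ^ 2))
        atTop (𝓝 0) :=
      tendsto_const_nhds.div_atTop (tendsto_id.atTop_mul_const (by positivity))
    have t2 : Tendsto (fun N : ℝ => Mc * Cw * W ^ 3 * (1 + B) ^ 2 / (c₀ ^ 3 * √N)) atTop (𝓝 0) :=
      tendsto_const_nhds.div_atTop
        (Real.tendsto_sqrt_atTop.const_mul_atTop (by positivity))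
    have := t1.add t2
    rw [add_zero] at this
    exact this.eventually_lt_const (by positivity)
  obtain ⟨N₀, hN₀⟩ := eventually_atTop.1 (ev3.and ev4)
  refine ⟨ε, hε, max N₀ 1, by positivity, ?_⟩
  intro ι E _ _ _ ν _ M e w μ J nb N hN h s g hg b τ hb hbK hbias
  obtain ⟨hn3, hn4⟩ := hN₀ N ((le_max_left _ _).trans hN)
  have hN0 : 0 < N := lt_of_lt_of_le one_pos ((le_max_right _ _).trans hN)
  refine (h.noncoverage_le hR hC hCw hW hB hN0 h0 h1 hδ0 hδ1 (d' := d / 16) (Mc := Mc) hε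
    (by positivity) hMc hc₀ hc₀' (fun hse hv u β => hclt h.noise hB h.weight h.support hse hv u β)
    (by linarith) s hg hb hbK hbias).trans (ENNReal.ofReal_le_ofReal ?_)
  linarith

/-! ### Regular designs -/

/-- Units in the estimation window. -/
def window (b : ℝ) {n : ℕ} (x : Fin n → ℝ) : Finset (Fin n) := Finset.univ.filter fun i => |x i| ≤ b

lemma mem_window {b : ℝ} {n : ℕ} {x : Fin n → ℝ} {i : Fin n} : i ∈ window b x ↔ |x i| ≤ b := by
  simp [window]

/-- Bounds for local linear weights at effective sample size `N`. -/
structure WeightBounds (K : ℝ → ℝ) (b W C N : ℝ) {n : ℕ} (x : Fin n → ℝ) : Prop where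
  det : ∀ p, 0 < kDet K b (side p) x
  first : ∀ p, |kMoment K b (side p) 1 x 1| / kDet K b (side p) x ≤ W / N
  second : ∀ p, |kMoment K b (side p) 1 x 2| / kDet K b (side p) x ≤ W / N
  weight : ∀ p i, |sideWeight K b (side p) (0 : Fin (1 + 1)) x i| ≤ W / N
  card : ((window b x).card : ℝ) ≤ C * N

namespace WeightBounds

variable {K : ℝ → ℝ} {b W C N : ℝ} {n : ℕ} {x : Fin n → ℝ}

lemma mem_window_of_ne_zero (hb : 0 < b) (hK : ∀ u, u ∉ Icc (-1 : ℝ) 1 → K u = 0) {p : Bool}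
    {i : Fin n} (h : sideWeight K b (side p) (0 : Fin (1 + 1)) x i ≠ 0) : i ∈ window b x :=
  mem_window.2 (sideWeight_eq_zero (isCone_side p) hb hK h).2

lemma sideWeight_zero_or (hb : 0 < b) (hK : ∀ u, u ∉ Icc (-1 : ℝ) 1 → K u = 0) (i : Fin n) :
    sideWeight K b (side true) (0 : Fin (1 + 1)) x i = 0 ∨
      sideWeight K b (side false) (0 : Fin (1 + 1)) x i = 0 := by
  by_contra! hcon
  have h1 : 0 ≤ x i := (sideWeight_eq_zero (isCone_side true) hb hK hcon.1).1
  have h2 : x i < 0 := (sideWeight_eq_zero (isCone_side false) hb hK hcon.2).1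
  linarith

lemma rdWeight_eq (i : Fin n) : rdWeight K b (0 : Fin (1 + 1)) x i =
    sideWeight K b (side true) (0 : Fin (1 + 1)) x i -
      sideWeight K b (side false) (0 : Fin (1 + 1)) x i := rfl

lemma rdWeight_sq (hb : 0 < b) (hK : ∀ u, u ∉ Icc (-1 : ℝ) 1 → K u = 0) (i : Fin n) :
    rdWeight K b (0 : Fin (1 + 1)) x i ^ 2 = sideWeight K b (side true) (0 : Fin (1 + 1)) x i ^ 2 +
      sideWeight K b (side false) (0 : Fin (1 + 1)) x i ^ 2 := by
  rw [rdWeight_eq]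
  rcases sideWeight_zero_or (x := x) hb hK i with h | h <;> rw [h] <;> ring

lemma abs_rdWeight_le (h : WeightBounds K b W C N x) (hb : 0 < b)
    (hK : ∀ u, u ∉ Icc (-1 : ℝ) 1 → K u = 0) (i : Fin n) :
    |rdWeight K b (0 : Fin (1 + 1)) x i| ≤ W / N := by
  rw [rdWeight_eq]
  rcases sideWeight_zero_or (x := x) hb hK i with h0 | h0 <;> rw [h0]
  · rw [zero_sub, abs_neg]; exact h.weight _ i
  · rw [sub_zero]; exact h.weight _ i

lemma mem_window_of_rdWeight_ne_zero (hb : 0 < b) (hK : ∀ u, u ∉ Icc (-1 : ℝ) 1 → K u = 0)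
    (i : Fin n) (h : rdWeight K b (0 : Fin (1 + 1)) x i ≠ 0) : i ∈ window b x := by
  by_contra hcon
  refine h ?_
  rw [rdWeight_eq, not_imp_comm.1 (mem_window_of_ne_zero hb hK) hcon,
    not_imp_comm.1 (mem_window_of_ne_zero hb hK) hcon, sub_zero]

lemma sum_abs_le (h : WeightBounds K b W C N x) (hb : 0 < b) (hN : 0 < N) (hW : 0 ≤ W)
    (hK : ∀ u, u ∉ Icc (-1 : ℝ) 1 → K u = 0) (p : Bool) :
    ∑ i, |sideWeight K b (side p) (0 : Fin (1 + 1)) x i| ≤ C * W := by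
  have e : ∑ i, |sideWeight K b (side p) (0 : Fin (1 + 1)) x i| =
      ∑ i ∈ window b x, |sideWeight K b (side p) (0 : Fin (1 + 1)) x i| := by
    refine (Finset.sum_subset (Finset.subset_univ _) fun i _ hi => ?_).symm
    rw [not_imp_comm.1 (mem_window_of_ne_zero hb hK) hi, abs_zero]
  rw [e]
  refine (Finset.sum_le_sum fun i _ => h.weight p i).trans ?_
  rw [Finset.sum_const, nsmul_eq_mul]
  refine (mul_le_mul_of_nonneg_right h.card (by positivity)).trans_eq ?_
  field_simp

/-- The weights on the right sum to one over at most C N units, so Cauchy–Schwarz bounds their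
squared norm from below. -/
lemma sum_sq_ge (h : WeightBounds K b W C N x) (hb : 0 < b) (hC : 0 < C) (hN : 0 < N)
    (hK : ∀ u, u ∉ Icc (-1 : ℝ) 1 → K u = 0) :
    1 / (C * N) ≤ ∑ i, rdWeight K b (0 : Fin (1 + 1)) x i ^ 2 := by
  set w := sideWeight K b (side true) (0 : Fin (1 + 1)) x
  have h1 : ∑ i ∈ window b x, w i = 1 := by
    rw [← sum_sideWeight (isCone_side true) hb (h.det true).ne']
    refine Finset.sum_subset (Finset.subset_univ _) fun i _ hi => ?_
    exact not_imp_comm.1 (mem_window_of_ne_zero hb hK) hi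
  have h2 := sq_sum_le_card_mul_sum_sq (s := window b x) (f := w)
  rw [h1, one_pow] at h2
  rw [div_le_iff₀' (by positivity)]
  refine h2.trans (mul_le_mul h.card ?_ (Finset.sum_nonneg fun _ _ => sq_nonneg _) (by positivity))
  refine (Finset.sum_le_sum_of_subset_of_nonneg (Finset.subset_univ _)
    fun _ _ _ => sq_nonneg _).trans (Finset.sum_le_sum fun i _ => ?_)
  rw [rdWeight_sq hb hK]
  exact le_add_of_nonneg_right (sq_nonneg _)

lemma abs_kCurv_le (h : WeightBounds K b W C N x) (hb : 0 < b) (hN : 0 < N) (hW : 0 ≤ W)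
    (hK : ∀ u, u ∉ Icc (-1 : ℝ) 1 → K u = 0) (p : Bool) :
    |kCurv K b (side p) x| ≤ C * W := by
  rw [← sum_sideWeight_mul_sq (isCone_side p) hb]
  refine (Finset.abs_sum_le_sum_abs _ _).trans
    ((Finset.sum_le_sum fun i _ => ?_).trans (h.sum_abs_le hb hN hW hK p))
  rw [abs_mul]
  by_cases hw : sideWeight K b (side p) (0 : Fin (1 + 1)) x i = 0
  · simp [hw]
  have := (sideWeight_eq_zero (isCone_side p) hb hK hw).2
  refine mul_le_of_le_one_right (abs_nonneg _) ?_
  rw [abs_pow, abs_div, abs_of_pos hb]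
  exact pow_le_one₀ (by positivity) ((div_le_one hb).2 this)

/-- Cauchy–Schwarz for the moments 1, 2, 3. The common sign keeps the two sides from cancelling in
the worst-case bias, which is therefore nonnegative for a nonnegative curvature bound. -/
lemma kCurv_nonpos (h : WeightBounds K b W C N x) (hK0 : ∀ u, 0 ≤ K u) (p : Bool) :
    kCurv K b (side p) x ≤ 0 := by
  refine div_nonpos_of_nonpos_of_nonneg (sub_nonpos.2 ?_) (h.det p).le
  cases p
  · refine kMoment_sq_le hK0 (ε := -1) (by norm_num) fun u hu => ?_
    have : u < 0 := hu
    linarith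
  · refine kMoment_sq_le hK0 (ε := 1) (by norm_num) fun u hu => ?_
    have : 0 ≤ u := hu
    linarith

/-- The worst-case bias in terms of the curvature weights of the two sides. -/
lemma bias_sum_eq (hb : 0 < b) (hK : ∀ u, u ∉ Icc (-1 : ℝ) 1 → K u = 0) :
    ∑ i, rdWeight K b (0 : Fin (1 + 1)) x i * x i ^ 2 * Real.sign (x i) =
      b ^ 2 * (kCurv K b (side true) x + kCurv K b (side false) x) := by
  rw [← sum_sideWeight_mul_sq (isCone_side true) hb, ← sum_sideWeight_mul_sq (isCone_side false) hb,
    ← Finset.sum_add_distrib, Finset.mul_sum]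
  refine Finset.sum_congr rfl fun i _ => ?_
  have e : b ^ 2 * (sideWeight K b (side true) (0 : Fin (1 + 1)) x i * (x i / b) ^ 2 +
      sideWeight K b (side false) (0 : Fin (1 + 1)) x i * (x i / b) ^ 2) =
      (sideWeight K b (side true) (0 : Fin (1 + 1)) x i +
      sideWeight K b (side false) (0 : Fin (1 + 1)) x i) * x i ^ 2 := by
    field_simp
  rw [e, rdWeight_eq]
  rcases lt_trichotomy (x i) 0 with h0 | h0 | h0
  · have : sideWeight K b (side true) (0 : Fin (1 + 1)) x i = 0 := by
      by_contra hw
      have : 0 ≤ x i := (sideWeight_eq_zero (isCone_side true) hb hK hw).1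
      linarith
    rw [this, Real.sign_of_neg h0]; ring
  · rw [h0]; simp
  · have : sideWeight K b (side false) (0 : Fin (1 + 1)) x i = 0 := by
      by_contra hw
      have : x i < 0 := (sideWeight_eq_zero (isCone_side false) hb hK hw).1
      linarith
    rw [this, Real.sign_of_pos h0]; ring

/-- Bias of the local linear regression of a function with one-sided quadratic expansions. -/
lemma abs_bias_le (h : WeightBounds K b W C N x) (hb : 0 < b) (hN : 0 < N) (hW : 0 ≤ W)
    (hK0 : ∀ u, 0 ≤ K u)
    (hK : ∀ u, u ∉ Icc (-1 : ℝ) 1 → K u = 0) (hx : ∀ i, x i ≠ 0) {f : ℝ → ℝ}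
    {L Cm BY κ a₁ b₁ c₁ a₂ b₂ c₂ m : ℝ} (hL : 0 ≤ L)
    (h1 : ∀ t, 0 < t → t ≤ b → |f t - (a₁ + b₁ * t + c₁ / 2 * t ^ 2)| ≤ L * |t| ^ 3)
    (h2 : ∀ t, t < 0 → -b ≤ t → |f t - (a₂ + b₂ * t + c₂ / 2 * t ^ 2)| ≤ L * |t| ^ 3)
    (hc₁ : |c₁ + m| ≤ BY) (hc₂ : |c₂ + m| ≤ BY) (hm : |m| ≤ Cm)
    (hκ : |kCurv K b (side true) x - kCurv K b (side false) x| ≤ κ) :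
    |∑ i, rdWeight K b (0 : Fin (1 + 1)) x i * f (x i) - (a₁ - a₂)| ≤
      -(BY / 2) * ∑ i, rdWeight K b (0 : Fin (1 + 1)) x i * x i ^ 2 * Real.sign (x i) +
        (Cm * κ / 2 + 2 * L * b * (C * W)) * b ^ 2 := by
  rw [bias_sum_eq hb hK]
  set k₁ := kCurv K b (side true) x
  set k₂ := kCurv K b (side false) x
  have hk₁ : k₁ ≤ 0 := h.kCurv_nonpos hK0 true
  have hk₂ : k₂ ≤ 0 := h.kCurv_nonpos hK0 false
  have hpow : ∀ t, |t| ≤ b → L * |t| ^ 3 ≤ L * b ^ 3 := fun t ht =>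
    mul_le_mul_of_nonneg_left (pow_le_pow_left₀ (abs_nonneg _) ht 3) hL
  have q1 := abs_sum_sideWeight_quadratic_le (x := x) (K := K) (g := f) (α₀ := a₁) (α₁ := b₁)
    (α₂ := c₁) (r := L * b ^ 3) (G := {0}ᶜ) (isCone_side true) hb (h.det true).ne' hK hx
    (fun t ht htb => by
      have h0 : 0 ≤ t := ht.1
      have h0' : 0 < t := lt_of_le_of_ne h0 (Ne.symm ht.2)
      exact (h1 t h0' (le_of_abs_le htb)).trans (hpow t htb))
  have q2 := abs_sum_sideWeight_quadratic_le (x := x) (K := K) (g := f) (α₀ := a₂) (α₁ := b₂)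
    (α₂ := c₂) (r := L * b ^ 3) (G := {0}ᶜ) (isCone_side false) hb (h.det false).ne' hK hx
    (fun t ht htb => (h2 t ht.1 (neg_le_of_abs_le htb)).trans (hpow t htb))
  have hLb : 0 ≤ L * b ^ 3 := by positivity
  have s1 := mul_le_mul_of_nonneg_left (h.sum_abs_le hb hN hW hK true) hLb
  have s2 := mul_le_mul_of_nonneg_left (h.sum_abs_le hb hN hW hK false) hLb
  simp only [rdWeight_eq, sub_mul, Finset.sum_sub_distrib]
  set X₁ := ∑ i, sideWeight K b (side true) (0 : Fin (1 + 1)) x i * f (x i)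
  set X₂ := ∑ i, sideWeight K b (side false) (0 : Fin (1 + 1)) x i * f (x i)
  have r1 := abs_le.1 (q1.trans s1)
  have r2 := abs_le.1 (q2.trans s2)
  have b2 : 0 ≤ b ^ 2 / 2 := by positivity
  -- The bound `BY` concerns c + m. Replacing c by c + m on both sides costs m (k₁ - k₂), controlled
  -- by κ; the remainder is at most -BY (k₁ + k₂) because both factors are nonpositive.
  have hkey : |c₁ * k₁ - c₂ * k₂| ≤ -BY * (k₁ + k₂) + Cm * κ := by
    have e : c₁ * k₁ - c₂ * k₂ = (c₁ + m) * k₁ - (c₂ + m) * k₂ - m * (k₁ - k₂) := by ring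
    rw [e]
    have t1 : |(c₁ + m) * k₁| ≤ BY * -k₁ := by
      rw [abs_mul, abs_of_nonpos hk₁]; exact mul_le_mul_of_nonneg_right hc₁ (by linarith)
    have t2 : |(c₂ + m) * k₂| ≤ BY * -k₂ := by
      rw [abs_mul, abs_of_nonpos hk₂]; exact mul_le_mul_of_nonneg_right hc₂ (by linarith)
    have t3 : |m * (k₁ - k₂)| ≤ Cm * κ := by
      rw [abs_mul]; exact mul_le_mul hm hκ (abs_nonneg _) ((abs_nonneg _).trans hm)
    have t4 := abs_sub ((c₁ + m) * k₁ - (c₂ + m) * k₂) (m * (k₁ - k₂))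
    have t5 := abs_sub ((c₁ + m) * k₁) ((c₂ + m) * k₂)
    linarith
  have hk := abs_le.1 hkey
  have m1 := mul_le_mul_of_nonneg_left hk.1 b2
  have m2 := mul_le_mul_of_nonneg_left hk.2 b2
  rw [abs_le]
  constructor <;> nlinarith

/-- Weighted averages over a fold of a function with a common linear expansion at the cutoff. -/
lemma abs_fold_sum_le (h : WeightBounds K b W C N x) (hb : 0 < b) (hN : 0 < N) (hW : 0 ≤ W)
    (hK : ∀ u, u ∉ Icc (-1 : ℝ) 1 → K u = 0) (hx : ∀ i, x i ≠ 0) {S : ℕ} {s : Fin n → Fin S}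
    {k : Fin S} {ρ : ℝ}
    (hfold : ∀ (p : Bool), ∀ m < 3, |kMoment K b (side p) (foldInd s k) x m / N -
      foldShare s k * (kMoment K b (side p) 1 x m / N)| ≤ ρ) {f : ℝ → ℝ} {v α₀ α₁ : ℝ}
    (h₀ : |α₀| ≤ v) (h₁ : |α₁| ≤ v)
    (hf : ∀ t, t ≠ 0 → |t| ≤ b → |f t - (α₀ + α₁ * t)| ≤ v * t ^ 2) :
    |∑ i with s i = k, rdWeight K b (0 : Fin (1 + 1)) x i * f (x i)| ≤
      v * (4 * W * ρ * (1 + b) + 2 * (C * W) * b ^ 2) := by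
  have hv : 0 ≤ v := (abs_nonneg _).trans h₀
  have hpow : ∀ t, |t| ≤ b → v * t ^ 2 ≤ v * b ^ 2 := fun t ht => by
    rw [← sq_abs]; exact mul_le_mul_of_nonneg_left (pow_le_pow_left₀ (abs_nonneg _) ht 2) hv
  have q := fun p : Bool => abs_sum_mul_sideWeight_linear_le (x := x) (K := K) (g := f) (α₀ := α₀)
    (α₁ := α₁) (r := v * b ^ 2) (G := {0}ᶜ) (isCone_side p) hb hK (a := foldInd s k)
    (fun i => by unfold foldInd; split_ifs <;> simp) hx
    (fun t ht htb => (hf t ht.2 htb).trans (hpow t htb))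
  have d := fun p : Bool => abs_sum_mul_sideWeight_sub_le (isCone_side p) hb (h.det p) hN (h.first p)
    (h.second p) (hfold p)
  have sb := fun p : Bool => mul_le_mul_of_nonneg_left (h.sum_abs_le hb hN hW hK p)
    (by positivity : 0 ≤ v * b ^ 2)
  have e : ∑ i with s i = k, rdWeight K b (0 : Fin (1 + 1)) x i * f (x i) =
      ∑ i, foldInd s k i * (sideWeight K b (side true) (0 : Fin (1 + 1)) x i * f (x i)) -
      ∑ i, foldInd s k i * (sideWeight K b (side false) (0 : Fin (1 + 1)) x i * f (x i)) := by
    rw [← Finset.sum_sub_distrib, Finset.sum_filter]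
    refine Finset.sum_congr rfl fun i _ => ?_
    rw [rdWeight_eq]
    unfold foldInd
    split_ifs <;> ring
  rw [e]
  set X := fun p : Bool => ∑ i, foldInd s k i *
    (sideWeight K b (side p) (0 : Fin (1 + 1)) x i * f (x i))
  set Y := fun p : Bool => ∑ i, foldInd s k i * sideWeight K b (side p) (0 : Fin (1 + 1)) x i
  set Z := fun p : Bool => ∑ i, foldInd s k i *
    (sideWeight K b (side p) (0 : Fin (1 + 1)) x i * (x i / b))
  show |X true - X false| ≤ _
  have q' : ∀ p, |X p - (α₀ * Y p + α₁ * b * Z p)| ≤ v * b ^ 2 * (C * W) := fun p =>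
    (q p).trans (sb p)
  have y' : ∀ p, |Y p - foldShare s k| ≤ 2 * W * ρ := fun p => (d p).1
  have z' : ∀ p, |Z p| ≤ 2 * W * ρ := fun p => (d p).2
  -- Both sides carry nearly the same share of the fold and see the same intercept, so the intercept
  -- cancels up to deviations of order ρ; the slope meets sums that are themselves of order ρ.
  have e2 : X true - X false = (X true - (α₀ * Y true + α₁ * b * Z true)) -
      (X false - (α₀ * Y false + α₁ * b * Z false)) +
      (α₀ * ((Y true - foldShare s k) - (Y false - foldShare s k)) +
        α₁ * (b * (Z true - Z false))) := by ring
  rw [e2]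
  have t1 : |α₀ * ((Y true - foldShare s k) - (Y false - foldShare s k))| ≤ v * (4 * W * ρ) := by
    rw [abs_mul]
    refine mul_le_mul h₀ ((abs_sub _ _).trans ?_) (abs_nonneg _) hv
    linarith [y' true, y' false]
  have t2 : |α₁ * (b * (Z true - Z false))| ≤ v * (b * (4 * W * ρ)) := by
    rw [abs_mul, abs_mul, abs_of_pos hb]
    refine mul_le_mul h₁ (mul_le_mul_of_nonneg_left ((abs_sub _ _).trans ?_) hb.le)
      (by positivity) hv
    linarith [z' true, z' false]
  refine (abs_add_le _ _).trans ((add_le_add ((abs_sub _ _).trans (add_le_add (q' true) (q' false)))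
    ((abs_add_le _ _).trans (add_le_add t1 t2))).trans_eq ?_)
  ring

end WeightBounds

section DesignBounds

variable {D : RDDesign} {K : ℝ → ℝ} {h : ℕ → ℝ}

lemma GoodDesign.moment_side {b η ρ C : ℝ} {S n : ℕ} {s : Fin n → Fin S} {x : Fin n → ℝ}
    (hG : GoodDesign D K b η ρ C s x) {η' : ℝ} (hη : η ≤ η') (p : Bool) (m : Fin 4) :
    |kMoment K b (side p) 1 x m / (n * b) - limitMoment D K p m| < η' :=
  (hG.moment p m).trans_le hη

lemma exists_weightBounds (hReg : Regularity D h K) : ∃ W > 0, ∃ η₀ > 0, ∀ {b η ρ C : ℝ} {S n : ℕ}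
    {s : Fin n → Fin S} {x : Fin n → ℝ}, GoodDesign D K b η ρ C s x → 0 < b → 0 < (n : ℝ) * b →
    η ≤ η₀ → WeightBounds K b W C (n * b) x := by
  obtain ⟨k, hk⟩ := hReg.kernel_bounded
  obtain ⟨W₁, hW₁, η₁, hη₁, H₁⟩ := exists_sideWeight_bound (limitMoment D K true)
    (limitMoment_det_pos hReg true) k
  obtain ⟨W₂, hW₂, η₂, hη₂, H₂⟩ := exists_sideWeight_bound (limitMoment D K false)
    (limitMoment_det_pos hReg false) k
  refine ⟨max W₁ W₂, by positivity, min η₁ η₂, by positivity, ?_⟩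
  intro b η ρ C S n s x hG hb hN hη
  have h1 := H₁ (isCone_side true) hb hReg.kernel_nonneg hk hReg.kernel_zero hN
    (hG.moment_side (hη.trans (min_le_left _ _)) true)
  have h2 := H₂ (isCone_side false) hb hReg.kernel_nonneg hk hReg.kernel_zero hN
    (hG.moment_side (hη.trans (min_le_right _ _)) false)
  have m1 : W₁ / (n * b) ≤ max W₁ W₂ / (n * b) := div_le_div_of_nonneg_right (le_max_left _ _) hN.le
  have m2 : W₂ / (n * b) ≤ max W₁ W₂ / (n * b) := div_le_div_of_nonneg_right (le_max_right _ _) hN.le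
  refine ⟨fun p => ?_, fun p => ?_, fun p => ?_, fun p i => ?_, hG.window⟩ <;> cases p
  exacts [h2.1, h1.1, h2.2.1.trans m2, h1.2.1.trans m1, h2.2.2.1.trans m2, h1.2.2.1.trans m1,
    (h2.2.2.2 i).trans m2, (h1.2.2.2 i).trans m1]

lemma exists_kCurv_sub_le (hReg : Regularity D h K) {ε : ℝ} (hε : 0 < ε) : ∃ η₀ > 0,
    ∀ {b η ρ C : ℝ} {S n : ℕ}
    {s : Fin n → Fin S} {x : Fin n → ℝ}, GoodDesign D K b η ρ C s x → 0 < (n : ℝ) * b →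
    η ≤ η₀ → |kCurv K b (side true) x - kCurv K b (side false) x| ≤ ε := by
  obtain ⟨η₁, hη₁, H₁⟩ := exists_kCurv_close (limitMoment D K true)
    (limitMoment_det_pos hReg true) (half_pos hε)
  obtain ⟨η₂, hη₂, H₂⟩ := exists_kCurv_close (limitMoment D K false)
    (limitMoment_det_pos hReg false) (half_pos hε)
  refine ⟨min η₁ η₂, by positivity, ?_⟩
  intro b η ρ C S n s x hG hN hη
  have h1 := H₁ hN (hG.moment_side (hη.trans (min_le_left _ _)) true)
  have h2 := H₂ hN (hG.moment_side (hη.trans (min_le_right _ _)) false)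
  rw [limitMoment_curv_eq hReg] at h2
  rw [abs_lt] at h1 h2
  rw [abs_le]
  constructor <;> linarith

/-- Every unit has enough potential neighbours. -/
lemma eventually_card_neighbors (hReg : Regularity D h K) (R : ℕ) : ∃ η₀ > 0, ∀ᶠ n in atTop,
    ∀ {η ρ C : ℝ} {S : ℕ} {s : Fin n → Fin S} {x : Fin n → ℝ}, GoodDesign D K (h n) η ρ C s x →
    η ≤ η₀ → ∀ i, (neighbors R x i).card = R := by
  classical
  obtain ⟨k, hk⟩ := hReg.kernel_bounded
  have hf0 : 0 < D.fX 0 := (exists_fX_bound D hReg).2.1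
  have hl : ∀ p, 0 < limitMoment D K p 0 := fun p => mul_pos hf0 (sideInt_zero_pos hReg p)
  set l := min (limitMoment D K true 0) (limitMoment D K false 0) with hldef
  have hl0 : 0 < l := lt_min (hl _) (hl _)
  have hle : ∀ p, l ≤ limitMoment D K p 0 := fun p => by
    cases p
    exacts [min_le_right _ _, min_le_left _ _]
  refine ⟨l / 2, by positivity, ?_⟩
  filter_upwards [hReg.effective_size.eventually_ge_atTop ((R + 1) * (|k| + 1) / (l / 2)),
    hReg.effective_size.eventually_gt_atTop 0] with n hn hn0 η ρ C S s x hG hη i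
  refine card_neighbors hG.noTies i ?_
  obtain ⟨p, hp⟩ : ∃ p, ∀ j, x j ∈ side p → (0 ≤ x j ↔ 0 ≤ x i) := by
    rcases le_or_gt 0 (x i) with h0 | h0
    · exact ⟨true, fun j hj => ⟨fun _ => h0, fun _ => hj⟩⟩
    · exact ⟨false, fun j hj => ⟨fun hh => absurd hj (not_lt.2 hh), fun hh => absurd hh (not_le.2 h0)⟩⟩
  have hmom := (abs_lt.1 (hG.moment_side hη p 0)).1
  have h1 : l / 2 * (n * h n) ≤ kMoment K (h n) (side p) 1 x 0 := by
    have h2 : l / 2 ≤ kMoment K (h n) (side p) 1 x ((0 : Fin 4) : ℕ) / (n * h n) := by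
      linarith [hle p]
    rwa [le_div_iff₀ hn0] at h2
  set Q := Finset.univ.filter fun j => x j ∈ side p with hQ
  -- Each unit on the side adds at most |k| + 1 to a moment that grows like n h, so the side has at
  -- least R + 1 units, one of which may be `i` itself.
  have h3 : kMoment K (h n) (side p) 1 x 0 ≤ Q.card * (|k| + 1) := by
    have e : kMoment K (h n) (side p) 1 x 0 ≤ ∑ j, if x j ∈ side p then |k| + 1 else 0 := by
      refine Finset.sum_le_sum fun j _ => ?_
      rw [Pi.one_apply, one_mul, pow_zero, mul_one]
      by_cases hj : x j ∈ side p
      · rw [if_pos hj, indicator_of_mem ((isCone_side p _ (hReg.bandwidth_pos n) _).2 hj)]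
        linarith [hk (x j / h n), le_abs_self k]
      · rw [if_neg hj, indicator_of_notMem (mt (isCone_side p _ (hReg.bandwidth_pos n) _).1 hj)]
    refine e.trans_eq ?_
    rw [← Finset.sum_filter, Finset.sum_const, nsmul_eq_mul]
  have h4 : ((R + 1 : ℕ) : ℝ) ≤ Q.card := by
    rw [div_le_iff₀ (by positivity)] at hn
    have : (R + 1 : ℝ) * (|k| + 1) ≤ Q.card * (|k| + 1) := by linarith
    push_cast
    exact le_of_mul_le_mul_right this (by positivity)
  have h5 : R + 1 ≤ Q.card := by exact_mod_cast h4
  have h6 : Q.card - 1 ≤ (Q.erase i).card := Finset.pred_card_le_card_erase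
  have h7 : (Q.erase i).card ≤
      (Finset.univ.filter fun j => j ≠ i ∧ (0 ≤ x j ↔ 0 ≤ x i)).card := by
    refine Finset.card_le_card fun j hj => ?_
    obtain ⟨hj1, hj2⟩ := Finset.mem_erase.1 hj
    exact Finset.mem_filter.2 ⟨Finset.mem_univ _, hj1, hp j (Finset.mem_filter.1 hj2).2⟩
  omega

end DesignBounds

namespace RDDesign

variable (D : RDDesign)

open Classical in
/-- The regression error `M(η̄) - E[M(η̄) | X = x]`, set to zero outside of the window. -/
def windowError {n : ℕ} (η : D.Cov n → ℝ) (b x : ℝ) (p : ℝ × D.Cov n) : ℝ :=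
  if |x| ≤ b then D.adj η p - D.adjMean η x else 0

lemma measurable_adj {n : ℕ} {η : D.Cov n → ℝ} (hη : Measurable η) : Measurable (D.adj η) :=
  measurable_fst.sub (hη.comp measurable_snd)

end RDDesign

/-- The moment bound is available only on the window; a zero error elsewhere keeps every noise
variable centred with a bounded fourth moment. -/
lemma centeredNoise_windowError {D : RDDesign} {n : ℕ} {η : D.Cov n → ℝ} (hη : Measurable η) {b B : ℝ}
    {x : Fin n → ℝ} (hint : ∀ i, Integrable (D.adj η) (D.condLaw n (x i)))
    (h4 : ∀ i, |x i| ≤ b → ∫⁻ p, ENNReal.ofReal ((D.adj η p - D.adjMean η (x i)) ^ 4)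
      ∂(D.condLaw n (x i)) ≤ ENNReal.ofReal B) :
    CenteredNoise (fun i => D.condLaw n (x i)) (fun i => D.windowError η b (x i)) B where
  measurable i := by
    show Measurable fun p => D.windowError η b (x i) p
    by_cases hi : |x i| ≤ b
    · simp only [RDDesign.windowError, hi, if_true]
      exact (D.measurable_adj hη).sub measurable_const
    · simp only [RDDesign.windowError, hi, if_false]; exact measurable_const
  mean i := by
    by_cases hi : |x i| ≤ b
    · simp only [RDDesign.windowError, hi, if_true]
      rw [integral_sub (hint i) (integrable_const _)]
      simp [RDDesign.adjMean, RDDesign.condMean]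
    · simp [RDDesign.windowError, hi]
  fourth i := by
    by_cases hi : |x i| ≤ b
    · simpa only [RDDesign.windowError, hi, if_true] using h4 i hi
    · simp [RDDesign.windowError, hi]

lemma mul_pos_of_nonneg_iff {a b : ℝ} (ha : a ≠ 0) (hb : b ≠ 0) (h : 0 ≤ a ↔ 0 ≤ b) : 0 < a * b := by
  rcases lt_or_gt_of_ne ha with h1 | h1
  · have : b < 0 := not_le.1 fun hb' => absurd (h.2 hb') (not_le.2 h1)
    exact mul_pos_of_neg_of_neg h1 this
  · exact mul_pos h1 (lt_of_le_of_ne (h.1 h1.le) hb.symm)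

/-- Given a regular design, the outcomes follow the conditional model. -/
lemma conditionalModel_of_goodDesign {D : RDDesign} {K : ℝ → ℝ} {b η' ρ W Cw C B L t : ℝ} {S n R : ℕ}
    {s : Fin n → Fin S} {x : Fin n → ℝ} {η : D.Cov n → ℝ} (hG : GoodDesign D K b η' ρ Cw s x)
    (hWB : WeightBounds K b W Cw (n * b) x) (hb : 0 < b) (hN : 0 < (n : ℝ) * b) (hCw : 0 < Cw)
    (hK : ∀ u, u ∉ Icc (-1 : ℝ) 1 → K u = 0) (hη : Measurable η)
    (hint : ∀ x ∈ D.suppX, Integrable (D.adj η) (D.condLaw n x))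
    (h4 : ∀ x ∈ D.suppXh b, ∫⁻ p, ENNReal.ofReal ((D.adj η p - D.adjMean η x) ^ 4)
      ∂(D.condLaw n x) ≤ ENNReal.ofReal B)
    (hvar : ∀ x ∈ D.suppX \ {0}, 1 / C ≤ D.adjVar η x) (hcard : ∀ i, (neighbors R x i).card = R)
    (hlip : LipschitzEachSide L (D.adjMean η) (D.suppX \ {0})) (ht : |L| * (2 * b) ≤ t) :
    ConditionalModel (fun i => D.condLaw n (x i)) (fun _ => D.adj η)
      (fun i => D.windowError η b (x i)) (rdWeight K b (0 : Fin (1 + 1)) x)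
      (fun i => D.adjMean η (x i)) (window b x) (neighbors R x) R W Cw C B (n * b) t where
  noise := centeredNoise_windowError hη (fun i => hint _ (hG.mem i).1)
    fun i hi => h4 _ ⟨(hG.mem i).1, abs_le.1 hi⟩
  eq i hi z := by
    rw [mem_window] at hi
    simp only [RDDesign.windowError, hi, if_true]; ring
  var i hi := by
    rw [mem_window] at hi
    simp only [RDDesign.windowError, hi, if_true]
    exact hvar _ (hG.mem i)
  weight := hWB.abs_rdWeight_le hb hK
  support := WeightBounds.mem_window_of_rdWeight_ne_zero hb hK
  card := hWB.card
  weight_sq := hWB.sum_sq_ge hb hCw hN hK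
  nb_card i _ := hcard i
  nb_self i _ := fun h => (mem_neighbors_side h).1 rfl
  nb_rev := card_filter_mem_neighbors_le hG.noTies
  nb_out := by
    refine (Finset.card_le_card fun i hi => ?_).trans (card_filter_neighbors_outside_le (x := x) b)
    obtain ⟨h1, h2⟩ := Finset.mem_filter.1 hi
    obtain ⟨j, hj, hj'⟩ := Finset.not_subset.1 h2
    rw [mem_window] at h1 hj'
    exact Finset.mem_filter.2 ⟨Finset.mem_univ _, h1, j, hj, not_le.1 hj'⟩
  smooth i hi j hj hjw := by
    rw [mem_window] at hi hjw
    have hs := (mem_neighbors_side hj).2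
    refine (hlip _ (hG.mem i) _ (hG.mem j)
      (mul_pos_of_nonneg_iff (hG.mem i).2 (hG.mem j).2 hs.symm)).trans (le_trans ?_ ht)
    refine mul_le_mul (le_abs_self L) ?_ (abs_nonneg _) (abs_nonneg _)
    exact (abs_sub _ _).trans (by linarith)

/-! ### Measurability of the estimator and its standard error -/

section Measurability

variable {K : ℝ → ℝ} {b : ℝ} {n : ℕ}

lemma measurable_kMoment (hK : Measurable K) (p : Bool) (m : ℕ) :
    Measurable fun x : Fin n → ℝ => kMoment K b (side p) 1 x m := by
  unfold kMoment
  have := hK.indicator (measurableSet_side p)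
  fun_prop

lemma measurable_rdWeight (hK : Measurable K) (hb : 0 < b) (i : Fin n) :
    Measurable fun x : Fin n → ℝ => rdWeight K b (0 : Fin (1 + 1)) x i := by
  have h : ∀ p, Measurable fun x : Fin n → ℝ => sideWeight K b (side p) (0 : Fin (1 + 1)) x i := by
    intro p
    simp_rw [sideWeight_eq (isCone_side p) hb]
    have h0 := measurable_kMoment (n := n) (b := b) hK p 0
    have h1 := measurable_kMoment (n := n) (b := b) hK p 1
    have h2 := measurable_kMoment (n := n) (b := b) hK p 2
    have := hK.indicator (measurableSet_side p)
    fun_prop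
  exact (h true).sub (h false)

lemma measurableSet_mem_neighbors (R : ℕ) (i j : Fin n) :
    MeasurableSet {x : Fin n → ℝ | j ∈ neighbors R x i} := by
  classical
  have hx : ∀ k : Fin n, Measurable fun x : Fin n → ℝ => x k := measurable_pi_apply
  have hside : ∀ k : Fin n, MeasurableSet {x : Fin n → ℝ | 0 ≤ x k ↔ 0 ≤ x i} := fun k =>
    MeasurableSet.iff (measurableSet_le measurable_const (hx k))
      (measurableSet_le measurable_const (hx i))
  have hclose : ∀ k : Fin n, MeasurableSet {x : Fin n → ℝ | k ≠ i ∧ (0 ≤ x k ↔ 0 ≤ x i) ∧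
      |x k - x i| < |x j - x i|} := fun k =>
    (MeasurableSet.const _).inter ((hside k).inter (measurableSet_lt ((hx k).sub (hx i)).abs
      ((hx j).sub (hx i)).abs))
  have hcard : Measurable fun x : Fin n → ℝ => (Finset.univ.filter fun k => k ≠ i ∧
      (0 ≤ x k ↔ 0 ≤ x i) ∧ |x k - x i| < |x j - x i|).card := by
    simp_rw [Finset.card_filter]
    exact Finset.measurable_sum _ fun k _ =>
      Measurable.ite (hclose k) measurable_const measurable_const
  have e : {x : Fin n → ℝ | j ∈ neighbors R x i} = {x | j ≠ i} ∩ ({x | 0 ≤ x j ↔ 0 ≤ x i} ∩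
      {x | (Finset.univ.filter fun k => k ≠ i ∧ (0 ≤ x k ↔ 0 ≤ x i) ∧
        |x k - x i| < |x j - x i|).card < R}) := by
    ext x
    simp only [neighbors, mem_ofPred_eq, Finset.mem_filter, Finset.mem_univ, true_and, mem_inter_iff]
  rw [e]
  exact (MeasurableSet.const _).inter ((hside j).inter (measurableSet_lt hcard measurable_const))

lemma measurable_sum_neighbors {Ω : Type*} [MeasurableSpace Ω] (R : ℕ) {X : Ω → Fin n → ℝ}
    (hX : Measurable X) (i : Fin n) {f : Fin n → Ω → ℝ} (hf : ∀ j, Measurable (f j)) :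
    Measurable fun ω => ∑ j ∈ neighbors R (X ω) i, f j ω := by
  classical
  have e : (fun ω => ∑ j ∈ neighbors R (X ω) i, f j ω) =
      fun ω => ∑ j, if j ∈ neighbors R (X ω) i then f j ω else 0 := by
    ext ω; rw [Finset.sum_ite_mem, Finset.univ_inter]
  rw [e]
  exact Finset.measurable_sum _ fun j _ =>
    Measurable.ite (hX (measurableSet_mem_neighbors R i j)) (hf j) measurable_const

variable {D : RDDesign} {S : ℕ} (F : CrossFit D S)

lemma measurable_runX : Measurable fun (ω : Fin n → D.Obs n) i => (ω i).1 := by fun_prop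

lemma measurable_foldEst (s : Fin n → Fin S) (k : Fin S) {Ω : Type*} [MeasurableSpace Ω]
    {f : Ω → Fin n → D.Obs n} (hf : Measurable f) {z : Ω → D.Cov n} (hz : Measurable z) :
    Measurable fun ω => F.foldEst (f ω, s) k (z ω) := by
  have := F.measurable_est n (Finset.univ.filter fun i => s i ≠ k)
  exact this.comp (Measurable.prodMk (measurable_pi_lambda _ fun i =>
    (measurable_pi_apply (i : Fin n)).comp hf) hz)

lemma measurable_adjHat (s : Fin n → Fin S) (i : Fin n) :
    Measurable fun ω : Fin n → D.Obs n => F.adjHat (ω, s) i :=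
  ((measurable_fst.comp measurable_snd).comp (measurable_pi_apply i)).sub
    (measurable_foldEst F s (s i) measurable_id
      ((measurable_snd.comp measurable_snd).comp (measurable_pi_apply i)))

/-- Disintegration needs a measurable event. Neighbour sets vary measurably with the design, and the
quantile is continuous in the bias ratio. -/
lemma measurableSet_mem_ciBiasAware (hK : Measurable K) (hb : 0 < b) (R : ℕ) (BY : ℝ) {γ : ℝ}
    (h0 : 0 < γ) (h1 : γ < 1) (s : Fin n → Fin S) (τ : ℝ) :
    MeasurableSet {ω : Fin n → D.Obs n | τ ∈ F.ciBiasAware K R BY b γ (ω, s)} := by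
  have hX := measurable_runX (D := D) (n := n)
  have hw := fun i => (measurable_rdWeight hK hb i).comp hX
  have hM := measurable_adjHat F s (n := n)
  have hest : Measurable fun ω : Fin n → D.Obs n => F.tauHat K b (0 : Fin (1 + 1)) (ω, s) :=
    Finset.measurable_sum _ fun i _ => (hw i).mul (hM i)
  have hse : Measurable fun ω : Fin n → D.Obs n => F.seHat K R b (0 : Fin (1 + 1)) (ω, s) :=
    (Finset.measurable_sum _ fun i _ => ((hw i).pow_const 2).mul
      (((hM i).sub ((measurable_sum_neighbors R hX i hM).div_const _)).pow_const 2)).sqrt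
  have hsign : Measurable Real.sign := by
    unfold Real.sign
    exact Measurable.ite measurableSet_Iio measurable_const
      (Measurable.ite measurableSet_Ioi measurable_const measurable_const)
  have hbias : Measurable fun ω : Fin n → D.Obs n =>
      CrossFit.biasBound K BY b (D := D) (S := S) (ω, s) :=
    (Finset.measurable_sum _ fun i _ => ((hw i).mul
      (((measurable_pi_apply i).comp hX).pow_const 2)).mul
      (hsign.comp ((measurable_pi_apply i).comp hX))).const_mul _
  have hz := ((continuous_absNormalQuantile h0 h1).measurable.comp (hbias.div hse)).mul hse
  exact (measurableSet_le (hest.sub hz) measurable_const).inter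
    (measurableSet_le measurable_const (hest.add hz))

lemma measurable_lintegral_condLaw {Ω : Type*} [MeasurableSpace Ω] {X : Ω → ℝ} (hX : Measurable X)
    {f : Ω → ℝ × D.Cov n → ENNReal} (hf : Measurable fun p : Ω × (ℝ × D.Cov n) => f p.1 p.2) :
    Measurable fun ω => ∫⁻ z, f ω z ∂(D.condLaw n (X ω)) :=
  Measurable.lintegral_kernel_prod_right' (κ := (D.condLaw n).comap X hX) hf

lemma measurable_integral_condLaw {Ω : Type*} [MeasurableSpace Ω] {X : Ω → ℝ} (hX : Measurable X)
    {f : Ω → ℝ × D.Cov n → ℝ} (hf : Measurable fun p : Ω × (ℝ × D.Cov n) => f p.1 p.2) :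
    Measurable fun ω => ∫ z, f ω z ∂(D.condLaw n (X ω)) :=
  (StronglyMeasurable.integral_kernel_prod_right' (κ := (D.condLaw n).comap X hX)
    hf.stronglyMeasurable).measurable

/-- The first stage is accurate: in conditional mean square on the estimation window, and on
average over each fold. -/
def AccurateFirstStage (K : ℝ → ℝ) (b c c' : ℝ) (ηbar : D.Cov n → ℝ) (s : Fin n → Fin S)
    (ω : Fin n → D.Obs n) : Prop :=
  ∀ k, (∀ i, |(ω i).1| ≤ b → ∫⁻ z, ENNReal.ofReal ((F.foldEst (ω, s) k z.2 - ηbar z.2) ^ 2)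
      ∂(D.condLaw n (ω i).1) ≤ ENNReal.ofReal c) ∧
    |∑ i with s i = k, rdWeight K b (0 : Fin (1 + 1)) (fun i => (ω i).1) i *
      ∫ z, (F.foldEst (ω, s) k z.2 - ηbar z.2) ∂(D.condLaw n (ω i).1)| ≤ c'

/-- Membership of the estimate in `T n` need not be a measurable event. Its consequence for
conditional moments is one, and the conditional argument runs on that. -/
lemma measurableSet_accurateFirstStage (hK : Measurable K) (hb : 0 < b) (c c' : ℝ)
    {ηbar : D.Cov n → ℝ} (hη : Measurable ηbar) (s : Fin n → Fin S) :
    MeasurableSet {ω | AccurateFirstStage F K b c c' ηbar s ω} := by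
  have hd : ∀ k, Measurable fun p : (Fin n → D.Obs n) × (ℝ × D.Cov n) =>
      F.foldEst (p.1, s) k p.2.2 - ηbar p.2.2 := fun k =>
    (measurable_foldEst F s k measurable_fst (measurable_snd.comp measurable_snd)).sub
      (hη.comp (measurable_snd.comp measurable_snd))
  have hx : ∀ i : Fin n, Measurable fun ω : Fin n → D.Obs n => (ω i).1 := fun i =>
    measurable_fst.comp (measurable_pi_apply i)
  have hw := fun i => (measurable_rdWeight hK hb i).comp (measurable_runX (D := D) (n := n))
  have e : {ω : Fin n → D.Obs n | AccurateFirstStage F K b c c' ηbar s ω} =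
      ⋂ k, ((⋂ i, ({ω | |(ω i).1| ≤ b}ᶜ ∪
        {ω | ∫⁻ z, ENNReal.ofReal ((F.foldEst (ω, s) k z.2 - ηbar z.2) ^ 2)
          ∂(D.condLaw n (ω i).1) ≤ ENNReal.ofReal c})) ∩
      {ω | |∑ i with s i = k, rdWeight K b (0 : Fin (1 + 1)) (fun i => (ω i).1) i *
      ∫ z, (F.foldEst (ω, s) k z.2 - ηbar z.2) ∂(D.condLaw n (ω i).1)| ≤ c'}) := by
    ext ω
    simp only [AccurateFirstStage, mem_ofPred_eq, mem_iInter, mem_inter_iff, mem_union,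
      mem_compl_iff, imp_iff_not_or]
  rw [e]
  refine MeasurableSet.iInter fun k => (MeasurableSet.iInter fun i => ?_).inter ?_
  · exact (measurableSet_le (hx i).abs measurable_const).compl.union
      (measurableSet_le (measurable_lintegral_condLaw (hx i)
        ((hd k).pow_const 2).ennreal_ofReal) measurable_const)
  · exact measurableSet_le (Finset.measurable_sum _ fun i _ => (hw i).mul
      (measurable_integral_condLaw (hx i) (hd k))).abs measurable_const

end Measurability

/-! ### Coverage of the bias-aware interval -/

section Coverage

variable {D : RDDesign} {S : ℕ} {F : CrossFit D S} {T : (n : ℕ) → Set (D.Cov n → ℝ)}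
  {ηbar : (n : ℕ) → D.Cov n → ℝ} {K : ℝ → ℝ} {h : ℕ → ℝ} {R : ℕ} {BY γ : ℝ}

/-- Under undersmoothing or optimal bandwidths the squared bandwidth is of the order of the inverse
root of the effective sample size. -/
lemma exists_bandwidth_sq_le (hReg : Regularity D h K)
    (hBand : (fun n : ℕ => (n : ℝ) * h n ^ 5) =O[atTop] (fun _ => (1 : ℝ))) :
    ∃ c > 0, ∀ᶠ n in atTop, h n ^ 2 ≤ c / √(n * h n) := by
  obtain ⟨c, hc⟩ := hBand.bound
  refine ⟨√(|c| + 1), by positivity, ?_⟩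
  filter_upwards [hc, hReg.effective_size.eventually_gt_atTop 0] with n hn hN
  have hb := hReg.bandwidth_pos n
  rw [le_div_iff₀ (Real.sqrt_pos.2 hN)]
  -- h² √(n h) = √(n h⁵), which is bounded.
  have e : h n ^ 2 * √(n * h n) = √(n * h n ^ 5) := by
    have : (n : ℝ) * h n ^ 5 = (h n ^ 2) ^ 2 * (n * h n) := by ring
    rw [this, Real.sqrt_mul (sq_nonneg (h n ^ 2)), Real.sqrt_sq (sq_nonneg (h n))]
  rw [e]
  refine Real.sqrt_le_sqrt ?_
  rw [norm_one, mul_one] at hn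
  exact (le_abs_self _).trans (hn.trans ((le_abs_self c).trans (by linarith)))

/-- Given a regular design and an accurate first stage, the interval undercovers by at most `d`. -/
lemma eventually_conditional_noncoverage_le (h0 : 1 / 2 ≤ γ) (h1 : γ < 1) (hR : 1 ≤ R)
    (hFirst : FirstStage D F T ηbar (fun n => D.suppXh (h n)))
    (hReg : Regularity D h K) (hMom : MomentRegularity D ηbar)
    (hSE : StdErrConditions D F T ηbar h) (hBY : OutcomeCurvatureBound D BY)
    (hBand : (fun n : ℕ => (n : ℝ) * h n ^ 5) =O[atTop] (fun _ => (1 : ℝ)))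
    {Cw : ℝ} (hCw : 0 < Cw) {d : ℝ} (hd : 0 < d) :
    ∃ ε > 0, ∃ η₀ > 0, ∀ᶠ n in atTop, ∀ (s : Fin n → Fin S) (ρ η : ℝ) (x : Fin n → ℝ), η ≤ η₀ →
      GoodDesign D K (h n) η ρ Cw s x → Measure.pi (fun i => D.condLaw n (x i))
        {y | (fun i => (x i, y i)) ∈ {ω : Fin n → D.Obs n |
          AccurateFirstStage F K (h n) (ε ^ 4) (ε / √(n * h n)) (ηbar n) s ω ∧
          D.tau n ∉ F.ciBiasAware K R BY (h n) γ (ω, s)}} ≤ ENNReal.ofReal (1 - γ + d) := by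
  obtain ⟨⟨A, hA, hFS, B, hB⟩, L', hL'⟩ := hSE
  obtain ⟨δ₀, hδ₀, L, hL, Cm, hexp⟩ := D.exists_adjMean_expansion hReg
    (fun n => hFirst.admissible n _ (hFirst.bar_mem n)) hMom hBY
  obtain ⟨C, hC, L₂, q, hq, hM⟩ := hMom
  have hBY0 : 0 ≤ BY := by
    obtain ⟨a, b, c, a', b', c', m, -, hc, -⟩ := hexp 0
    exact (abs_nonneg _).trans hc
  have hCm0 : 0 ≤ Cm := by
    obtain ⟨a, b, c, a', b', c', m, -, -, -, hm, -⟩ := hexp 0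
    exact (abs_nonneg _).trans hm
  obtain ⟨cB, hcB, hband⟩ := exists_bandwidth_sq_le hReg hBand
  obtain ⟨W, hW, η₁, hη₁, HW⟩ := exists_weightBounds hReg
  set Kb := BY * (Cw * W) * cB with hKb
  obtain ⟨ε, hε, N₀, hN₀, H⟩ := exists_noncoverage_le h0 h1 hC hCw hW.le (le_max_right B 0)
    (by positivity : 0 ≤ Kb) S hR hd
  -- Makes the uncancelled curvature term Cm κ h² / 2 at most half of ε / √(n h).
  set κ := ε / ((Cm + 1) * cB) with hκ
  obtain ⟨η₂, hη₂, Hκ⟩ := exists_kCurv_sub_le hReg (by positivity : 0 < κ)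
  obtain ⟨η₃, hη₃, Hnb⟩ := eventually_card_neighbors hReg R
  have ev1 : ∀ᶠ n in atTop, 2 * L * h n * (Cw * W) * cB < ε / 2 := by
    have : Tendsto (fun n => 2 * L * h n * (Cw * W) * cB) atTop (𝓝 (2 * L * 0 * (Cw * W) * cB)) :=
      ((hReg.bandwidth_zero.const_mul _).mul_const _).mul_const _
    exact this.eventually_lt_const (by simpa using hε)
  have ev2 : ∀ᶠ n in atTop, |L'| * (2 * h n) < ε := by
    have : Tendsto (fun n => |L'| * (2 * h n)) atTop (𝓝 (|L'| * (2 * 0))) :=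
      (hReg.bandwidth_zero.const_mul _).const_mul _
    exact this.eventually_lt_const (by simpa using hε)
  refine ⟨ε, hε, min η₁ (min η₂ η₃), by positivity, ?_⟩
  filter_upwards [hband, Hnb, ev1, ev2, hReg.effective_size.eventually_ge_atTop N₀,
    hReg.bandwidth_zero.eventually_lt_const hδ₀] with n hband Hnb ev1 ev2 hN hδn s ρ η x hη hG
  have hb := hReg.bandwidth_pos n
  have hNp : 0 < (n : ℝ) * h n := lt_of_lt_of_le hN₀ hN
  have hWB := HW hG hb hNp (hη.trans (min_le_left _ _))
  have hκb := Hκ hG hNp (hη.trans ((min_le_right _ _).trans (min_le_left _ _)))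
  have hnb := Hnb hG (hη.trans ((min_le_right _ _).trans (min_le_right _ _)))
  obtain ⟨hint, -, -, -, -, -, hvar⟩ := hM n
  have hbm := (hFirst.admissible n _ (hFirst.bar_mem n)).1
  have hmodel := conditionalModel_of_goodDesign (R := R) hG hWB hb hNp hCw hReg.kernel_zero hbm hint
    (B := max B 0) (fun t ht => (hB n _ (hFirst.bar_mem n) t ⟨ht.1, (hA n).2 ht⟩).trans
      (ENNReal.ofReal_le_ofReal (le_max_left _ _))) hvar hnb (hL' n).1 ev2.le
  obtain ⟨a₁, b₁, c₁, a₂, b₂, c₂, m, hτ, hc₁, hc₂, hm, he₁, he₂⟩ := hexp n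
  have hbias := hWB.abs_bias_le hb hNp hW.le hReg.kernel_nonneg hReg.kernel_zero
    (fun i => (hG.mem i).2) hL (fun t ht htb => he₁ t ht (htb.trans hδn.le))
    (fun t ht htb => he₂ t ht (by linarith)) hc₁ hc₂ hm hκb
  rw [← hτ] at hbias
  set bb := -(BY / 2) * ∑ i, rdWeight K (h n) (0 : Fin (1 + 1)) x i * x i ^ 2 * Real.sign (x i)
    with hbb
  have hk₁ := hWB.kCurv_nonpos hReg.kernel_nonneg true
  have hk₂ := hWB.kCurv_nonpos hReg.kernel_nonneg false
  have hbb' : bb = BY / 2 * h n ^ 2 * (-kCurv K (h n) (side true) x - kCurv K (h n) (side false) x) := by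
    rw [hbb, WeightBounds.bias_sum_eq hb hReg.kernel_zero]; ring
  have hbb0 : 0 ≤ bb := by
    rw [hbb']; exact mul_nonneg (by positivity) (by linarith)
  have hbbK : bb ≤ Kb / √(n * h n) := by
    have q1 := (abs_le.1 (hWB.abs_kCurv_le hb hNp hW.le hReg.kernel_zero true)).1
    have q2 := (abs_le.1 (hWB.abs_kCurv_le hb hNp hW.le hReg.kernel_zero false)).1
    rw [hbb']
    calc _ ≤ BY / 2 * h n ^ 2 * (2 * (Cw * W)) :=
          mul_le_mul_of_nonneg_left (by linarith) (by positivity)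
      _ = BY * (Cw * W) * h n ^ 2 := by ring
      _ ≤ BY * (Cw * W) * (cB / √(n * h n)) := mul_le_mul_of_nonneg_left hband (by positivity)
      _ = _ := by rw [hKb]; ring
  have hrem : (Cm * κ / 2 + 2 * L * h n * (Cw * W)) * h n ^ 2 ≤ ε / √(n * h n) := by
    calc _ ≤ (Cm * κ / 2 + 2 * L * h n * (Cw * W)) * (cB / √(n * h n)) :=
          mul_le_mul_of_nonneg_left hband (by positivity)
      _ = (Cm * κ * cB / 2 + 2 * L * h n * (Cw * W) * cB) / √(n * h n) := by ring
      _ ≤ _ := by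
          refine div_le_div_of_nonneg_right ?_ (Real.sqrt_nonneg _)
          have : Cm * κ * cB ≤ ε := by
            have e : Cm * κ * cB = ε * (Cm / (Cm + 1)) := by rw [hκ]; field_simp
            rw [e]
            exact mul_le_of_le_one_right hε.le ((div_le_one (by positivity)).2 (by linarith))
          linarith
  have hbias' := hbias.trans (add_le_add le_rfl hrem)
  -- The first-stage error as a function of the outcomes alone, with the running variable frozen at
  -- `x`.
  set g : (k : Fin S) → ({i // i ∈ Finset.univ.filter fun i => s i ≠ k} → ℝ × D.Cov n) →
      ℝ × D.Cov n → ℝ := fun k u z =>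
    F.est n (Finset.univ.filter fun i => s i ≠ k) (fun i => (x i, u i)) z.2 - ηbar n z.2 with hg
  have hgm : ∀ k, Measurable fun p : ({i // i ∈ Finset.univ.filter fun i => s i ≠ k} →
      ℝ × D.Cov n) × (ℝ × D.Cov n) => g k p.1 p.2 := fun k => by
    refine Measurable.sub ?_ (hbm.comp (measurable_snd.comp measurable_snd))
    have := F.measurable_est n (Finset.univ.filter fun i => s i ≠ k)
    refine this.comp (Measurable.prodMk (measurable_pi_lambda _ fun i => ?_)
      (measurable_snd.comp measurable_snd))
    exact measurable_const.prodMk ((measurable_pi_apply i).comp measurable_fst)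
  refine (measure_mono ?_).trans (H hN hmodel s hgm hbb0 hbbK hbias')
  rintro y ⟨hacc, hcov⟩
  have hadj : ∀ i, D.adj (ηbar n) (y i) - g (s i) (fun j => y j) (y i) =
      F.adjHat ((fun i => (x i, y i), s) : Sample D S n) i := fun i => by
    simp only [hg, RDDesign.adj, CrossFit.adjHat, CrossFit.foldEst]; ring
  refine ⟨fun k => ⟨fun i hi => (hacc k).1 i (mem_window.1 hi), (hacc k).2⟩, fun t s' ht hs' => ?_⟩
  simp only [hadj] at ht hs'
  subst ht hs'
  exact hcov

/-- On a regular design, admissible first-stage estimates are accurate. -/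
lemma eventually_accurateFirstStage (hFirst : FirstStage D F T ηbar (fun n => D.suppXh (h n)))
    (hDeriv : Derivatives D T ηbar h 2) (hReg : Regularity D h K)
    (hBand : (fun n : ℕ => (n : ℝ) * h n ^ 5) =O[atTop] (fun _ => (1 : ℝ)))
    {Cw ρ ε : ℝ} (hε : 0 < ε) : ∃ η₀ > 0, ∀ᶠ n in atTop, ∀ (s : Fin n → Fin S) (η : ℝ)
      (ω : Fin n → D.Obs n), η ≤ η₀ →
      GoodDesign D K (h n) η (ρ / √(n * h n)) Cw s (fun i => (ω i).1) →
      (∀ k, F.foldEst (ω, s) k ∈ T n) →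
      AccurateFirstStage F K (h n) (ε ^ 4) (ε / √(n * h n)) (ηbar n) s ω := by
  obtain ⟨v, hv0, hv, hcov⟩ := D.exists_covMean_expansion hReg hFirst hDeriv
  obtain ⟨cB, hcB, hband⟩ := exists_bandwidth_sq_le hReg hBand
  obtain ⟨W, hW, η₁, hη₁, HW⟩ := exists_weightBounds hReg
  obtain ⟨r, hr, c, hrate⟩ := hFirst.rate
  have ev1 : ∀ᶠ n in atTop, c * r n ^ 2 < ε ^ 4 := by
    have : Tendsto (fun n => c * r n ^ 2) atTop (𝓝 (c * 0 ^ 2)) := (hr.pow 2).const_mul _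
    exact this.eventually_lt_const (by simpa using pow_pos hε 4)
  -- Fold imbalance and squared bandwidth are both O((n h)^(-1/2)), and both multiply the vanishing
  -- `v n`.
  have ev2 : ∀ᶠ n in atTop, v n * (4 * W * ρ * (1 + h n) + 2 * (Cw * W) * cB) < ε := by
    have : Tendsto (fun n => v n * (4 * W * ρ * (1 + h n) + 2 * (Cw * W) * cB)) atTop
        (𝓝 (0 * (4 * W * ρ * (1 + 0) + 2 * (Cw * W) * cB))) :=
      hv.mul (((hReg.bandwidth_zero.const_add _).const_mul _).add_const _)
    exact this.eventually_lt_const (by simpa using hε)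
  refine ⟨η₁, hη₁, ?_⟩
  filter_upwards [hcov, hband, hrate, ev1, ev2, hReg.effective_size.eventually_gt_atTop 0] with
    n hcov hband hrate ev1 ev2 hN s η ω hη hG hT k
  have hb := hReg.bandwidth_pos n
  have hWB := HW hG hb hN hη
  refine ⟨fun i hi => (hrate _ (hT k) _ ⟨(hG.mem i).1, abs_le.1 hi⟩).trans
    (ENNReal.ofReal_le_ofReal ev1.le), ?_⟩
  obtain ⟨α₀, α₁, h₀, h₁, hf⟩ := hcov _ (hT k)
  have hCW : 0 ≤ Cw * W := (abs_nonneg _).trans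
    (hWB.abs_kCurv_le hb hN hW.le hReg.kernel_zero true)
  refine (hWB.abs_fold_sum_le hb hN hW.le hReg.kernel_zero (fun i => (hG.mem i).2)
    (fun p m hm => hG.fold p k m hm) h₀ h₁ hf).trans ?_
  have e : v n * (4 * W * (ρ / √(n * h n)) * (1 + h n) + 2 * (Cw * W) * (cB / √(n * h n))) =
      v n * (4 * W * ρ * (1 + h n) + 2 * (Cw * W) * cB) / √(n * h n) := by ring
  calc _ ≤ v n * (4 * W * (ρ / √(n * h n)) * (1 + h n) + 2 * (Cw * W) * (cB / √(n * h n))) := by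
        have := hv0 n
        gcongr
    _ ≤ _ := by rw [e]; exact div_le_div_of_nonneg_right ev2.le (Real.sqrt_nonneg _)

/-- For every split of the sample, the interval undercovers by at most `d` when the first stage
is admissible. -/
lemma eventually_noncoverage_fold_le (h0 : 1 / 2 ≤ γ) (h1 : γ < 1) (hR : 1 ≤ R)
    (hFirst : FirstStage D F T ηbar (fun n => D.suppXh (h n)))
    (hDeriv : Derivatives D T ηbar h 2)
    (hReg : Regularity D h K) (hMom : MomentRegularity D ηbar)
    (hSE : StdErrConditions D F T ηbar h) (hBY : OutcomeCurvatureBound D BY)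
    (hBand : (fun n : ℕ => (n : ℝ) * h n ^ 5) =O[atTop] (fun _ => (1 : ℝ)))
    {d : ℝ} (hd : 0 < d) : ∀ᶠ n in atTop, ∀ s : Fin n → Fin S,
      Measure.pi (fun _ : Fin n => D.obsLaw n) {ω | (∀ k, F.foldEst (ω, s) k ∈ T n) ∧
        D.tau n ∉ F.ciBiasAware K R BY (h n) γ (ω, s)} ≤ ENNReal.ofReal (1 - γ + 3 * d) := by
  obtain ⟨Cw, hCw, hgood⟩ := exists_goodDesign_prob hReg S
  obtain ⟨ε, hε, η₁, hη₁, H₁⟩ := eventually_conditional_noncoverage_le h0 h1 hR hFirst hReg hMom hSE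
    hBY hBand hCw hd
  -- `Cw` does not depend on `d`, so ε could be chosen before ρ; η comes last, small enough for both
  -- bounds.
  obtain ⟨ρ, hρ, hgood⟩ := hgood d hd
  obtain ⟨η₂, hη₂, H₂⟩ := eventually_accurateFirstStage (Cw := Cw) (ρ := ρ) hFirst hDeriv hReg hBand hε
  filter_upwards [H₁, H₂, hgood (min η₁ η₂) (lt_min hη₁ hη₂)] with n H₁ H₂ hgood s
  set G : Set (Fin n → ℝ) := {x | GoodDesign D K (h n) (min η₁ η₂) (ρ / √(n * h n)) Cw s x}
  set Q : Set (Fin n → D.Obs n) := {ω |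
    AccurateFirstStage F K (h n) (ε ^ 4) (ε / √(n * h n)) (ηbar n) s ω ∧
      D.tau n ∉ F.ciBiasAware K R BY (h n) γ (ω, s)}
  have hQ : MeasurableSet Q := by
    have hb := hReg.bandwidth_pos n
    exact (measurableSet_accurateFirstStage F hReg.kernel_measurable hb _ _
      (hFirst.admissible n _ (hFirst.bar_mem n)).1 s).inter
      (measurableSet_mem_ciBiasAware F hReg.kernel_measurable hb R BY (by linarith) h1 s _).compl
  have m1 := measure_pi_compProd_le D.lawX (D.condLaw n) hQ G (ENNReal.ofReal (1 - γ + d))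
    fun x hx => H₁ s _ _ x (min_le_left _ _) hx
  have m2 := measure_pi_compProd_ge D.lawX (D.condLaw n) Gᶜ
  have hG := hgood s
  -- Bad designs are paid for twice, in the disintegration and where admissibility is turned into
  -- accuracy; with the conditional slack this makes 3d.
  refine (measure_mono (t := Q ∪ {ω | (fun i => (ω i).1) ∈ Gᶜ}) ?_).trans
    ((measure_union_le _ _).trans ((add_le_add m1 m2).trans ?_))
  · rintro ω ⟨hT, hcov⟩
    by_cases hx : (fun i => (ω i).1) ∈ G
    · exact Or.inl ⟨H₂ s _ ω (min_le_right _ _) hx hT, hcov⟩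
    · exact Or.inr hx
  · refine (add_le_add (add_le_add le_rfl hG) hG).trans_eq ?_
    rw [← ENNReal.ofReal_add (by linarith) hd.le, ← ENNReal.ofReal_add (by linarith) hd.le]
    congr 1
    ring

/-- Asymptotic coverage of the bias-aware interval at any quantile level `γ ≥ 1 / 2`. -/
theorem exists_coverage_ge (h0 : 1 / 2 ≤ γ) (h1 : γ < 1) (hR : 1 ≤ R)
    (hFirst : FirstStage D F T ηbar (fun n => D.suppXh (h n)))
    (hDeriv : Derivatives D T ηbar h 2)
    (hReg : Regularity D h K) (hMom : MomentRegularity D ηbar)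
    (hSE : StdErrConditions D F T ηbar h) (hBY : OutcomeCurvatureBound D BY)
    (hBand : (fun n : ℕ => (n : ℝ) * h n ^ 5) =O[atTop] (fun _ => (1 : ℝ))) :
    ∃ e : ℕ → ℝ, Tendsto e atTop (𝓝 0) ∧ ∀ n : ℕ, γ + e n ≤
      (F.sampleLaw n).real {ω | D.tau n ∈ F.ciBiasAware K R BY (h n) γ ω} := by
  set P : ℕ → ℝ := fun n =>
    (F.sampleLaw n).real {ω | D.tau n ∈ F.ciBiasAware K R BY (h n) γ ω}
  have key : ∀ d > 0, ∀ᶠ n in atTop, γ - 4 * d ≤ P n := by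
    intro d hd
    have hmem : ∀ᶠ n in atTop, ∑ k, F.sampleLaw n {ω | F.foldEst ω k ∉ T n} ≤ ENNReal.ofReal d := by
      have : Tendsto (fun n => ∑ k, F.sampleLaw n {ω | F.foldEst ω k ∉ T n}) atTop
          (𝓝 (∑ _k : Fin S, 0)) := tendsto_finsetSum _ fun k _ => hFirst.mem k
      rw [Finset.sum_const_zero] at this
      exact (this.eventually (gt_mem_nhds (by simpa using hd))).mono fun _ => le_of_lt
    filter_upwards [hmem, eventually_noncoverage_fold_le h0 h1 hR hFirst hDeriv hReg hMom hSE hBY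
      hBand hd] with n hmem hfold
    set V : Set (Sample D S n) := {ω | D.tau n ∈ F.ciBiasAware K R BY (h n) γ ω}
    set Q : (Fin n → Fin S) → Set (Fin n → D.Obs n) := fun s =>
      {ω | (∀ k, F.foldEst (ω, s) k ∈ T n) ∧ D.tau n ∉ F.ciBiasAware K R BY (h n) γ (ω, s)}
    have hsub : Vᶜ ⊆ (⋃ k, {ω | F.foldEst ω k ∉ T n}) ∪ ⋃ s, Q s ×ˢ {s} := by
      rintro ⟨ω, s⟩ hω
      by_cases hT : ∀ k, F.foldEst (ω, s) k ∈ T n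
      · exact Or.inr (mem_iUnion.2 ⟨s, ⟨hT, hω⟩, rfl⟩)
      · push Not at hT
        exact Or.inl (mem_iUnion.2 hT)
    -- There are finitely many splits and their law has total mass one, so a bound uniform over
    -- splits survives averaging.
    have hs : ∑ s, F.sampleLaw n (Q s ×ˢ {s}) ≤ ENNReal.ofReal (1 - γ + 3 * d) := by
      calc _ = ∑ s, Measure.pi (fun _ : Fin n => D.obsLaw n) (Q s) * F.foldLaw n {s} :=
            Finset.sum_congr rfl fun s _ => Measure.prod_prod _ _
        _ ≤ ∑ s, ENNReal.ofReal (1 - γ + 3 * d) * F.foldLaw n {s} :=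
            Finset.sum_le_sum fun s _ => mul_le_mul_left (hfold s) _
        _ = ENNReal.ofReal (1 - γ + 3 * d) := by
            rw [← Finset.mul_sum, sum_measure_singleton, Finset.coe_univ, measure_univ, mul_one]
    have hV : F.sampleLaw n Vᶜ ≤ ENNReal.ofReal (1 - γ + 4 * d) := by
      refine (measure_mono hsub).trans ((measure_union_le _ _).trans ((add_le_add
        ((measure_iUnion_fintype_le _ _).trans hmem)
        ((measure_iUnion_fintype_le _ _).trans hs)).trans_eq ?_))
      rw [← ENNReal.ofReal_add hd.le (by linarith)]
      congr 1
      ring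
    have h2 : 1 ≤ P n + (F.sampleLaw n).real Vᶜ := by
      have := measureReal_union_le (μ := F.sampleLaw n) V Vᶜ
      rwa [union_compl_self, probReal_univ] at this
    have h3 : (F.sampleLaw n).real Vᶜ ≤ 1 - γ + 4 * d :=
      ENNReal.toReal_le_of_le_ofReal (by linarith) hV
    linarith
  -- Only undercoverage matters, so the remainder is the coverage error cut off at zero from above.
  refine ⟨fun n => min 0 (P n - γ), ?_, fun n => ?_⟩
  · rw [Metric.tendsto_nhds]
    intro ε hε
    filter_upwards [key (ε / 8) (by positivity)] with n hn
    rw [Real.dist_eq, sub_zero, abs_of_nonpos (min_le_left _ _), neg_lt]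
    exact lt_min (by linarith) (by linarith)
  · have := min_le_right 0 (P n - γ)
    linarith

end Coverage

end

/-! ### The coverage statement. -/

theorem mainTheorem9 (D : RDDesign) (S : ℕ) (hS : 1 ≤ S) (F : CrossFit D S)
    (T : (n : ℕ) → Set (D.Cov n → ℝ)) (ηbar : (n : ℕ) → D.Cov n → ℝ)
    (K : ℝ → ℝ) (h : ℕ → ℝ) (R : ℕ) (hR : 1 ≤ R) (BY : ℝ) (α : ℝ) (hα : α ∈ Set.Ioo (0 : ℝ) 1)
    (hFirst : FirstStage D F T ηbar (fun n => D.suppXh (h n)))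
    (hDeriv : Derivatives D T ηbar h 2)
    (hReg : Regularity D h K)
    (hMom : MomentRegularity D ηbar)
    (hNN : NeighborCondition D F ηbar h K R 1)
    (hSE : StdErrConditions D F T ηbar h)
    (hBY : OutcomeCurvatureBound D BY)
    (hBand : (fun n : ℕ => (n : ℝ) * h n ^ 5) =O[Filter.atTop] (fun _ => (1 : ℝ))) :
    (∃ e : ℕ → ℝ, Filter.Tendsto e Filter.atTop (nhds 0) ∧ ∀ n : ℕ, 1 - α + e n ≤
      (F.sampleLaw n).real {ω | D.tau n ∈ F.ciBiasAware K R BY (h n) (1 - α / 2) ω}) ∧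
    (α ≤ 1 / 2 → ∃ e : ℕ → ℝ, Filter.Tendsto e Filter.atTop (nhds 0) ∧ ∀ n : ℕ, 1 - α + e n ≤
      (F.sampleLaw n).real {ω | D.tau n ∈ F.ciBiasAware K R BY (h n) (1 - α) ω}) := by
  obtain ⟨hα0, hα1⟩ := hα
  refine ⟨?_, fun hα2 => ?_⟩
  -- The level 1 - α/2 exceeds 1/2 for every α < 1, and it exceeds 1 - α.
  · obtain ⟨e, he, hcov⟩ := exists_coverage_ge (γ := 1 - α / 2) (by linarith) (by linarith) hR hFirst
      hDeriv hReg hMom hSE hBY hBand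
    exact ⟨e, he, fun n => le_trans (by linarith) (hcov n)⟩
  -- Here α ≤ 1/2 says exactly that the level is at least 1/2.
  · exact exists_coverage_ge (by linarith) (by linarith) hR hFirst hDeriv hReg hMom hSE hBY hBand
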